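/- Let $\mathcal T=(\mathbb T,\mathsf V,\xi)$ be a strict topological theory: $\mathbb T=(T,e,m)$ is a monad on $\mathbf{Set}$ such that $T$ preserves weak pullbacks and every naturality square of $m$ is a weak pullback; $\mathsf V=(\mathsf V,\otimes,k)$ is a commutative unital quantale with $\bot\neq k$; $\xi:T\mathsf V\to\mathsf V$ is a $\mathbb T$-algebra structure for which $\otimes$ and $k$ are $\mathbb T$-homomorphisms, and $\varphi\mapsto\xi\cdot T\varphi$ is monotone and natural with respect to direct images. Assume moreover that $T1=1$. For a $\mathsf V$-relation $r:X\times Y\to\mathsf V$ put $T_\xi r(\mathfrak x,\mathfrak y)=\bigvee\{\xi\cdot Tr(\mathfrak w)\mid T\pi_1\mathfrak w=\mathfrak x,\ T\pi_2\mathfrak w=\mathfrak y\}$. A $\mathcal T$-relation $\alpha:X\rightharpoonup Y$ is a map $\alpha:TX\times Y\to\mathsf V$; put $\hat\alpha=T_\xi\alpha\cdot m^\circ$ and $\beta\circ\alpha=\beta\cdot\hat\alpha$. A $\mathcal T$-category is a set $X$ with $a:TX\times X\to\mathsf V$ such that $k\le a(e(x),x)$ and $T_\xi a(\mathfrak X,\mathfrak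 x)\otimes a(\mathfrak x,x)\le a(m(\mathfrak X),x)$; a $\mathcal T$-functor $f:(X,a)\to(Y,b)$ satisfies $a(\mathfrak x,x)\le b(Tf\mathfrak x,fx)$; a $\mathcal T$-distributor $\varphi:X\rightharpoonup Y$ is a $\mathcal T$-relation with $\varphi\circ a\le\varphi$ and $b\circ\varphi\le\varphi$. Put $a_0(x,y)=a(e(x),y)$, $f_\circledast(\mathfrak x,y)=b(Tf\mathfrak x,y)$ and $f^\circledast(\mathfrak y,x)=b(\mathfrak y,fx)$. $\mathcal T$-functors are ordered by $f\le g$ iff $k\le b_0(fx,gx)$ for all $x$; $X$ is separated if $f\simeq g$ implies $f=g$ for all $\mathcal T$-functors with codomain $X$. Write $G=(1,e_1^\circ)$, and $TX=(TX,\hat a\cdot m)$. $X$ is representable if $e_X:X\to TX$ has a left adjoint $\alpha:TX\to X$ in $\mathbf{Cat}(\mathcal T)$; a pseudo-homomorphism is a $\mathcal T$-functor $f$ with $\beta\cdot Tf\simeq f\cdot\alpha$. These form $\mathbf{Repr}(\mathcal T)$. The dual of a representable $X$ is $X^{\mathrm{op}}=(X,a_0^\circ\cdot\alpha)$. Let $\mathsf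 V=(\mathsf V,\hom_\xi)$ with $\hom_\xi(\mathfrak v,v)=\hom(\xi\mathfrak v,v)$, let $PX=\mathsf V^{(TX)^{\mathrm{op}}}$ (exponential in $\mathcal T$-categories) with $y_X:X\to PX$, $x\mapsto a(-,x)$, and for $X$ representable let $VX=(\mathsf V^X)^{\mathrm{op}}$ with $y_X:X\to VX$, $x\mapsto a_0(x,-)$. These underlie the monad $\mathbb P$ on $\mathcal T$-categories ($Pf=-\circ f^\circledast$, multiplication $-\circ(y_X)_\circledast$) and the enriched Vietoris monad $\mathbb V$ on representable $\mathcal T$-categories ($Vf=f_\circledast\circ-$, multiplication $y_X^\circledast\circ-$). A $\mathcal T$-category $X$ is totally cocomplete if $y_X:X\to PX$ has a left adjoint in $\mathbf{Cat}(\mathcal T)$; a representable $X$ is totally complete if $y_X:X\to VX$ has a right adjoint in $\mathbf{Repr}(\mathcal T)$. A colimit of a $\mathcal T$-functor $d:D\to X$ weighted by a $\mathcal T$-distributor $\varphi:D\rightharpoonup A$ is a $\mathcal T$-functor $g:A\to X$ such that $g_\circledast$ is the extension of $d_\circledast$ along $\varphi$, i.e. $g_\circledast(\mathfrak a,x)=\bigwedge_{\mathfrak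 d}\hom(\hat\varphi(\mathfrak d,\mathfrak a),d_\circledast(\mathfrak d,x))$; a limit of $h:A\to X$ weighted by $\varphi:G\rightharpoonup A$ is an $x_0\in X$ with $a(\mathfrak x,x_0)=\bigwedge_{z\in A}\hom(\varphi(z),a(\mathfrak x,hz))$ for all $\mathfrak x\in TX$. $\mathbf{Cocts}(\mathcal T)$ is the category of totally cocomplete $\mathcal T$-categories and weighted colimit preserving $\mathcal T$-functors, $\mathbf{Cts}(\mathcal T)$ that of totally complete representable $\mathcal T$-categories and weighted limit preserving pseudo-homomorphisms. **Theorem.** 1. A representable $\mathcal T$-category $X$ is totally cocomplete if and only if $X^{\mathrm{op}}$ is totally complete. 2. Every totally cocomplete $\mathcal T$-category is representable, and taking duals (and leaving maps unchanged) defines an equivalence of categories $(-)^{\mathrm{op}}:\mathbf{Cocts}(\mathcal T)\to\mathbf{Cts}(\mathcal T)$ which commutes with the forgetful functors to $\mathbf{Set}$. 3. This functor restricts to an equivalence between the full subcategories of separated objects, and taking duals also induces an equivalence, commuting with the forgetful functors to $\mathbf{Set}$, of Eilenberg–Moore categories $$(\mathbf{Cat}(\mathcal T)_{\mathrm{sep}})^{\mathbb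 P}\simeq(\mathbf{Repr}(\mathcal T)_{\mathrm{sep}})^{\mathbb V}.$$ -/

import Mathlib

open CategoryTheory Quantale

universe u

set_option linter.unusedSectionVars false

/-- A square of sets `f ∘ p = g ∘ q` is a weak pullback. -/
structure IsWeakPullback {W X Y Z : Type u} (p : W → X) (q : W → Y) (f : X → Z) (g : Y → Z) :
    Prop where
  comm : ∀ w, f (p w) = g (q w)
  lift : ∀ x y, f x = g y → ∃ w, p w = x ∧ q w = y

/-- A (strict) topological theory `(T, V, ξ)`: a monad `T` on the category of sets, a
commutative unital non-trivial quantale `V` (tensor `*`, unit `1`) and a map `ξ : T V → V`. -/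
structure TopologicalTheory (V : Type u) [CommMonoid V] [CompleteLattice V] [IsQuantale V] where
  /-- the monad on the category of sets -/
  T : Monad (Type u)
  /-- the structure map on the quantale -/
  ξ : T.obj V → V
  /-- `V` is non-trivial -/
  bot_ne_one : (⊥ : V) ≠ 1
  /-- `T` preserves weak pullbacks -/
  map_weakPullback : ∀ {W X Y Z : Type u} (p : W → X) (q : W → Y) (f : X → Z) (g : Y → Z),
    IsWeakPullback p q f g →
      IsWeakPullback (T.map (↾p)) (T.map (↾q)) (T.map (↾f)) (T.map (↾g))
  /-- the naturality squares of the multiplication are weak pullbacks -/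
  mul_weakPullback : ∀ {X Y : Type u} (f : X → Y),
    IsWeakPullback (T.μ.app X) (T.map (T.map (↾f))) (T.map (↾f)) (T.μ.app Y)
  /-- `(V, ξ)` is an Eilenberg-Moore algebra: unit law -/
  ξ_unit : ∀ v : V, ξ (T.η.app V v) = v
  /-- `(V, ξ)` is an Eilenberg-Moore algebra: associativity law -/
  ξ_assoc : ∀ w : T.obj (T.obj V), ξ (T.map (↾ξ) w) = ξ (T.μ.app V w)
  /-- the tensor of `V` is a homomorphism of algebras -/
  ξ_mul : ∀ w : T.obj (V × V),
    ξ (T.map (↾(fun p : V × V => p.1 * p.2)) w) =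
      ξ (T.map (↾(Prod.fst : V × V → V)) w) * ξ (T.map (↾(Prod.snd : V × V → V)) w)
  /-- the unit of `V` is a homomorphism of algebras -/
  ξ_one : ∀ t : T.obj PUnit.{u + 1}, ξ (T.map (↾(fun _ : PUnit.{u + 1} => (1 : V))) t) = 1
  /-- the maps `φ ↦ ξ ∘ T φ` are monotone ... -/
  ξ_mono : ∀ {X : Type u} (φ ψ : X → V), φ ≤ ψ →
    ∀ 𝔵 : T.obj X, ξ (T.map (↾φ) 𝔵) ≤ ξ (T.map (↾ψ) 𝔵)
  /-- ... and natural with respect to direct images of `V`-valued maps -/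
  ξ_image : ∀ {X Y : Type u} (f : X → Y) (φ : X → V) (𝔶 : T.obj Y),
    ξ (T.map (↾(fun y : Y => ⨆ (x : X) (_ : f x = y), φ x)) 𝔶) =
      ⨆ (𝔵 : T.obj X) (_ : T.map (↾f) 𝔵 = 𝔶), ξ (T.map (↾φ) 𝔵)

namespace TopologicalTheory

variable {V : Type u} [CommMonoid V] [CompleteLattice V] [IsQuantale V] (𝕋 : TopologicalTheory V)

/-! ### The monad on functions, and the extension to `V`-relations -/

/-- The action of the monad on sets. -/
abbrev F (X : Type u) : Type u := 𝕋.T.obj X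

/-- The action of the monad on functions. -/
def map {X Y : Type u} (f : X → Y) (𝔵 : 𝕋.F X) : 𝕋.F Y := 𝕋.T.map (↾f) 𝔵

/-- The unit of the monad. -/
def e {X : Type u} (x : X) : 𝕋.F X := 𝕋.T.η.app X x

/-- The multiplication of the monad. -/
def m {X : Type u} (𝔛 : 𝕋.F (𝕋.F X)) : 𝕋.F X := 𝕋.T.μ.app X 𝔛

/-- The map `φ ↦ ξ ∘ T φ`. -/
def xi {X : Type u} (φ : X → V) (𝔵 : 𝕋.F X) : V := 𝕋.ξ (𝕋.map φ 𝔵)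

/-- The extension of the monad to `V`-relations. -/
def ext {X Y : Type u} (r : X → Y → V) (𝔵 : 𝕋.F X) (𝔶 : 𝕋.F Y) : V :=
  ⨆ (w : 𝕋.F (X × Y)) (_ : 𝕋.map Prod.fst w = 𝔵) (_ : 𝕋.map Prod.snd w = 𝔶),
    𝕋.xi (fun p : X × Y => r p.1 p.2) w

section basic

variable {W X Y Z : Type u}

theorem map_id' (𝔵 : 𝕋.F X) : 𝕋.map (fun x => x) 𝔵 = 𝔵 :=
  congrArg (fun h : 𝕋.T.obj X ⟶ 𝕋.T.obj X => h 𝔵) (𝕋.T.map_id X)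

theorem map_map (f : X → Y) (g : Y → Z) (𝔵 : 𝕋.F X) :
    𝕋.map g (𝕋.map f 𝔵) = 𝕋.map (fun x => g (f x)) 𝔵 :=
  (congrArg (fun h : 𝕋.T.obj X ⟶ 𝕋.T.obj Z => h 𝔵) (𝕋.T.map_comp (↾f) (↾g))).symm

theorem map_e (f : X → Y) (x : X) : 𝕋.map f (𝕋.e x) = 𝕋.e (f x) :=
  (congrArg (fun h : X ⟶ 𝕋.T.obj Y => h x) (𝕋.T.η.naturality (↾f))).symm

theorem map_m (f : X → Y) (𝔛 : 𝕋.F (𝕋.F X)) :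
    𝕋.map f (𝕋.m 𝔛) = 𝕋.m (𝕋.map (𝕋.map f) 𝔛) :=
  (congrArg (fun h : 𝕋.T.obj (𝕋.T.obj X) ⟶ 𝕋.T.obj Y => h 𝔛) (𝕋.T.μ.naturality (↾f))).symm

theorem m_e (𝔵 : 𝕋.F X) : 𝕋.m (𝕋.e 𝔵) = 𝔵 :=
  congrArg (fun h : 𝕋.T.obj X ⟶ 𝕋.T.obj X => h 𝔵) (𝕋.T.left_unit X)

theorem m_map_e (𝔵 : 𝕋.F X) : 𝕋.m (𝕋.map 𝕋.e 𝔵) = 𝔵 :=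
  congrArg (fun h : 𝕋.T.obj X ⟶ 𝕋.T.obj X => h 𝔵) (𝕋.T.right_unit X)

theorem m_map_m (𝔛 : 𝕋.F (𝕋.F (𝕋.F X))) : 𝕋.m (𝕋.map 𝕋.m 𝔛) = 𝕋.m (𝕋.m 𝔛) :=
  congrArg (fun h : 𝕋.T.obj (𝕋.T.obj (𝕋.T.obj X)) ⟶ 𝕋.T.obj X => h 𝔛) (𝕋.T.assoc X)

theorem exists_of_map_eq (f : X → Z) (g : Y → Z) (𝔵 : 𝕋.F X) (𝔶 : 𝕋.F Y)
    (p : W → X) (q : W → Y) (hpq : IsWeakPullback p q f g) (h : 𝕋.map f 𝔵 = 𝕋.map g 𝔶) :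
    ∃ w, 𝕋.map p w = 𝔵 ∧ 𝕋.map q w = 𝔶 :=
  (𝕋.map_weakPullback p q f g hpq).lift 𝔵 𝔶 h

theorem exists_of_m_eq (f : X → Y) (𝔵 : 𝕋.F X) (𝔜 : 𝕋.F (𝕋.F Y)) (h : 𝕋.map f 𝔵 = 𝕋.m 𝔜) :
    ∃ 𝔛, 𝕋.m 𝔛 = 𝔵 ∧ 𝕋.map (𝕋.map f) 𝔛 = 𝔜 :=
  (𝕋.mul_weakPullback f).lift 𝔵 𝔜 h

theorem xi_mono {φ ψ : X → V} (h : ∀ x, φ x ≤ ψ x) (𝔵 : 𝕋.F X) : 𝕋.xi φ 𝔵 ≤ 𝕋.xi ψ 𝔵 :=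
  𝕋.ξ_mono φ ψ h 𝔵

theorem xi_map (f : X → Y) (φ : Y → V) (𝔵 : 𝕋.F X) :
    𝕋.xi φ (𝕋.map f 𝔵) = 𝕋.xi (fun x => φ (f x)) 𝔵 := by
  rw [xi, map_map]; rfl

theorem xi_e (φ : X → V) (x : X) : 𝕋.xi φ (𝕋.e x) = φ x := by
  rw [xi, map_e]; exact 𝕋.ξ_unit _

theorem xi_m (φ : X → V) (𝔛 : 𝕋.F (𝕋.F X)) : 𝕋.xi φ (𝕋.m 𝔛) = 𝕋.xi (𝕋.xi φ) 𝔛 := by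
  rw [xi, map_m]
  refine (𝕋.ξ_assoc _).symm.trans ?_
  change 𝕋.ξ (𝕋.map 𝕋.ξ (𝕋.map (𝕋.map φ) 𝔛)) = _
  rw [map_map]; rfl

theorem xi_mul (φ ψ : X → V) (𝔵 : 𝕋.F X) :
    𝕋.xi (fun x => φ x * ψ x) 𝔵 = 𝕋.xi φ 𝔵 * 𝕋.xi ψ 𝔵 := by
  have h := 𝕋.ξ_mul (𝕋.map (fun x => (φ x, ψ x)) 𝔵)
  change 𝕋.ξ (𝕋.map _ (𝕋.map _ 𝔵)) = 𝕋.ξ (𝕋.map _ (𝕋.map _ 𝔵)) * 𝕋.ξ (𝕋.map _ (𝕋.map _ 𝔵)) at h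
  simp only [map_map] at h
  exact h

theorem xi_one (𝔵 : 𝕋.F X) : 𝕋.xi (fun _ => (1 : V)) 𝔵 = 1 := by
  have h := 𝕋.ξ_one (𝕋.map (fun _ => PUnit.unit) 𝔵)
  change 𝕋.ξ (𝕋.map _ (𝕋.map _ 𝔵)) = 1 at h
  simp only [map_map] at h
  exact h

theorem xi_image (f : X → Y) (φ : X → V) (𝔶 : 𝕋.F Y) :
    𝕋.xi (fun y : Y => ⨆ (x : X) (_ : f x = y), φ x) 𝔶 =
      ⨆ (𝔵 : 𝕋.F X) (_ : 𝕋.map f 𝔵 = 𝔶), 𝕋.xi φ 𝔵 :=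
  𝕋.ξ_image f φ 𝔶

theorem le_ext (r : X → Y → V) (w : 𝕋.F (X × Y)) :
    𝕋.xi (fun p : X × Y => r p.1 p.2) w ≤ 𝕋.ext r (𝕋.map Prod.fst w) (𝕋.map Prod.snd w) :=
  le_iSup_of_le w (le_iSup_of_le rfl (le_iSup_of_le rfl le_rfl))

/-- Every element of `T Z` gives a lower bound for the extension of a relation. -/
theorem le_ext' (r : X → Y → V) (f : Z → X) (g : Z → Y) (w : 𝕋.F Z) :
    𝕋.xi (fun z => r (f z) (g z)) w ≤ 𝕋.ext r (𝕋.map f w) (𝕋.map g w) := by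
  have h := 𝕋.le_ext r (𝕋.map (fun z => (f z, g z)) w)
  simpa only [map_map, xi_map] using h

theorem ext_le {r : X → Y → V} {𝔵 : 𝕋.F X} {𝔶 : 𝕋.F Y} {v : V}
    (h : ∀ w : 𝕋.F (X × Y), 𝕋.map Prod.fst w = 𝔵 → 𝕋.map Prod.snd w = 𝔶 →
      𝕋.xi (fun p : X × Y => r p.1 p.2) w ≤ v) : 𝕋.ext r 𝔵 𝔶 ≤ v :=
  iSup_le fun w => iSup_le fun h₁ => iSup_le fun h₂ => h w h₁ h₂

theorem ext_mono {r s : X → Y → V} (h : ∀ x y, r x y ≤ s x y) (𝔵 : 𝕋.F X) (𝔶 : 𝕋.F Y) :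
    𝕋.ext r 𝔵 𝔶 ≤ 𝕋.ext s 𝔵 𝔶 :=
  𝕋.ext_le fun w h₁ h₂ => by
    subst h₁ h₂
    exact (𝕋.xi_mono (fun p => h p.1 p.2) w).trans (𝕋.le_ext s w)

theorem ext_swap (r : X → Y → V) (𝔵 : 𝕋.F X) (𝔶 : 𝕋.F Y) :
    𝕋.ext (fun y x => r x y) 𝔶 𝔵 = 𝕋.ext r 𝔵 𝔶 := by
  apply le_antisymm
  · refine 𝕋.ext_le fun w h₁ h₂ => ?_
    subst h₁ h₂
    exact 𝕋.le_ext' r Prod.snd Prod.fst w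
  · refine 𝕋.ext_le fun w h₁ h₂ => ?_
    subst h₁ h₂
    exact 𝕋.le_ext' (fun y x => r x y) Prod.snd Prod.fst w

theorem ext_map_map {X' Y' : Type u} (r : X → Y → V) (f : X' → X) (g : Y' → Y) (𝔵 : 𝕋.F X')
    (𝔶 : 𝕋.F Y') :
    𝕋.ext r (𝕋.map f 𝔵) (𝕋.map g 𝔶) = 𝕋.ext (fun x y => r (f x) (g y)) 𝔵 𝔶 := by
  apply le_antisymm
  · refine 𝕋.ext_le fun w h₁ h₂ => ?_
    obtain ⟨w₁, hw₁, hw₁'⟩ := 𝕋.exists_of_map_eq (Prod.fst : X × Y → X) f w 𝔵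
      (W := X' × Y) (fun p => (f p.1, p.2)) Prod.fst
      ⟨fun _ => rfl, fun p x hp => ⟨(x, p.2), by simp [← hp], rfl⟩⟩ h₁
    obtain ⟨w₂, hw₂, hw₂'⟩ := 𝕋.exists_of_map_eq (Prod.snd : X' × Y → Y) g w₁ 𝔶
      (W := X' × Y') (fun p => (p.1, g p.2)) Prod.snd
      ⟨fun _ => rfl, fun p y hp => ⟨(p.1, y), by simp [← hp], rfl⟩⟩ (by
        rw [← h₂, ← hw₁, map_map])
    subst hw₁ hw₁' hw₂' hw₂
    have := 𝕋.le_ext (fun x y => r (f x) (g y)) w₂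
    simpa only [map_map, xi_map] using this
  · refine 𝕋.ext_le fun w h₁ h₂ => ?_
    subst h₁ h₂
    have := 𝕋.le_ext' r (fun p : X' × Y' => f p.1) (fun p : X' × Y' => g p.2) w
    simpa only [map_map] using this

theorem ext_map_left {X' : Type u} (r : X → Y → V) (f : X' → X) (𝔵 : 𝕋.F X') (𝔶 : 𝕋.F Y) :
    𝕋.ext r (𝕋.map f 𝔵) 𝔶 = 𝕋.ext (fun x y => r (f x) y) 𝔵 𝔶 := by
  have := 𝕋.ext_map_map r f (fun y => y) 𝔵 𝔶
  rwa [map_id'] at this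

theorem ext_map_right {Y' : Type u} (r : X → Y → V) (g : Y' → Y) (𝔵 : 𝕋.F X) (𝔶 : 𝕋.F Y') :
    𝕋.ext r 𝔵 (𝕋.map g 𝔶) = 𝕋.ext (fun x y => r x (g y)) 𝔵 𝔶 := by
  have := 𝕋.ext_map_map r (fun x => x) g 𝔵 𝔶
  rwa [map_id'] at this

theorem one_le_ext {r : X → X → V} (h : ∀ x, 1 ≤ r x x) (𝔵 : 𝕋.F X) : 1 ≤ 𝕋.ext r 𝔵 𝔵 := by
  have := 𝕋.le_ext' r (fun x => x) (fun x => x) 𝔵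
  rw [map_id'] at this
  refine le_trans ?_ this
  rw [← 𝕋.xi_one 𝔵]
  exact 𝕋.xi_mono h 𝔵

theorem le_ext_e (r : X → Y → V) (x : X) (y : Y) : r x y ≤ 𝕋.ext r (𝕋.e x) (𝕋.e y) := by
  have := 𝕋.le_ext r (𝕋.e (x, y))
  rwa [xi_e, map_e, map_e] at this

/-- The extension is functorial. -/
theorem ext_comp (r : X → Y → V) (s : Y → Z → V) (𝔵 : 𝕋.F X) (𝔷 : 𝕋.F Z) :
    𝕋.ext (fun x z => ⨆ y, r x y * s y z) 𝔵 𝔷 = ⨆ 𝔶, 𝕋.ext r 𝔵 𝔶 * 𝕋.ext s 𝔶 𝔷 := by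
  apply le_antisymm
  · refine 𝕋.ext_le fun w h₁ h₂ => ?_
    have hle : 𝕋.xi (fun p : X × Z => ⨆ y, r p.1 y * s y p.2) w ≤
        𝕋.xi (fun p : X × Z => ⨆ (q : X × Y × Z) (_ : (q.1, q.2.2) = p),
          r q.1 q.2.1 * s q.2.1 q.2.2) w :=
      𝕋.xi_mono (fun p => iSup_le fun y =>
        le_iSup₂_of_le (f := fun (q : X × Y × Z) (_ : (q.1, q.2.2) = p) =>
          r q.1 q.2.1 * s q.2.1 q.2.2) (p.1, y, p.2) rfl le_rfl) w
    refine hle.trans ?_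
    rw [𝕋.xi_image (fun q : X × Y × Z => (q.1, q.2.2)) (fun q => r q.1 q.2.1 * s q.2.1 q.2.2)]
    refine iSup_le fun v => iSup_le fun hv => ?_
    subst hv h₁ h₂
    rw [xi_mul, map_map, map_map]
    exact le_iSup_of_le (𝕋.map (fun q => q.2.1) v)
      (mul_le_mul' (𝕋.le_ext' r _ _ v) (𝕋.le_ext' s _ _ v))
  · refine iSup_le fun 𝔶 => ?_
    rw [← leftMulResiduation_le_iff_mul_le]
    refine 𝕋.ext_le fun w₁ h₁ h₁' => ?_
    rw [leftMulResiduation_le_iff_mul_le, ← rightMulResiduation_le_iff_mul_le]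
    refine 𝕋.ext_le fun w₂ h₂ h₂' => ?_
    rw [rightMulResiduation_le_iff_mul_le]
    obtain ⟨v, hv₁, hv₂⟩ := 𝕋.exists_of_map_eq (Prod.snd : X × Y → Y) (Prod.fst : Y × Z → Y) w₁ w₂
      (W := X × Y × Z) (fun q => (q.1, q.2.1)) (fun q => q.2)
      ⟨fun _ => rfl, fun p q h => ⟨(p.1, q), by simp [← h], rfl⟩⟩ (h₁'.trans h₂.symm)
    subst hv₁ hv₂ h₁ h₂'
    rw [xi_map, xi_map, ← xi_mul, map_map, map_map]
    refine le_trans ?_ (𝕋.le_ext' (fun x z => ⨆ y, r x y * s y z) (fun q : X × Y × Z => q.1)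
      (fun q => q.2.2) v)
    exact 𝕋.xi_mono (fun q => le_iSup (fun y => r q.1 y * s y q.2.2) q.2.1) v

theorem ext_mul_le {r : X → Y → V} {s : Y → Z → V} {t : X → Z → V}
    (h : ∀ x y z, r x y * s y z ≤ t x z) (𝔵 : 𝕋.F X) (𝔶 : 𝕋.F Y) (𝔷 : 𝕋.F Z) :
    𝕋.ext r 𝔵 𝔶 * 𝕋.ext s 𝔶 𝔷 ≤ 𝕋.ext t 𝔵 𝔷 :=
  (le_iSup_of_le (f := fun 𝔶 => 𝕋.ext r 𝔵 𝔶 * 𝕋.ext s 𝔶 𝔷) 𝔶 le_rfl).trans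
    ((𝕋.ext_comp r s 𝔵 𝔷).symm.trans_le
      (𝕋.ext_mono (fun x z => iSup_le fun y => h x y z) 𝔵 𝔷))

/-- The multiplication is natural for the extension. -/
theorem ext_ext_le (r : X → Y → V) (𝔛 : 𝕋.F (𝕋.F X)) (𝔜 : 𝕋.F (𝕋.F Y)) :
    𝕋.ext (𝕋.ext r) 𝔛 𝔜 ≤ 𝕋.ext r (𝕋.m 𝔛) (𝕋.m 𝔜) := by
  refine 𝕋.ext_le fun w h₁ h₂ => ?_
  have hle : 𝕋.xi (fun p : 𝕋.F X × 𝕋.F Y => 𝕋.ext r p.1 p.2) w ≤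
      𝕋.xi (fun p : 𝕋.F X × 𝕋.F Y => ⨆ (v : 𝕋.F (X × Y))
        (_ : (𝕋.map Prod.fst v, 𝕋.map Prod.snd v) = p), 𝕋.xi (fun q : X × Y => r q.1 q.2) v) w :=
    𝕋.xi_mono (fun p => 𝕋.ext_le fun v hv₁ hv₂ => le_iSup_of_le v
      (le_iSup_of_le (Prod.ext hv₁ hv₂) le_rfl)) w
  refine hle.trans ?_
  rw [𝕋.xi_image (fun v : 𝕋.F (X × Y) => (𝕋.map Prod.fst v, 𝕋.map Prod.snd v))]
  refine iSup_le fun v => iSup_le fun hv => ?_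
  subst hv h₁ h₂
  rw [← xi_m, map_map, map_map]
  have := 𝕋.le_ext r (𝕋.m v)
  rwa [map_m, map_m] at this

theorem ext_m_le (r : X → Y → V) (𝔛 : 𝕋.F (𝕋.F X)) (𝔶 : 𝕋.F Y) :
    𝕋.ext r (𝕋.m 𝔛) 𝔶 ≤ ⨆ (𝔜 : 𝕋.F (𝕋.F Y)) (_ : 𝕋.m 𝔜 = 𝔶), 𝕋.ext (𝕋.ext r) 𝔛 𝔜 := by
  refine 𝕋.ext_le fun w h₁ h₂ => ?_
  obtain ⟨v, hv₁, hv₂⟩ := 𝕋.exists_of_m_eq Prod.fst w 𝔛 h₁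
  subst hv₁ hv₂ h₂
  refine le_iSup_of_le (𝕋.map (𝕋.map Prod.snd) v) (le_iSup_of_le (𝕋.map_m _ _).symm ?_)
  rw [xi_m]
  exact (𝕋.xi_mono (fun w => 𝕋.le_ext r w) v).trans
    (𝕋.le_ext' (𝕋.ext r) (𝕋.map Prod.fst) (𝕋.map Prod.snd) v)

end basic

section basic

variable {X Y Z : Type u}

theorem ext_m_le' (r : X → Y → V) (𝔵 : 𝕋.F X) (𝔜 : 𝕋.F (𝕋.F Y)) :
    𝕋.ext r 𝔵 (𝕋.m 𝔜) ≤ ⨆ (𝔛 : 𝕋.F (𝕋.F X)) (_ : 𝕋.m 𝔛 = 𝔵), 𝕋.ext (𝕋.ext r) 𝔛 𝔜 := by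
  have hs : 𝕋.ext (fun y x => r x y) = fun 𝔶 𝔵 => 𝕋.ext r 𝔵 𝔶 :=
    funext fun 𝔶 => funext fun 𝔵 => 𝕋.ext_swap r 𝔵 𝔶
  have h := 𝕋.ext_m_le (fun y x => r x y) 𝔜 𝔵
  rw [ext_swap, hs] at h
  simpa only [ext_swap] using h

theorem ext_image_le (f : X → Z) (r : X → Y → V) (𝔷 : 𝕋.F Z) (𝔶 : 𝕋.F Y) :
    𝕋.ext (fun z y => ⨆ (x : X) (_ : f x = z), r x y) 𝔷 𝔶 ≤
      ⨆ (𝔵 : 𝕋.F X) (_ : 𝕋.map f 𝔵 = 𝔷), 𝕋.ext r 𝔵 𝔶 := by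
  refine 𝕋.ext_le fun w h₁ h₂ => ?_
  have hle : 𝕋.xi (fun p : Z × Y => ⨆ (x : X) (_ : f x = p.1), r x p.2) w ≤
      𝕋.xi (fun p : Z × Y => ⨆ (q : X × Y) (_ : (f q.1, q.2) = p), r q.1 q.2) w :=
    𝕋.xi_mono (fun p => iSup₂_le fun x hx =>
      le_iSup₂_of_le (f := fun (q : X × Y) (_ : (f q.1, q.2) = p) => r q.1 q.2) (x, p.2)
        (Prod.ext hx rfl) le_rfl) w
  refine hle.trans ?_
  rw [𝕋.xi_image (fun q : X × Y => (f q.1, q.2)) (fun q => r q.1 q.2)]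
  refine iSup₂_le fun v hv => ?_
  subst hv h₁ h₂
  rw [map_map, map_map]
  exact le_iSup₂_of_le (𝕋.map Prod.fst v) (𝕋.map_map _ _ _) (𝕋.le_ext r v)

theorem one_mul_le {a b c d : V} (h₁ : 1 ≤ a) (h₂ : a * b ≤ c) (h₃ : d ≤ b) : d ≤ c :=
  calc d = 1 * d := (one_mul d).symm
    _ ≤ a * b := mul_le_mul' h₁ h₃
    _ ≤ c := h₂

theorem mul_one_le {a b c d : V} (h₁ : 1 ≤ b) (h₂ : a * b ≤ c) (h₃ : d ≤ a) : d ≤ c :=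
  calc d = d * 1 := (mul_one d).symm
    _ ≤ a * b := mul_le_mul' h₃ h₁
    _ ≤ c := h₂

theorem iSup_mul_le {ι : Sort*} {f : ι → V} {b c : V} (h : ∀ i, f i * b ≤ c) :
    (⨆ i, f i) * b ≤ c :=
  leftMulResiduation_le_iff_mul_le.1
    (iSup_le fun i => leftMulResiduation_le_iff_mul_le.2 (h i))

theorem mul_iSup_le {ι : Sort*} {f : ι → V} {b c : V} (h : ∀ i, b * f i ≤ c) :
    b * (⨆ i, f i) ≤ c := by
  rw [mul_comm]
  exact iSup_mul_le fun i => by rw [mul_comm]; exact h i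

theorem le_hom_iff {x y z : V} : x ≤ y ⇨ₗ z ↔ x * y ≤ z := leftMulResiduation_le_iff_mul_le

theorem hom_mul_le (x y : V) : (x ⇨ₗ y) * x ≤ y := le_hom_iff.1 le_rfl

/-! ### `T`-relations -/

/-- The `V`-relation `T_ξ α · m°` associated with a `T`-relation `α`. -/
def hat (α : 𝕋.F X → Y → V) (𝔵 : 𝕋.F X) (𝔶 : 𝕋.F Y) : V :=
  ⨆ (𝔛 : 𝕋.F (𝕋.F X)) (_ : 𝕋.m 𝔛 = 𝔵), 𝕋.ext α 𝔛 𝔶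

/-- The Kleisli convolution `β ∘ α = β · T_ξ α · m°` of `T`-relations. -/
def kleisli (β : 𝕋.F Y → Z → V) (α : 𝕋.F X → Y → V) (𝔵 : 𝕋.F X) (z : Z) : V :=
  ⨆ 𝔶 : 𝕋.F Y, 𝕋.hat α 𝔵 𝔶 * β 𝔶 z

/-- The extension of `γ` along `α` in the category of `T`-relations. -/
def extension (γ : 𝕋.F X → Z → V) (α : 𝕋.F X → Y → V) (𝔶 : 𝕋.F Y) (z : Z) : V :=
  ⨅ 𝔵 : 𝕋.F X, 𝕋.hat α 𝔵 𝔶 ⇨ₗ γ 𝔵 z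

/-- The lifting of `φ` along a `T`-relation `ψ` whose domain is the one-point set. -/
def lifting (ψ : 𝕋.F PUnit.{u + 1} → X → V) (φ : 𝕋.F Y → X → V) (𝔶 : 𝕋.F Y) : V :=
  ⨅ x : X, ψ (𝕋.e PUnit.unit) x ⇨ₗ φ 𝔶 x

/-- The `T`-functor condition, for arbitrary `T`-relations on the domain and the codomain. -/
def IsTFunctor (a : 𝕋.F X → X → V) (b : 𝕋.F Y → Y → V) (f : X → Y) : Prop :=
  ∀ 𝔵 x, a 𝔵 x ≤ b (𝕋.map f 𝔵) (f x)

theorem le_hat (α : 𝕋.F X → Y → V) (𝔛 : 𝕋.F (𝕋.F X)) (𝔶 : 𝕋.F Y) :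
    𝕋.ext α 𝔛 𝔶 ≤ 𝕋.hat α (𝕋.m 𝔛) 𝔶 :=
  le_iSup₂_of_le (f := fun 𝔛' (_ : 𝕋.m 𝔛' = 𝕋.m 𝔛) => 𝕋.ext α 𝔛' 𝔶) 𝔛 rfl le_rfl

theorem le_hat_e (α : 𝕋.F X → Y → V) (𝔵 : 𝕋.F X) (y : Y) : α 𝔵 y ≤ 𝕋.hat α 𝔵 (𝕋.e y) := by
  have := (𝕋.le_ext_e α 𝔵 y).trans (𝕋.le_hat α _ _)
  rwa [m_e] at this

theorem ext_e_le_hat (α : 𝕋.F X → Y → V) (𝔵 : 𝕋.F X) (𝔶 : 𝕋.F Y) :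
    𝕋.ext (fun x y => α (𝕋.e x) y) 𝔵 𝔶 ≤ 𝕋.hat α 𝔵 𝔶 := by
  rw [← ext_map_left]
  have := 𝕋.le_hat α (𝕋.map 𝕋.e 𝔵) 𝔶
  rwa [m_map_e] at this

end basic

/-! ### `T`-categories and `T`-functors -/

/-- A `T`-category. -/
structure TCat where
  /-- the underlying set -/
  carrier : Type u
  /-- the structure, a `T`-relation -/
  str : 𝕋.F carrier → carrier → V
  refl : ∀ x, 1 ≤ str (𝕋.e x) x
  trans : ∀ 𝔛 𝔵 x, 𝕋.ext str 𝔛 𝔵 * str 𝔵 x ≤ str (𝕋.m 𝔛) x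

/-- A `T`-functor. -/
@[ext]
structure TFunctor (X Y : 𝕋.TCat) where
  /-- the underlying map -/
  toFun : X.carrier → Y.carrier
  isTFunctor : 𝕋.IsTFunctor X.str Y.str toFun

namespace TCat

variable {𝕋}

/-- The underlying `V`-category structure. -/
def str₀ (X : 𝕋.TCat) (x y : X.carrier) : V := X.str (𝕋.e x) y

/-- The order on maps into (the underlying set of) a `T`-category. -/
def Le (X : 𝕋.TCat) {A : Type u} (f g : A → X.carrier) : Prop := ∀ a, 1 ≤ X.str₀ (f a) (g a)

/-- Equivalence of maps into a `T`-category. -/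
def Equivalent (X : 𝕋.TCat) {A : Type u} (f g : A → X.carrier) : Prop := X.Le f g ∧ X.Le g f

theorem refl₀ (X : 𝕋.TCat) (x : X.carrier) : 1 ≤ X.str₀ x x := X.refl x

theorem mul_le (X : 𝕋.TCat) (𝔵 : 𝕋.F X.carrier) (x y : X.carrier) :
    X.str 𝔵 x * X.str₀ x y ≤ X.str 𝔵 y := by
  have h := X.trans (𝕋.e 𝔵) (𝕋.e x) y
  rw [m_e] at h
  exact (mul_le_mul_left (𝕋.le_ext_e X.str 𝔵 x) _).trans h

theorem trans₀ (X : 𝕋.TCat) (x y z : X.carrier) : X.str₀ x y * X.str₀ y z ≤ X.str₀ x z :=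
  X.mul_le (𝕋.e x) y z

theorem hat_e (X : 𝕋.TCat) (𝔵 : 𝕋.F X.carrier) (x : X.carrier) :
    𝕋.hat X.str 𝔵 (𝕋.e x) = X.str 𝔵 x := by
  apply le_antisymm _ (𝕋.le_hat_e _ _ _)
  refine iSup₂_le fun 𝔛 h => ?_
  subst h
  exact mul_one_le (X.refl x) (X.trans 𝔛 (𝕋.e x) x) le_rfl

theorem hat_mul_le (X : 𝕋.TCat) (𝔵 𝔶 : 𝕋.F X.carrier) (x : X.carrier) :
    𝕋.hat X.str 𝔵 𝔶 * X.str 𝔶 x ≤ X.str 𝔵 x := by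
  refine iSup_mul_le fun 𝔛 => iSup_mul_le fun h => ?_
  subst h
  exact X.trans 𝔛 𝔶 x

theorem one_le_hat (X : 𝕋.TCat) (𝔵 : 𝕋.F X.carrier) : 1 ≤ 𝕋.hat X.str 𝔵 𝔵 :=
  (𝕋.one_le_ext X.refl 𝔵).trans (𝕋.ext_e_le_hat X.str 𝔵 𝔵)

theorem hat_trans (X : 𝕋.TCat) (𝔵 𝔶 𝔷 : 𝕋.F X.carrier) :
    𝕋.hat X.str 𝔵 𝔶 * 𝕋.hat X.str 𝔶 𝔷 ≤ 𝕋.hat X.str 𝔵 𝔷 := by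
  refine iSup_mul_le fun 𝔛 => iSup_mul_le fun h => mul_iSup_le fun 𝔜 => mul_iSup_le fun h' => ?_
  subst h h'
  refine (mul_le_mul_left (𝕋.ext_m_le' X.str 𝔛 𝔜) _).trans ?_
  refine iSup_mul_le fun 𝔚 => iSup_mul_le fun h => ?_
  subst h
  refine (𝕋.ext_mul_le (t := fun 𝔛 x => X.str (𝕋.m 𝔛) x) X.trans 𝔚 𝔜 𝔷).trans ?_
  rw [← 𝕋.ext_map_left X.str 𝕋.m, ← m_map_m]
  exact 𝕋.le_hat _ _ _

theorem ext_hat_le (X : 𝕋.TCat) (𝔛 𝔜 : 𝕋.F (𝕋.F X.carrier)) :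
    𝕋.ext (𝕋.hat X.str) 𝔛 𝔜 ≤ 𝕋.hat X.str (𝕋.m 𝔛) (𝕋.m 𝔜) := by
  refine (𝕋.ext_image_le 𝕋.m (𝕋.ext X.str) 𝔛 𝔜).trans (iSup₂_le fun 𝔚 h => ?_)
  subst h
  refine (𝕋.ext_ext_le X.str 𝔚 𝔜).trans ?_
  rw [m_map_m]
  exact 𝕋.le_hat _ _ _

end TCat

/-- A pseudo-algebra for the monad on `V`-categories: a `V`-category structure `c` on `X` and
a map `α : T X → X` satisfying the algebra laws up to equivalence. -/
structure VAlg (X : Type u) where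
  /-- the `V`-category structure -/
  c : X → X → V
  /-- the pseudo-algebra structure -/
  α : 𝕋.F X → X
  refl : ∀ x, 1 ≤ c x x
  trans : ∀ x y z, c x y * c y z ≤ c x z
  ext_le : ∀ 𝔵 𝔶, 𝕋.ext c 𝔵 𝔶 ≤ c (α 𝔵) (α 𝔶)
  unit_le : ∀ x, 1 ≤ c (α (𝕋.e x)) x
  le_unit : ∀ x, 1 ≤ c x (α (𝕋.e x))
  assoc_le : ∀ 𝔛, 1 ≤ c (α (𝕋.map α 𝔛)) (α (𝕋.m 𝔛))
  le_assoc : ∀ 𝔛, 1 ≤ c (α (𝕋.m 𝔛)) (α (𝕋.map α 𝔛))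

namespace VAlg

variable {𝕋} {X : Type u}

theorem c_unit (A : 𝕋.VAlg X) (x y : X) : A.c (A.α (𝕋.e x)) y = A.c x y :=
  le_antisymm (one_mul_le (A.le_unit x) (A.trans _ _ _) le_rfl)
    (one_mul_le (A.unit_le x) (A.trans _ _ _) le_rfl)

theorem ext_le_c (A : 𝕋.VAlg X) (𝔛 : 𝕋.F (𝕋.F X)) (𝔵 : 𝕋.F X) :
    𝕋.ext (fun 𝔵 x => A.c (A.α 𝔵) x) 𝔛 𝔵 ≤ A.c (A.α (𝕋.m 𝔛)) (A.α 𝔵) := by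
  rw [← 𝕋.ext_map_left A.c A.α]
  exact one_mul_le (A.le_assoc 𝔛) (A.trans _ _ _) (A.ext_le _ _)

/-- The `T`-category `(X, c · α)` given by a pseudo-algebra `(X, c, α)`. -/
abbrev toTCat (A : 𝕋.VAlg X) : 𝕋.TCat where
  carrier := X
  str 𝔵 x := A.c (A.α 𝔵) x
  refl := A.unit_le
  trans 𝔛 𝔵 _ := (mul_le_mul_left (A.ext_le_c 𝔛 𝔵) _).trans (A.trans _ _ _)

/-- The dual pseudo-algebra. -/
abbrev op (A : 𝕋.VAlg X) : 𝕋.VAlg X where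
  c x y := A.c y x
  α := A.α
  refl := A.refl
  trans x y z := by rw [mul_comm]; exact A.trans z y x
  ext_le 𝔵 𝔶 := by rw [ext_swap]; exact A.ext_le 𝔶 𝔵
  unit_le := A.le_unit
  le_unit := A.unit_le
  assoc_le := A.le_assoc
  le_assoc := A.assoc_le

/-- The algebra `(T X, T_ξ a · m°, m)`, for a `T`-category `(X, a)`. -/
abbrev free (X : 𝕋.TCat) : 𝕋.VAlg (𝕋.F X.carrier) where
  c := 𝕋.hat X.str
  α := 𝕋.m
  refl := X.one_le_hat
  trans := X.hat_trans
  ext_le := X.ext_hat_le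
  unit_le 𝔵 := by rw [m_e]; exact X.one_le_hat 𝔵
  le_unit 𝔵 := by rw [m_e]; exact X.one_le_hat 𝔵
  assoc_le 𝔛 := by rw [m_map_m]; exact X.one_le_hat _
  le_assoc 𝔛 := by rw [m_map_m]; exact X.one_le_hat _

end VAlg

namespace TCat

variable {𝕋}

/-- The `T`-category `T X = (T X, T_ξ a · m° · m)`. -/
abbrev free (X : 𝕋.TCat) : 𝕋.TCat := (VAlg.free X).toTCat

/-- The unit of the monad as a `T`-functor `X → T X`. -/
abbrev unit (X : 𝕋.TCat) : 𝕋.TFunctor X X.free where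
  toFun := 𝕋.e
  isTFunctor 𝔵 x := by
    change _ ≤ 𝕋.hat X.str (𝕋.m (𝕋.map 𝕋.e 𝔵)) (𝕋.e x)
    rw [m_map_e, hat_e]

end TCat

/-- `f` is left adjoint to `g` in the 2-category of `T`-categories. -/
def IsAdjoint {X Y : 𝕋.TCat} (f : 𝕋.TFunctor X Y) (g : 𝕋.TFunctor Y X) : Prop :=
  X.Le (fun x => x) (fun x => g.toFun (f.toFun x)) ∧
    Y.Le (fun y => f.toFun (g.toFun y)) (fun y => y)

/-- `α` is a left adjoint of the unit `X → T X`. -/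
def IsAlg (X : 𝕋.TCat) (α : 𝕋.TFunctor X.free X) : Prop := 𝕋.IsAdjoint α X.unit

/-- A `T`-category `X` is representable if the unit `X → T X` has a left adjoint. -/
def Representable (X : 𝕋.TCat) : Prop := ∃ α : 𝕋.TFunctor X.free X, 𝕋.IsAlg X α

section representable

variable {𝕋}

theorem TFunctor.str₀_le {X Y : 𝕋.TCat} (f : 𝕋.TFunctor X Y) (x y : X.carrier) :
    X.str₀ x y ≤ Y.str₀ (f.toFun x) (f.toFun y) := by
  have := f.isTFunctor (𝕋.e x) y
  rwa [map_e] at this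

theorem IsAlg.le_str {X : 𝕋.TCat} {α : 𝕋.TFunctor X.free X} (h : 𝕋.IsAlg X α)
    (𝔵 : 𝕋.F X.carrier) : 1 ≤ X.str 𝔵 (α.toFun 𝔵) := by
  have h1 := h.1 𝔵
  change 1 ≤ 𝕋.hat X.str (𝕋.m (𝕋.e 𝔵)) (𝕋.e (α.toFun 𝔵)) at h1
  rwa [m_e, TCat.hat_e] at h1

theorem IsAlg.hat_le {X : 𝕋.TCat} (α : 𝕋.TFunctor X.free X) (𝔵 𝔶 : 𝕋.F X.carrier) :
    𝕋.hat X.str 𝔵 𝔶 ≤ X.str₀ (α.toFun 𝔵) (α.toFun 𝔶) := by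
  have h := α.str₀_le 𝔵 𝔶
  change 𝕋.hat X.str (𝕋.m (𝕋.e 𝔵)) 𝔶 ≤ _ at h
  rwa [m_e] at h

theorem IsAlg.str_eq {X : 𝕋.TCat} {α : 𝕋.TFunctor X.free X} (h : 𝕋.IsAlg X α)
    (𝔵 : 𝕋.F X.carrier) (x : X.carrier) : X.str 𝔵 x = X.str₀ (α.toFun 𝔵) x := by
  apply le_antisymm
  · rw [← X.hat_e]
    exact mul_one_le (h.2 x) (X.trans₀ _ _ _) (IsAlg.hat_le α 𝔵 (𝕋.e x))
  · exact one_mul_le (h.le_str 𝔵) (X.mul_le _ _ _) le_rfl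

/-- A left adjoint of the unit `X → T X` is a pseudo-algebra structure on the underlying
`V`-category of `X`. -/
abbrev IsAlg.toVAlg {X : 𝕋.TCat} {α : 𝕋.TFunctor X.free X} (h : 𝕋.IsAlg X α) :
    𝕋.VAlg X.carrier where
  c := X.str₀
  α := α.toFun
  refl := X.refl₀
  trans := X.trans₀
  ext_le 𝔵 𝔶 := (𝕋.ext_e_le_hat X.str 𝔵 𝔶).trans (IsAlg.hat_le α 𝔵 𝔶)
  unit_le := h.2
  le_unit _ := h.le_str _
  assoc_le 𝔛 := by
    rw [← h.str_eq]
    have h1 := α.isTFunctor 𝔛 (𝕋.m 𝔛)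
    exact le_trans (X.one_le_hat (𝕋.m 𝔛)) h1
  le_assoc 𝔛 := by
    rw [← h.str_eq]
    refine one_mul_le (a := 𝕋.ext X.str 𝔛 (𝕋.map α.toFun 𝔛)) ?_ (X.trans 𝔛 _ _)
      (h.le_str _)
    rw [ext_map_right]
    exact 𝕋.one_le_ext h.le_str 𝔛

/-- The left adjoint of the unit given by a pseudo-algebra. -/
abbrev VAlg.leftAdj {X : Type u} (A : 𝕋.VAlg X) : 𝕋.TFunctor A.toTCat.free A.toTCat where
  toFun := A.α
  isTFunctor 𝔛 𝔶 := by
    change 𝕋.hat _ (𝕋.m 𝔛) 𝔶 ≤ A.c (A.α (𝕋.map A.α 𝔛)) (A.α 𝔶)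
    refine one_mul_le (A.assoc_le 𝔛) (A.trans _ _ _) (iSup₂_le fun 𝔜 h => ?_)
    rw [← h]
    exact A.ext_le_c 𝔜 𝔶

theorem VAlg.isAlg {X : Type u} (A : 𝕋.VAlg X) : 𝕋.IsAlg A.toTCat A.leftAdj := by
  refine ⟨fun 𝔵 => ?_, fun x => ?_⟩
  · change 1 ≤ 𝕋.hat A.toTCat.str (𝕋.m (𝕋.e 𝔵)) (𝕋.e (A.α 𝔵))
    rw [m_e]
    refine le_trans ?_ (𝕋.le_hat_e _ _ _)
    exact A.refl _
  · change 1 ≤ A.c (A.α (𝕋.e (A.α (𝕋.e x)))) x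
    rw [c_unit]
    exact A.unit_le x

theorem VAlg.representable {X : Type u} (A : 𝕋.VAlg X) : 𝕋.Representable A.toTCat :=
  ⟨A.leftAdj, A.isAlg⟩

end representable

/-! ### Representable `T`-categories, pseudo-homomorphisms and duals -/

/-- A pseudo-homomorphism between representable `T`-categories: `β · T f ≃ f · α` for the left
adjoints `α`, `β` of the units. -/
def IsPseudoHom {X Y : 𝕋.TCat} (f : 𝕋.TFunctor X Y) : Prop :=
  ∀ (α : 𝕋.TFunctor X.free X) (β : 𝕋.TFunctor Y.free Y), 𝕋.IsAlg X α → 𝕋.IsAlg Y β →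
    Y.Equivalent (fun 𝔵 : 𝕋.F X.carrier => β.toFun (𝕋.map f.toFun 𝔵))
      (fun 𝔵 : 𝕋.F X.carrier => f.toFun (α.toFun 𝔵))

/-- A representable `T`-category. -/
structure RepCat where
  /-- the underlying `T`-category -/
  toTCat : 𝕋.TCat
  representable : 𝕋.Representable toTCat

section representable

variable {𝕋}

/-- The pseudo-algebra given by a (chosen) left adjoint of the unit `X → T X`. -/
noncomputable abbrev RepCat.vAlg (X : 𝕋.RepCat) : 𝕋.VAlg X.toTCat.carrier :=
  X.representable.choose_spec.toVAlg

/-- The dual `(X, a₀° · α)` of a representable `T`-category `(X, a₀ · α)`; it does not depend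
on the choice of `α`, see `RepCat.op_str`. -/
noncomputable abbrev RepCat.op (X : 𝕋.RepCat) : 𝕋.RepCat where
  toTCat := X.vAlg.op.toTCat
  representable := X.vAlg.op.representable

/-- The structure of `X` is the one induced by the pseudo-algebra `A`. -/
def VAlg.Induces {X : 𝕋.TCat} (A : 𝕋.VAlg X.carrier) : Prop :=
  ∀ 𝔵 x, X.str 𝔵 x = A.c (A.α 𝔵) x

theorem VAlg.Induces.str₀_eq {X : 𝕋.TCat} {A : 𝕋.VAlg X.carrier} (h : A.Induces)
    (x y : X.carrier) : X.str₀ x y = A.c x y :=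
  (h _ _).trans (A.c_unit x y)

theorem VAlg.exists_isAlg_aux {X : Type u} (A : 𝕋.VAlg X) (a : 𝕋.F X → X → V)
    (ha : A.toTCat.str = a) (hr : ∀ x, 1 ≤ a (𝕋.e x) x)
    (ht : ∀ 𝔛 𝔵 x, 𝕋.ext a 𝔛 𝔵 * a 𝔵 x ≤ a (𝕋.m 𝔛) x) :
    ∃ α : 𝕋.TFunctor (TCat.mk X a hr ht).free (TCat.mk X a hr ht),
      𝕋.IsAlg (TCat.mk X a hr ht) α ∧ α.toFun = A.α := by
  subst ha
  exact ⟨A.leftAdj, A.isAlg, rfl⟩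

theorem VAlg.Induces.exists_isAlg {X : 𝕋.TCat} {A : 𝕋.VAlg X.carrier} (h : A.Induces) :
    ∃ α : 𝕋.TFunctor X.free X, 𝕋.IsAlg X α ∧ α.toFun = A.α :=
  A.exists_isAlg_aux X.str (funext fun 𝔵 => funext fun x => (h 𝔵 x).symm) X.refl X.trans

theorem VAlg.Induces.coreCompact {X : 𝕋.TCat} {A : 𝕋.VAlg X.carrier} (h : A.Induces)
    (𝔛 : 𝕋.F (𝕋.F X.carrier)) (x : X.carrier) :
    X.str (𝕋.m 𝔛) x ≤ ⨆ 𝔵, 𝕋.ext X.str 𝔛 𝔵 * X.str 𝔵 x := by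
  refine le_iSup_of_le (𝕋.map A.α 𝔛) (one_mul_le (a := 𝕋.ext X.str 𝔛 (𝕋.map A.α 𝔛)) ?_ le_rfl ?_)
  · rw [ext_map_right]
    refine 𝕋.one_le_ext (fun 𝔵 => ?_) 𝔛
    rw [h]
    exact A.refl _
  · rw [h, h]
    exact one_mul_le (A.assoc_le 𝔛) (A.trans _ _ _) le_rfl

theorem IsAlg.induces {X : 𝕋.TCat} {α : 𝕋.TFunctor X.free X} (h : 𝕋.IsAlg X α) :
    h.toVAlg.Induces := h.str_eq

theorem RepCat.induces (X : 𝕋.RepCat) : VAlg.Induces X.vAlg :=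
  X.representable.choose_spec.induces

theorem VAlg.Induces.equiv {X : 𝕋.TCat} {A B : 𝕋.VAlg X.carrier} (hA : A.Induces)
    (hB : B.Induces) (𝔵 : 𝕋.F X.carrier) : 1 ≤ X.str₀ (A.α 𝔵) (B.α 𝔵) := by
  rw [hA.str₀_eq, ← hA, hB]
  exact B.refl _

theorem VAlg.Induces.op_str {X : 𝕋.RepCat} {A : 𝕋.VAlg X.toTCat.carrier} (hA : A.Induces)
    (𝔵 : 𝕋.F X.toTCat.carrier) (x : X.toTCat.carrier) :
    X.op.toTCat.str 𝔵 x = X.toTCat.str₀ x (A.α 𝔵) :=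
  le_antisymm (mul_one_le (X.induces.equiv hA 𝔵) (X.toTCat.trans₀ _ _ _) le_rfl)
    (mul_one_le (hA.equiv X.induces 𝔵) (X.toTCat.trans₀ _ _ _) le_rfl)

/-- The dual does not depend on the choice of the left adjoint. -/
theorem RepCat.op_str (X : 𝕋.RepCat) {α : 𝕋.TFunctor X.toTCat.free X.toTCat}
    (h : 𝕋.IsAlg X.toTCat α) (𝔵 : 𝕋.F X.toTCat.carrier) (x : X.toTCat.carrier) :
    X.op.toTCat.str 𝔵 x = X.toTCat.str₀ x (α.toFun 𝔵) :=
  h.induces.op_str 𝔵 x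

theorem VAlg.Induces.op {X : 𝕋.RepCat} {A : 𝕋.VAlg X.toTCat.carrier} (hA : A.Induces) :
    VAlg.Induces (X := X.op.toTCat) A.op := fun 𝔵 x => by
  rw [hA.op_str, hA.str₀_eq]

theorem isPseudoHom_iff {X Y : 𝕋.TCat} (hY : 𝕋.Representable Y) {A : 𝕋.VAlg X.carrier}
    (hA : A.Induces) (f : 𝕋.TFunctor X Y) :
    𝕋.IsPseudoHom f ↔ ∀ 𝔵 y, Y.str (𝕋.map f.toFun 𝔵) y ≤ Y.str₀ (f.toFun (A.α 𝔵)) y := by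
  constructor
  · intro h 𝔵 y
    obtain ⟨α, hα, h'⟩ := hA.exists_isAlg
    obtain ⟨β, hβ⟩ := hY
    have h1 : 1 ≤ Y.str₀ (f.toFun (α.toFun 𝔵)) (β.toFun (𝕋.map f.toFun 𝔵)) :=
      (h α β hα hβ).2 𝔵
    rw [hβ.str_eq, ← h']
    exact one_mul_le h1 (Y.trans₀ _ _ _) le_rfl
  · intro h α β hα hβ
    have h2 : ∀ 𝔵, 1 ≤ Y.str₀ (f.toFun (A.α 𝔵)) (f.toFun (α.toFun 𝔵)) := fun 𝔵 =>
      (hA.equiv hα.induces 𝔵).trans (f.str₀_le _ _)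
    have h2' : ∀ 𝔵, 1 ≤ Y.str₀ (f.toFun (α.toFun 𝔵)) (f.toFun (A.α 𝔵)) := fun 𝔵 =>
      (hα.induces.equiv hA 𝔵).trans (f.str₀_le _ _)
    refine ⟨fun 𝔵 => ?_, fun 𝔵 => ?_⟩
    · change 1 ≤ Y.str₀ (β.toFun (𝕋.map f.toFun 𝔵)) (f.toFun (α.toFun 𝔵))
      rw [← hβ.str_eq]
      exact (hα.le_str 𝔵).trans (f.isTFunctor _ _)
    · change 1 ≤ Y.str₀ (f.toFun (α.toFun 𝔵)) (β.toFun (𝕋.map f.toFun 𝔵))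
      refine one_mul_le (h2' 𝔵) (Y.trans₀ _ _ _) ((hβ.le_str _).trans (h 𝔵 _))

end representable

/-! ### Exponentials, presheaves -/

section exponential

variable {X Y Z : Type u}

/-- The structure of the `T`-category `G = (1, e°)`. -/
def gStr (t : 𝕋.F PUnit.{u + 1}) (p : PUnit.{u + 1}) : V := ⨆ _ : 𝕋.e p = t, (1 : V)

/-- The structure of the tensor product `X ⊗ Y`. -/
def tensorStr (a : 𝕋.F X → X → V) (b : 𝕋.F Y → Y → V) (w : 𝕋.F (X × Y)) (p : X × Y) : V :=
  a (𝕋.map Prod.fst w) p.1 * b (𝕋.map Prod.snd w) p.2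

/-- The structure `hom_ξ` of the `T`-category `V`. -/
def homStr (𝔳 : 𝕋.F V) (v : V) : V := 𝕋.ξ 𝔳 ⇨ₗ v

/-- The underlying set of the exponential `Y ^ X`: all maps `h : X → Y` which are
`T`-functors of type `G ⊗ X → Y`. -/
@[ext]
structure Exp (a : 𝕋.F X → X → V) (b : 𝕋.F Y → Y → V) : Type u where
  /-- the map `X → Y` -/
  fn : X → Y
  isTFunctor : 𝕋.IsTFunctor (𝕋.tensorStr 𝕋.gStr a) b (fun p : PUnit.{u + 1} × X => fn p.2)

/-- The structure of the exponential `Y ^ X`. -/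
def expStr (a : 𝕋.F X → X → V) (b : 𝕋.F Y → Y → V) (𝔭 : 𝕋.F (𝕋.Exp a b)) (h : 𝕋.Exp a b) : V :=
  ⨅ (𝔮 : 𝕋.F (𝕋.Exp a b × X)) (x : X) (_ : 𝕋.map Prod.fst 𝔮 = 𝔭),
    a (𝕋.map Prod.snd 𝔮) x ⇨ₗ b (𝕋.map (fun z => z.1.fn z.2) 𝔮) (h.fn x)

/-- The underlying set of `V ^ X`. -/
abbrev VExp (a : 𝕋.F X → X → V) : Type u := 𝕋.Exp a 𝕋.homStr

/-- The `V`-relation `μ = a · T_ξ ev`. -/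
def mu (a : 𝕋.F X → X → V) (𝔭 : 𝕋.F (𝕋.VExp a)) (x : X) : V :=
  ⨆ 𝔵 : 𝕋.F X, 𝕋.ext (fun (h : 𝕋.VExp a) (x : X) => h.fn x) 𝔭 𝔵 * a 𝔵 x

theorem expStr_eq (a : 𝕋.F X → X → V) (𝔭 : 𝕋.F (𝕋.VExp a)) (h : 𝕋.VExp a) :
    𝕋.expStr a 𝕋.homStr 𝔭 h = ⨅ x, 𝕋.mu a 𝔭 x ⇨ₗ h.fn x := by
  apply le_antisymm
  · refine le_iInf fun x => le_hom_iff.2 (mul_iSup_le fun 𝔵 => ?_)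
    rw [mul_left_comm, ← le_hom_iff]
    refine 𝕋.ext_le fun w h₁ h₂ => le_hom_iff.2 ?_
    have h3 : 𝕋.expStr a 𝕋.homStr 𝔭 h ≤ a 𝔵 x ⇨ₗ (𝕋.xi (fun z => z.1.fn z.2) w ⇨ₗ h.fn x) := by
      subst h₁ h₂
      exact iInf_le_of_le w (iInf_le_of_le x (iInf_le_of_le rfl le_rfl))
    rw [le_hom_iff, le_hom_iff] at h3
    rwa [mul_comm]
  · refine le_iInf fun 𝔮 => le_iInf fun x => le_iInf fun h₁ => ?_
    rw [le_hom_iff]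
    refine le_hom_iff.2 ?_
    subst h₁
    change _ * 𝕋.xi (fun z => z.1.fn z.2) 𝔮 ≤ _
    rw [mul_assoc]
    refine le_trans (mul_le_mul' (iInf_le _ x) ?_) (hom_mul_le (𝕋.mu a (𝕋.map Prod.fst 𝔮) x) _)
    rw [mul_comm]
    exact le_iSup_of_le (𝕋.map Prod.snd 𝔮) (mul_le_mul_left (𝕋.le_ext _ 𝔮) _)

theorem mu_mono (X : 𝕋.TCat) (𝔭 𝔭' : 𝕋.F (𝕋.VExp X.str)) (x : X.carrier) :
    𝕋.ext (fun h h' : 𝕋.VExp X.str => ⨅ x, h.fn x ⇨ₗ h'.fn x) 𝔭 𝔭' * 𝕋.mu X.str 𝔭 x ≤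
      𝕋.mu X.str 𝔭' x := by
  refine mul_iSup_le fun 𝔵 => ?_
  rw [← mul_assoc]
  refine le_iSup_of_le 𝔵 (mul_le_mul_left ?_ _)
  have h := 𝕋.ext_mul_le (r := fun (x : X.carrier) (h : 𝕋.VExp X.str) => h.fn x)
    (s := fun h h' : 𝕋.VExp X.str => ⨅ x, h.fn x ⇨ₗ h'.fn x) (t := fun x h => h.fn x)
    (fun x h h' => by rw [mul_comm]; exact le_hom_iff.1 (iInf_le _ x)) 𝔵 𝔭 𝔭'
  rw [𝕋.ext_swap (fun (h : 𝕋.VExp X.str) (x : X.carrier) => h.fn x) 𝔭 𝔵,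
    𝕋.ext_swap (fun (h : 𝕋.VExp X.str) (x : X.carrier) => h.fn x) 𝔭' 𝔵] at h
  rwa [mul_comm]

variable [Subsingleton (𝕋.F PUnit.{u + 1})]

theorem isPresheaf_iff (a : 𝕋.F X → X → V) (h : X → V) :
    𝕋.IsTFunctor (𝕋.tensorStr 𝕋.gStr a) 𝕋.homStr (fun p : PUnit.{u + 1} × X => h p.2) ↔
      ∀ 𝔵 x, 𝕋.xi h 𝔵 * a 𝔵 x ≤ h x := by
  have hg : ∀ t p, 𝕋.gStr t p = 1 := fun t p =>
    le_antisymm (iSup_le fun _ => le_rfl) (le_iSup_of_le (Subsingleton.elim _ _) le_rfl)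
  constructor
  · intro H 𝔵 x
    have h1 := H (𝕋.map (fun x => (PUnit.unit, x)) 𝔵) (PUnit.unit, x)
    have h2 := le_hom_iff.1 h1
    change 𝕋.gStr _ _ * a _ _ * 𝕋.ξ _ ≤ h x at h2
    rw [hg, one_mul, map_map, map_map, mul_comm] at h2
    change 𝕋.xi h 𝔵 * a (𝕋.map (fun x => x) 𝔵) x ≤ h x at h2
    rwa [map_id'] at h2
  · intro H w p
    refine le_hom_iff.2 ?_
    change 𝕋.gStr _ _ * a _ _ * 𝕋.xi (fun p => h p.2) w ≤ h p.2
    rw [hg, one_mul, mul_comm, ← 𝕋.xi_map Prod.snd h]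
    exact H _ _

theorem VExp.le {a : 𝕋.F X → X → V} (h : 𝕋.VExp a) (𝔵 : 𝕋.F X) (x : X) :
    𝕋.xi h.fn 𝔵 * a 𝔵 x ≤ h.fn x :=
  (𝕋.isPresheaf_iff a h.fn).1 h.2 𝔵 x

theorem VExp.mul_le {a : 𝕋.F X → X → V} (h : 𝕋.VExp a) (x y : X) :
    h.fn x * a (𝕋.e x) y ≤ h.fn y := by
  have := VExp.le 𝕋 h (𝕋.e x) y
  rwa [xi_e] at this

theorem xi_eq_ext (φ : X → V) (𝔵 : 𝕋.F X) :
    𝕋.xi φ 𝔵 = 𝕋.ext (fun (_ : PUnit.{u + 1}) x => φ x) (𝕋.e PUnit.unit) 𝔵 := by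
  apply le_antisymm
  · have := 𝕋.le_ext' (fun (_ : PUnit.{u + 1}) x => φ x) (fun _ => PUnit.unit) (fun x => x) 𝔵
    rwa [map_id', Subsingleton.elim (𝕋.map (fun _ => PUnit.unit) 𝔵) (𝕋.e PUnit.unit)] at this
  · refine 𝕋.ext_le fun w _ h₂ => ?_
    rw [← h₂, xi_map]

theorem ext_e_left (r : Y → X → V) (y : Y) (𝔵 : 𝕋.F X) :
    𝕋.ext r (𝕋.e y) 𝔵 = 𝕋.xi (r y) 𝔵 := by
  rw [xi_eq_ext, ← 𝕋.map_e (fun _ : PUnit.{u + 1} => y) PUnit.unit, ext_map_left]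

theorem mu_isPresheaf (X : 𝕋.TCat) (𝔭 : 𝕋.F (𝕋.VExp X.str)) :
    𝕋.IsTFunctor (𝕋.tensorStr 𝕋.gStr X.str) 𝕋.homStr
      (fun p : PUnit.{u + 1} × X.carrier => 𝕋.mu X.str 𝔭 p.2) := by
  refine (𝕋.isPresheaf_iff _ _).2 fun 𝔵 x => ?_
  have h1 : 𝕋.xi (𝕋.mu X.str 𝔭) 𝔵 = 𝕋.ext (𝕋.mu X.str) (𝕋.e 𝔭) 𝔵 :=
    (𝕋.ext_e_left (𝕋.mu X.str) 𝔭 𝔵).symm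
  rw [h1]
  refine (mul_le_mul_left (𝕋.ext_comp _ X.str (𝕋.e 𝔭) 𝔵).le _).trans ?_
  refine iSup_mul_le fun 𝔛 => ?_
  have h2 := 𝕋.ext_ext_le (fun (h : 𝕋.VExp X.str) (x : X.carrier) => h.fn x) (𝕋.e 𝔭) 𝔛
  rw [m_e] at h2
  rw [mul_assoc]
  exact le_iSup_of_le (𝕋.m 𝔛) (mul_le_mul' h2 (X.trans 𝔛 𝔵 x))

theorem mu_e (X : 𝕋.TCat) (h : 𝕋.VExp X.str) (x : X.carrier) :
    𝕋.mu X.str (𝕋.e h) x = h.fn x := by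
  apply le_antisymm
  · refine iSup_le fun 𝔵 => ?_
    rw [ext_e_left]
    exact VExp.le 𝕋 h 𝔵 x
  · refine le_iSup_of_le (𝕋.e x) ?_
    rw [ext_e_left, xi_e]
    exact mul_one_le (X.refl x) le_rfl le_rfl

theorem mu_map_le (X : 𝕋.TCat) (𝔓 : 𝕋.F (𝕋.F (𝕋.VExp X.str))) (x : X.carrier) :
    𝕋.mu X.str (𝕋.map (fun 𝔭 => ⟨𝕋.mu X.str 𝔭, 𝕋.mu_isPresheaf X 𝔭⟩) 𝔓) x ≤
      𝕋.mu X.str (𝕋.m 𝔓) x := by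
  refine iSup_le fun 𝔵 => ?_
  rw [ext_map_left]
  refine (mul_le_mul_left (𝕋.ext_comp _ X.str 𝔓 𝔵).le _).trans ?_
  refine iSup_mul_le fun 𝔛 => ?_
  rw [mul_assoc]
  exact le_iSup_of_le (𝕋.m 𝔛) (mul_le_mul' (𝕋.ext_ext_le _ 𝔓 𝔛) (X.trans 𝔛 𝔵 x))

theorem le_mu_map (X : 𝕋.TCat)
    (hX : ∀ 𝔛 x, X.str (𝕋.m 𝔛) x ≤ ⨆ 𝔵, 𝕋.ext X.str 𝔛 𝔵 * X.str 𝔵 x)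
    (𝔓 : 𝕋.F (𝕋.F (𝕋.VExp X.str))) (x : X.carrier) :
    𝕋.mu X.str (𝕋.m 𝔓) x ≤
      𝕋.mu X.str (𝕋.map (fun 𝔭 => ⟨𝕋.mu X.str 𝔭, 𝕋.mu_isPresheaf X 𝔭⟩) 𝔓) x := by
  refine iSup_le fun 𝔵 => ?_
  refine (mul_le_mul_left (𝕋.ext_m_le _ 𝔓 𝔵) _).trans ?_
  refine iSup_mul_le fun 𝔛 => iSup_mul_le fun h𝔛 => ?_
  subst h𝔛
  refine (mul_le_mul_right (hX 𝔛 x) _).trans (mul_iSup_le fun 𝔶 => ?_)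
  refine le_iSup_of_le 𝔶 ?_
  rw [ext_map_left, ← mul_assoc]
  refine mul_le_mul_left ?_ _
  refine 𝕋.ext_mul_le (fun 𝔭 𝔵 x => ?_) 𝔓 𝔛 𝔶
  exact le_iSup (fun 𝔵 => 𝕋.ext (fun (h : 𝕋.VExp X.str) x => h.fn x) 𝔭 𝔵 * X.str 𝔵 x) 𝔵

theorem one_le_iInf_hom {ι : Type u} {f g : ι → V} (h : ∀ i, f i ≤ g i) :
    1 ≤ ⨅ i, f i ⇨ₗ g i :=
  le_iInf fun i => le_hom_iff.2 (by rw [one_mul]; exact h i)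

theorem iInf_hom_trans {ι : Type u} (f g h : ι → V) :
    (⨅ i, f i ⇨ₗ g i) * (⨅ i, g i ⇨ₗ h i) ≤ ⨅ i, f i ⇨ₗ h i :=
  le_iInf fun i => le_hom_iff.2 <| by
    have h1 : (⨅ i, f i ⇨ₗ g i) * f i ≤ g i := le_hom_iff.1 (iInf_le _ i)
    have h2 : (⨅ i, g i ⇨ₗ h i) * g i ≤ h i := le_hom_iff.1 (iInf_le _ i)
    rw [mul_right_comm, mul_comm]
    exact (mul_le_mul_right h1 _).trans h2

/-- The `V`-category structure and the algebra structure of `V ^ X`, for `X` core-compact. -/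
abbrev expVAlg (X : 𝕋.TCat)
    (hX : ∀ 𝔛 x, X.str (𝕋.m 𝔛) x ≤ ⨆ 𝔵, 𝕋.ext X.str 𝔛 𝔵 * X.str 𝔵 x) :
    𝕋.VAlg (𝕋.VExp X.str) where
  c h h' := ⨅ x, h.fn x ⇨ₗ h'.fn x
  α 𝔭 := ⟨𝕋.mu X.str 𝔭, 𝕋.mu_isPresheaf X 𝔭⟩
  refl _ := one_le_iInf_hom fun _ => le_rfl
  trans _ _ _ := iInf_hom_trans _ _ _
  ext_le 𝔭 𝔭' := le_iInf fun x => le_hom_iff.2 (𝕋.mu_mono X 𝔭 𝔭' x)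
  unit_le h := one_le_iInf_hom fun x => (𝕋.mu_e X h x).le
  le_unit h := one_le_iInf_hom fun x => (𝕋.mu_e X h x).ge
  assoc_le 𝔓 := one_le_iInf_hom (𝕋.mu_map_le X 𝔓)
  le_assoc 𝔓 := one_le_iInf_hom (𝕋.le_mu_map X hX 𝔓)

end exponential

section constructions

variable {𝕋}

theorem isTFunctor_of_vAlg {X Y : 𝕋.TCat} {A : 𝕋.VAlg X.carrier} {B : 𝕋.VAlg Y.carrier}
    (hA : A.Induces) (hB : B.Induces) {f : X.carrier → Y.carrier}
    (h₀ : ∀ x y, A.c x y ≤ B.c (f x) (f y)) (h : ∀ 𝔵, 1 ≤ B.c (B.α (𝕋.map f 𝔵)) (f (A.α 𝔵))) :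
    𝕋.IsTFunctor X.str Y.str f := fun 𝔵 x => by
  rw [hA, hB]
  exact one_mul_le (h 𝔵) (B.trans _ _ _) (h₀ _ _)

theorem isPseudoHom_of_vAlg {X Y : 𝕋.TCat} {A : 𝕋.VAlg X.carrier} {B : 𝕋.VAlg Y.carrier}
    (hA : A.Induces) (hB : B.Induces) (f : 𝕋.TFunctor X Y)
    (h : ∀ 𝔵, 1 ≤ B.c (f.toFun (A.α 𝔵)) (B.α (𝕋.map f.toFun 𝔵))) : 𝕋.IsPseudoHom f := by
  obtain ⟨β, hβ, -⟩ := hB.exists_isAlg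
  refine (isPseudoHom_iff ⟨β, hβ⟩ hA f).2 fun 𝔵 y => ?_
  rw [hB, hB.str₀_eq]
  exact one_mul_le (h 𝔵) (B.trans _ _ _) le_rfl

/-- The identity `T`-functor. -/
abbrev TFunctor.id (X : 𝕋.TCat) : 𝕋.TFunctor X X where
  toFun x := x
  isTFunctor 𝔵 x := by rw [map_id']

/-- The composite of `T`-functors. -/
abbrev TFunctor.comp {X Y Z : 𝕋.TCat} (f : 𝕋.TFunctor X Y) (g : 𝕋.TFunctor Y Z) :
    𝕋.TFunctor X Z where
  toFun x := g.toFun (f.toFun x)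
  isTFunctor 𝔵 x := by
    rw [← 𝕋.map_map f.toFun g.toFun]
    exact (f.isTFunctor 𝔵 x).trans (g.isTFunctor _ _)

theorem isPseudoHom_id (X : 𝕋.RepCat) : 𝕋.IsPseudoHom (TFunctor.id X.toTCat) := by
  refine (isPseudoHom_iff X.representable X.induces _).2 fun 𝔵 y => ?_
  rw [map_id']
  exact (X.induces 𝔵 y).le

theorem isPseudoHom_comp {X Y Z : 𝕋.RepCat} (f : 𝕋.TFunctor X.toTCat Y.toTCat)
    (g : 𝕋.TFunctor Y.toTCat Z.toTCat) (hf : 𝕋.IsPseudoHom f) (hg : 𝕋.IsPseudoHom g) :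
    𝕋.IsPseudoHom (f.comp g) := by
  have hf' := (isPseudoHom_iff Y.representable X.induces _).1 hf
  have hg' := (isPseudoHom_iff Z.representable Y.induces _).1 hg
  refine (isPseudoHom_iff Z.representable X.induces _).2 fun 𝔵 y => ?_
  have h1 : 1 ≤ Y.toTCat.str₀ (f.toFun (X.vAlg.α 𝔵)) (Y.vAlg.α (𝕋.map f.toFun 𝔵)) :=
    le_trans (by rw [Y.induces]; exact Y.vAlg.refl _) (hf' 𝔵 _)
  rw [← 𝕋.map_map f.toFun g.toFun]
  exact (hg' _ y).trans
    (one_mul_le (h1.trans (g.str₀_le _ _)) (Z.toTCat.trans₀ _ _ _) le_rfl)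

/-- A pseudo-homomorphism, as a morphism of representable `T`-categories. -/
@[ext]
structure PseudoHom (X Y : 𝕋.RepCat) extends 𝕋.TFunctor X.toTCat Y.toTCat where
  isPseudoHom : 𝕋.IsPseudoHom toTFunctor

instance : Category 𝕋.TCat where
  Hom X Y := 𝕋.TFunctor X Y
  id X := TFunctor.id X
  comp f g := f.comp g

instance : Category 𝕋.RepCat where
  Hom X Y := PseudoHom X Y
  id X := ⟨TFunctor.id X.toTCat, isPseudoHom_id X⟩
  comp f g := ⟨f.toTFunctor.comp g.toTFunctor, isPseudoHom_comp _ _ f.isPseudoHom g.isPseudoHom⟩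

/-- The forgetful functor from `T`-categories to sets. -/
def TCat.forget : 𝕋.TCat ⥤ Type u where
  obj X := X.carrier
  map f := ↾(f : 𝕋.TFunctor _ _).toFun

/-- The forgetful functor from representable `T`-categories to `T`-categories. -/
def RepCat.forget : 𝕋.RepCat ⥤ 𝕋.TCat where
  obj X := X.toTCat
  map f := (f : PseudoHom _ _).toTFunctor

/-- A `T`-category `X` is separated if equivalent `T`-functors with codomain `X` are equal. -/
def Separated : ObjectProperty 𝕋.TCat := fun X =>
  ∀ (Y : 𝕋.TCat) (f g : 𝕋.TFunctor Y X), X.Equivalent f.toFun g.toFun → f = g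

theorem separated_of_antisymm {X : 𝕋.TCat}
    (h : ∀ x y, 1 ≤ X.str₀ x y → 1 ≤ X.str₀ y x → x = y) : Separated X :=
  fun _ _ _ hfg => TFunctor.ext (funext fun y => h _ _ (hfg.1 y) (hfg.2 y))

theorem eq_of_one_le_iInf_hom {X : Type u} {φ ψ : X → V} (h₁ : 1 ≤ ⨅ x, φ x ⇨ₗ ψ x) (h₂ : 1 ≤ ⨅ x, ψ x ⇨ₗ φ x) : φ = ψ :=
  funext fun x => le_antisymm
    (by simpa only [one_mul] using le_hom_iff.1 (h₁.trans (iInf_le _ x)))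
    (by simpa only [one_mul] using le_hom_iff.1 (h₂.trans (iInf_le _ x)))

variable [Subsingleton (𝕋.F PUnit.{u + 1})]

theorem isPresheaf_of_vAlg {X : 𝕋.TCat} {A : 𝕋.VAlg X.carrier} (hA : A.Induces)
    {φ : X.carrier → V} (h₁ : ∀ x y, φ x * A.c x y ≤ φ y) (h₂ : ∀ 𝔵, 𝕋.xi φ 𝔵 ≤ φ (A.α 𝔵)) :
    𝕋.IsTFunctor (𝕋.tensorStr 𝕋.gStr X.str) 𝕋.homStr
      (fun p : PUnit.{u + 1} × X.carrier => φ p.2) :=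
  (𝕋.isPresheaf_iff _ _).2 fun 𝔵 x => by
    rw [hA]
    exact (mul_le_mul_left (h₂ 𝔵) _).trans (h₁ _ _)

theorem VExp.mul_c_le {X : 𝕋.TCat} {A : 𝕋.VAlg X.carrier} (hA : A.Induces) (φ : 𝕋.VExp X.str)
    (x y : X.carrier) : φ.fn x * A.c x y ≤ φ.fn y := by
  rw [← hA.str₀_eq]
  exact VExp.mul_le 𝕋 φ x y

theorem VExp.xi_le {X : 𝕋.TCat} {A : 𝕋.VAlg X.carrier} (hA : A.Induces) (φ : 𝕋.VExp X.str)
    (𝔵 : 𝕋.F X.carrier) : 𝕋.xi φ.fn 𝔵 ≤ φ.fn (A.α 𝔵) :=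
  mul_one_le ((A.refl (A.α 𝔵)).trans_eq (hA _ _).symm) (VExp.le 𝕋 φ 𝔵 (A.α 𝔵)) le_rfl

theorem hat_const {X : Type u} (φ : X → V) (t : 𝕋.F PUnit.{u + 1}) (𝔵 : 𝕋.F X) :
    𝕋.hat (fun (_ : 𝕋.F PUnit.{u + 1}) x => φ x) t 𝔵 = 𝕋.xi φ 𝔵 := by
  apply le_antisymm
  · refine iSup₂_le fun 𝔛 _ => 𝕋.ext_le fun w _ h₂ => ?_
    rw [← h₂, xi_map]
  · have h := 𝕋.le_ext' (fun (_ : 𝕋.F PUnit.{u + 1}) x => φ x) (fun _ => 𝕋.e PUnit.unit)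
      (fun x => x) 𝔵
    have h' := h.trans (𝕋.le_hat _ _ _)
    rwa [map_id', Subsingleton.elim (𝕋.m _) t] at h'

/-! ### The exponential `V ^ X` and its dual `V X`, for `X` representable -/

/-- The algebra structure of `V ^ X`. -/
abbrev RepCat.expVAlg (X : 𝕋.RepCat) : 𝕋.VAlg (𝕋.VExp X.toTCat.str) :=
  𝕋.expVAlg X.toTCat X.induces.coreCompact

theorem RepCat.expStr_eq (X : 𝕋.RepCat) :
    𝕋.expStr X.toTCat.str 𝕋.homStr = X.expVAlg.toTCat.str :=
  funext fun 𝔭 => funext fun h => 𝕋.expStr_eq X.toTCat.str 𝔭 h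

/-- The exponential `V ^ X`, as a `T`-category. -/
abbrev RepCat.expTCat (X : 𝕋.RepCat) : 𝕋.TCat where
  carrier := 𝕋.VExp X.toTCat.str
  str := 𝕋.expStr X.toTCat.str 𝕋.homStr
  refl := by rw [X.expStr_eq]; exact X.expVAlg.toTCat.refl
  trans := by rw [X.expStr_eq]; exact X.expVAlg.toTCat.trans

theorem RepCat.exp_induces (X : 𝕋.RepCat) : VAlg.Induces (X := X.expTCat) X.expVAlg :=
  fun 𝔭 h => congrFun (congrFun X.expStr_eq 𝔭) h

/-- The exponential `V ^ X`, as a representable `T`-category. -/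
abbrev RepCat.exp (X : 𝕋.RepCat) : 𝕋.RepCat where
  toTCat := X.expTCat
  representable := by
    obtain ⟨α, h, -⟩ := X.exp_induces.exists_isAlg
    exact ⟨α, h⟩

/-- The `T`-category `V X`, dual to `V ^ X`. -/
noncomputable abbrev RepCat.vietoris (X : 𝕋.RepCat) : 𝕋.RepCat := X.exp.op

theorem RepCat.vietoris_induces (X : 𝕋.RepCat) : VAlg.Induces (X := X.vietoris.toTCat) X.expVAlg.op :=
  VAlg.Induces.op (X := X.exp) X.exp_induces

/-- The structure of `V X` is given by the pointwise `hom` and by `μ`. -/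
theorem RepCat.vietoris_str (X : 𝕋.RepCat) (𝔭 : 𝕋.F X.vietoris.toTCat.carrier) (φ : X.vietoris.toTCat.carrier) :
    X.vietoris.toTCat.str 𝔭 φ = ⨅ x, φ.fn x ⇨ₗ 𝕋.mu X.toTCat.str 𝔭 x :=
  X.vietoris_induces 𝔭 φ

theorem RepCat.vietoris_str₀ (X : 𝕋.RepCat) (φ ψ : X.vietoris.toTCat.carrier) :
    X.vietoris.toTCat.str₀ φ ψ = ⨅ x, ψ.fn x ⇨ₗ φ.fn x :=
  X.vietoris_induces.str₀_eq φ ψ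

end constructions

/-! ### The monad `V` -/

section vietoris

variable {𝕋} [Subsingleton (𝕋.F PUnit.{u + 1})]

theorem xi_iSup {X Y : Type u} (φ : X → V) (r : X → Y → V) (𝔶 : 𝕋.F Y) :
    𝕋.xi (fun y => ⨆ x, φ x * r x y) 𝔶 = ⨆ 𝔵, 𝕋.xi φ 𝔵 * 𝕋.ext r 𝔵 𝔶 := by
  have h := 𝕋.ext_comp (fun (_ : PUnit.{u + 1}) x => φ x) r (𝕋.e PUnit.unit) 𝔶
  simp only [← xi_eq_ext] at h
  exact h

namespace RepCat

theorem vietoris_separated (X : 𝕋.RepCat) : Separated X.vietoris.toTCat :=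
  separated_of_antisymm fun φ ψ h₁ h₂ => by
    rw [vietoris_str₀] at h₁ h₂
    exact Exp.ext (eq_of_one_le_iInf_hom h₂ h₁)

theorem str₀_isPresheaf (X : 𝕋.RepCat) (x : X.toTCat.carrier) :
    𝕋.IsTFunctor (𝕋.tensorStr 𝕋.gStr X.toTCat.str) 𝕋.homStr
      (fun p : PUnit.{u + 1} × X.toTCat.carrier => X.toTCat.str₀ x p.2) := by
  refine isPresheaf_of_vAlg X.induces (X.vAlg.trans x) fun 𝔵 => ?_
  rw [← ext_e_left]
  exact (X.vAlg.ext_le _ _).trans_eq (X.vAlg.c_unit x _)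

/-- The underlying map of the Yoneda functor `y : X → V X`, `y x = a₀(x, -)`. -/
noncomputable abbrev y (X : 𝕋.RepCat) (x : X.toTCat.carrier) : X.vietoris.toTCat.carrier :=
  ⟨X.toTCat.str₀ x, X.str₀_isPresheaf x⟩

theorem mu_y (X : 𝕋.RepCat) (𝔵 : 𝕋.F X.toTCat.carrier) (x : X.toTCat.carrier) :
    𝕋.mu X.toTCat.str (𝕋.map X.y 𝔵) x = X.toTCat.str 𝔵 x := by
  apply le_antisymm
  · refine iSup_le fun 𝔶 => ?_
    rw [ext_map_left]
    exact (mul_le_mul_left (𝕋.ext_e_le_hat X.toTCat.str 𝔵 𝔶) _).trans (X.toTCat.hat_mul_le _ _ _)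
  · refine le_iSup_of_le 𝔵 ?_
    rw [ext_map_left]
    exact one_mul_le (𝕋.one_le_ext X.toTCat.refl₀ 𝔵) le_rfl le_rfl

theorem str₀_y (X : 𝕋.RepCat) (φ : X.vietoris.toTCat.carrier) (x : X.toTCat.carrier) :
    X.vietoris.toTCat.str₀ φ (X.y x) = φ.fn x := by
  rw [vietoris_str₀]
  apply le_antisymm
  · exact mul_one_le (X.toTCat.refl₀ x) (le_hom_iff.1 (iInf_le _ x)) le_rfl
  · exact le_iInf fun z => le_hom_iff.2 (VExp.mul_le 𝕋 φ x z)

theorem str_y (X : 𝕋.RepCat) (𝔭 : 𝕋.F X.vietoris.toTCat.carrier) (x : X.toTCat.carrier) :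
    X.vietoris.toTCat.str 𝔭 (X.y x) = 𝕋.mu X.toTCat.str 𝔭 x := by
  rw [X.vietoris_induces, ← X.vietoris_induces.str₀_eq, str₀_y]

/-- The Yoneda functor `y : X → V X`. -/
noncomputable abbrev yV (X : 𝕋.RepCat) : X ⟶ X.vietoris where
  toFun := X.y
  isTFunctor := isTFunctor_of_vAlg X.induces X.vietoris_induces
    (fun x y => le_iInf fun z => le_hom_iff.2 (X.vAlg.trans x y z))
    (fun 𝔵 => one_le_iInf_hom fun x =>
      ((X.mu_y 𝔵 x).trans (X.induces 𝔵 x)).ge)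
  isPseudoHom := isPseudoHom_of_vAlg X.induces X.vietoris_induces _
    (fun 𝔵 => one_le_iInf_hom fun x =>
      ((X.mu_y 𝔵 x).trans (X.induces 𝔵 x)).le)

/-- The map `φ ↦ f_⊛ ∘ φ`, where `f_⊛ = b · T f`; here `φ` is considered as a `T`-relation from
the one-point set to `X`. -/
noncomputable def vMapFn {X Y : 𝕋.RepCat} (f : X ⟶ Y) (φ : X.vietoris.toTCat.carrier) (y : Y.toTCat.carrier) :
    V :=
  𝕋.kleisli (fun 𝔵 y => Y.toTCat.str (𝕋.map f.toFun 𝔵) y)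
    (fun (_ : 𝕋.F PUnit.{u + 1}) x => φ.fn x) (𝕋.e PUnit.unit) y

theorem str_map_eq {X Y : 𝕋.RepCat} (f : X ⟶ Y) (𝔵 : 𝕋.F X.toTCat.carrier) (y : Y.toTCat.carrier) :
    Y.toTCat.str (𝕋.map f.toFun 𝔵) y = Y.toTCat.str₀ (f.toFun (X.vAlg.α 𝔵)) y := by
  apply le_antisymm
  · exact (isPseudoHom_iff Y.representable X.induces f.toTFunctor).1 f.isPseudoHom 𝔵 y
  · refine one_mul_le (a := X.toTCat.str 𝔵 (X.vAlg.α 𝔵)) ?_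
      ((mul_le_mul_left (f.isTFunctor _ _) _).trans (Y.toTCat.mul_le _ _ _)) le_rfl
    rw [X.induces]
    exact X.vAlg.refl _

theorem vMapFn_eq {X Y : 𝕋.RepCat} (f : X ⟶ Y) (φ : X.vietoris.toTCat.carrier)
    (y : Y.toTCat.carrier) : vMapFn f φ y = ⨆ x, φ.fn x * Y.toTCat.str₀ (f.toFun x) y := by
  apply le_antisymm
  · refine iSup_le fun 𝔵 => ?_
    rw [hat_const]
    refine (mul_le_mul_right (str_map_eq f 𝔵 y).le _).trans ?_
    exact le_iSup_of_le (X.vAlg.α 𝔵) (mul_le_mul_left (VExp.xi_le X.induces φ 𝔵) _)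
  · refine iSup_le fun x => le_iSup_of_le (𝕋.e x) ?_
    rw [hat_const, xi_e]
    exact mul_le_mul_right (congrArg (fun t => Y.toTCat.str t y) (𝕋.map_e f.toFun x)).ge _

theorem ext_str₀_map {X Y : 𝕋.RepCat} (f : X ⟶ Y) (𝔵 : 𝕋.F X.toTCat.carrier)
    (𝔶 : 𝕋.F Y.toTCat.carrier) (y : Y.toTCat.carrier) :
    𝕋.ext (fun x y => Y.toTCat.str₀ (f.toFun x) y) 𝔵 𝔶 * Y.toTCat.str 𝔶 y ≤
      Y.toTCat.str (𝕋.map f.toFun 𝔵) y := by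
  rw [← 𝕋.ext_map_left Y.toTCat.str₀]
  exact (mul_le_mul_left (𝕋.ext_e_le_hat _ _ _) _).trans (Y.toTCat.hat_mul_le _ _ _)

theorem vMapFn_isPresheaf {X Y : 𝕋.RepCat} (f : X ⟶ Y) (φ : X.vietoris.toTCat.carrier) :
    𝕋.IsTFunctor (𝕋.tensorStr 𝕋.gStr Y.toTCat.str) 𝕋.homStr
      (fun p : PUnit.{u + 1} × Y.toTCat.carrier => vMapFn f φ p.2) := by
  refine (𝕋.isPresheaf_iff _ _).2 fun 𝔶 y => ?_
  have h : vMapFn f φ = fun y => ⨆ x, φ.fn x * Y.toTCat.str₀ (f.toFun x) y :=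
    funext (vMapFn_eq f φ)
  rw [h, xi_iSup]
  refine iSup_mul_le fun 𝔵 => ?_
  rw [mul_assoc]
  refine (mul_le_mul_right (ext_str₀_map f 𝔵 𝔶 y) _).trans ?_
  rw [str_map_eq]
  exact le_iSup_of_le (X.vAlg.α 𝔵) (mul_le_mul_left (VExp.xi_le X.induces φ 𝔵) _)

/-- The map `V f`. -/
noncomputable abbrev vMapObj {X Y : 𝕋.RepCat} (f : X ⟶ Y) (φ : X.vietoris.toTCat.carrier) :
    Y.vietoris.toTCat.carrier :=
  ⟨vMapFn f φ, vMapFn_isPresheaf f φ⟩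

theorem mu_vMapObj {X Y : 𝕋.RepCat} (f : X ⟶ Y) (𝔭 : 𝕋.F X.vietoris.toTCat.carrier)
    (y : Y.toTCat.carrier) :
    𝕋.mu Y.toTCat.str (𝕋.map (vMapObj f) 𝔭) y =
      vMapFn f (X.expVAlg.α 𝔭) y := by
  have hext : ∀ 𝔶, 𝕋.ext (fun (φ : Y.vietoris.toTCat.carrier) y => φ.fn y)
      (𝕋.map (vMapObj f) 𝔭) 𝔶 = ⨆ 𝔵, 𝕋.ext (fun (φ : X.vietoris.toTCat.carrier) x => φ.fn x) 𝔭 𝔵 *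
        𝕋.ext (fun x y => Y.toTCat.str₀ (f.toFun x) y) 𝔵 𝔶 := by
    intro 𝔶
    rw [ext_map_left, ← ext_comp]
    simp only [vMapFn_eq]
  rw [vMapFn_eq]
  apply le_antisymm
  · refine iSup_le fun 𝔶 => ?_
    rw [hext]
    refine iSup_mul_le fun 𝔵 => ?_
    rw [mul_assoc]
    refine (mul_le_mul_right (ext_str₀_map f 𝔵 𝔶 y) _).trans ?_
    rw [str_map_eq]
    refine le_iSup_of_le (X.vAlg.α 𝔵) (mul_le_mul_left ?_ _)
    refine le_iSup_of_le 𝔵 (mul_one_le ?_ le_rfl le_rfl)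
    rw [X.induces]
    exact X.vAlg.refl _
  · refine iSup_le fun x => iSup_mul_le fun 𝔵 => ?_
    refine le_iSup_of_le (𝕋.map f.toFun 𝔵) ?_
    rw [hext, mul_assoc]
    refine mul_le_mul' (le_iSup_of_le 𝔵 (mul_one_le ?_ le_rfl le_rfl)) ?_
    · rw [← 𝕋.ext_map_left Y.toTCat.str₀]
      exact 𝕋.one_le_ext Y.toTCat.refl₀ _
    · exact (mul_le_mul_left (f.isTFunctor _ _) _).trans (Y.toTCat.mul_le _ _ _)

/-- The map `V f`, as a pseudo-homomorphism. -/
noncomputable abbrev vMap {X Y : 𝕋.RepCat} (f : X ⟶ Y) : X.vietoris ⟶ Y.vietoris where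
  toFun := vMapObj f
  isTFunctor := isTFunctor_of_vAlg X.vietoris_induces Y.vietoris_induces
    (fun φ ψ => le_iInf fun y => le_hom_iff.2 (by
      change (⨅ x, ψ.fn x ⇨ₗ φ.fn x) * vMapFn f ψ y ≤ vMapFn f φ y
      rw [vMapFn_eq, vMapFn_eq]
      refine mul_iSup_le fun x => le_iSup_of_le x ?_
      rw [← mul_assoc]
      have h : (⨅ x, ψ.fn x ⇨ₗ φ.fn x) * ψ.fn x ≤ φ.fn x := le_hom_iff.1 (iInf_le _ x)
      exact mul_le_mul_left h _))
    (fun 𝔭 => one_le_iInf_hom fun y => (mu_vMapObj f 𝔭 y).ge)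
  isPseudoHom := isPseudoHom_of_vAlg X.vietoris_induces Y.vietoris_induces _
    (fun 𝔭 => one_le_iInf_hom fun y => (mu_vMapObj f 𝔭 y).le)

/-- The map `Ψ ↦ y^⊛ ∘ Ψ`, where `y^⊛` is the `T`-relation `(𝔭, x) ↦ (V X)(𝔭, y x)`. -/
noncomputable def vMultFn (X : 𝕋.RepCat) (Ψ : X.vietoris.vietoris.toTCat.carrier) (x : X.toTCat.carrier) : V :=
  𝕋.kleisli (fun 𝔭 x => X.vietoris.toTCat.str 𝔭 (X.y x))
    (fun (_ : 𝕋.F PUnit.{u + 1}) φ => Ψ.fn φ) (𝕋.e PUnit.unit) x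

theorem vMultFn_eq (X : 𝕋.RepCat) (Ψ : X.vietoris.vietoris.toTCat.carrier)
    (x : X.toTCat.carrier) : X.vMultFn Ψ x = Ψ.fn (X.y x) := by
  apply le_antisymm
  · refine iSup_le fun 𝔭 => ?_
    rw [hat_const]
    exact VExp.le 𝕋 Ψ 𝔭 (X.y x)
  · refine le_iSup_of_le (𝕋.e (X.y x)) ?_
    rw [hat_const, xi_e]
    exact mul_one_le (X.vietoris.toTCat.refl _) le_rfl le_rfl

theorem vMultFn_isPresheaf (X : 𝕋.RepCat) (Ψ : X.vietoris.vietoris.toTCat.carrier) :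
    𝕋.IsTFunctor (𝕋.tensorStr 𝕋.gStr X.toTCat.str) 𝕋.homStr
      (fun p : PUnit.{u + 1} × X.toTCat.carrier => X.vMultFn Ψ p.2) := by
  refine (𝕋.isPresheaf_iff _ _).2 fun 𝔵 x => ?_
  have h : X.vMultFn Ψ = fun x => Ψ.fn (X.y x) := funext (X.vMultFn_eq Ψ)
  rw [h, ← 𝕋.xi_map X.y Ψ.fn]
  exact (mul_le_mul_right (X.yV.isTFunctor 𝔵 x) _).trans (VExp.le 𝕋 Ψ _ _)

/-- The multiplication of the monad `V`, as a map. -/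
noncomputable abbrev vMultObj (X : 𝕋.RepCat) (Ψ : X.vietoris.vietoris.toTCat.carrier) :
    X.vietoris.toTCat.carrier :=
  ⟨X.vMultFn Ψ, X.vMultFn_isPresheaf Ψ⟩

theorem fn_mul_fn_le (X : 𝕋.RepCat) (Ψ : X.vietoris.vietoris.toTCat.carrier)
    (φ : X.vietoris.toTCat.carrier) (x : X.toTCat.carrier) :
    Ψ.fn φ * φ.fn x ≤ Ψ.fn (X.y x) := by
  rw [← X.str₀_y φ x]
  exact VExp.mul_le 𝕋 Ψ φ (X.y x)

theorem mu_vMultObj (X : 𝕋.RepCat) (𝔓 : 𝕋.F X.vietoris.vietoris.toTCat.carrier)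
    (x : X.toTCat.carrier) :
    𝕋.mu X.toTCat.str (𝕋.map X.vMultObj 𝔓) x = 𝕋.mu X.vietoris.toTCat.str 𝔓 (X.y x) := by
  have hext : ∀ 𝔵, 𝕋.ext (fun (φ : X.vietoris.toTCat.carrier) x => φ.fn x)
      (𝕋.map X.vMultObj 𝔓) 𝔵 =
      𝕋.ext (fun (Ψ : X.vietoris.vietoris.toTCat.carrier) x => Ψ.fn (X.y x)) 𝔓 𝔵 := by
    intro 𝔵
    rw [ext_map_left]
    simp only [vMultFn_eq]
  apply le_antisymm
  · refine iSup_le fun 𝔵 => le_iSup_of_le (𝕋.map X.y 𝔵) ?_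
    rw [hext, ext_map_right]
    exact mul_le_mul_right (X.yV.isTFunctor 𝔵 x) _
  · refine iSup_le fun 𝔭 => ?_
    rw [str_y]
    refine mul_iSup_le fun 𝔵 => le_iSup_of_le 𝔵 ?_
    rw [hext, ← mul_assoc]
    exact mul_le_mul_left (𝕋.ext_mul_le X.fn_mul_fn_le 𝔓 𝔭 𝔵) _

/-- The multiplication of the monad `V`. -/
noncomputable abbrev vMult (X : 𝕋.RepCat) : X.vietoris.vietoris ⟶ X.vietoris where
  toFun := X.vMultObj
  isTFunctor := isTFunctor_of_vAlg X.vietoris.vietoris_induces X.vietoris_induces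
    (fun Φ Ψ => le_iInf fun x => by
      change _ ≤ X.vMultFn Ψ x ⇨ₗ X.vMultFn Φ x
      rw [vMultFn_eq, vMultFn_eq]
      exact iInf_le _ _)
    (fun 𝔓 => one_le_iInf_hom fun x => by
      change X.vMultFn _ x ≤ 𝕋.mu X.toTCat.str (𝕋.map X.vMultObj 𝔓) x
      rw [mu_vMultObj, vMultFn_eq])
  isPseudoHom := isPseudoHom_of_vAlg X.vietoris.vietoris_induces X.vietoris_induces _
    (fun 𝔓 => one_le_iInf_hom fun x => by
      change 𝕋.mu X.toTCat.str (𝕋.map X.vMultObj 𝔓) x ≤ X.vMultFn _ x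
      rw [mu_vMultObj, vMultFn_eq])

theorem hom_ext {X Y : 𝕋.RepCat} {f g : X ⟶ Y} (h : ∀ x, f.toFun x = g.toFun x) : f = g :=
  PseudoHom.ext (funext h)

theorem comp_toFun {X Y Z : 𝕋.RepCat} (f : X ⟶ Y) (g : Y ⟶ Z) (x : X.toTCat.carrier) :
    (f ≫ g).toFun x = g.toFun (f.toFun x) := rfl

theorem vMap_id (X : 𝕋.RepCat) : vMap (𝟙 X) = 𝟙 X.vietoris :=
  hom_ext fun φ => Exp.ext (funext fun x => by
    refine (vMapFn_eq (𝟙 X) φ x).trans (le_antisymm (iSup_le fun z => ?_) ?_)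
    · exact VExp.mul_le 𝕋 φ z x
    · exact le_iSup_of_le x (mul_one_le (X.toTCat.refl₀ x) le_rfl le_rfl))

theorem vMap_comp {X Y Z : 𝕋.RepCat} (f : X ⟶ Y) (g : Y ⟶ Z) :
    vMap (f ≫ g) = vMap f ≫ vMap g :=
  hom_ext fun φ => Exp.ext (funext fun z => by
    refine (vMapFn_eq (f ≫ g) φ z).trans (Eq.trans ?_ (vMapFn_eq g (vMapObj f φ) z).symm)
    simp only [vMapFn_eq]
    apply le_antisymm
    · refine iSup_le fun x => le_iSup_of_le (f.toFun x) (mul_le_mul_left ?_ _)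
      exact le_iSup_of_le x (mul_one_le (Y.toTCat.refl₀ _) le_rfl le_rfl)
    · refine iSup_le fun y => iSup_mul_le fun x => le_iSup_of_le x ?_
      rw [mul_assoc]
      exact mul_le_mul_right ((mul_le_mul_left (g.str₀_le _ _) _).trans
        (Z.toTCat.trans₀ _ _ _)) _)

theorem yV_naturality {X Y : 𝕋.RepCat} (f : X ⟶ Y) : f ≫ Y.yV = X.yV ≫ vMap f :=
  hom_ext fun x => Exp.ext (funext fun y => by
    refine Eq.trans ?_ (vMapFn_eq f (X.y x) y).symm
    apply le_antisymm
    · exact le_iSup_of_le x (one_mul_le (X.toTCat.refl₀ x) le_rfl le_rfl)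
    · refine iSup_le fun z => ?_
      exact (mul_le_mul_left (f.str₀_le _ _) _).trans (Y.toTCat.trans₀ _ _ _))

theorem vMult_naturality {X Y : 𝕋.RepCat} (f : X ⟶ Y) :
    vMap (vMap f) ≫ Y.vMult = X.vMult ≫ vMap f :=
  hom_ext fun Ψ => Exp.ext (funext fun y => by
    refine (Y.vMultFn_eq _ y).trans ((vMapFn_eq (vMap f) Ψ (Y.y y)).trans (Eq.trans ?_
      (vMapFn_eq f (X.vMultObj Ψ) y).symm))
    have h : ∀ φ, Y.vietoris.toTCat.str₀ (vMapObj f φ) (Y.y y) =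
        ⨆ x, φ.fn x * Y.toTCat.str₀ (f.toFun x) y := fun φ =>
      (Y.str₀_y _ y).trans (vMapFn_eq f φ y)
    refine (iSup_congr fun φ => congrArg (Ψ.fn φ * ·) (h φ)).trans ?_
    simp only [vMultFn_eq]
    apply le_antisymm
    · refine iSup_le fun φ => mul_iSup_le fun x => le_iSup_of_le x ?_
      rw [← mul_assoc]
      exact mul_le_mul_left (X.fn_mul_fn_le Ψ φ x) _
    · refine iSup_le fun x => le_iSup_of_le (X.y x) (mul_le_mul_right ?_ _)
      exact le_iSup_of_le x (one_mul_le (X.toTCat.refl₀ x) le_rfl le_rfl))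

theorem yV_vMult (X : 𝕋.RepCat) : X.vietoris.yV ≫ X.vMult = 𝟙 X.vietoris :=
  hom_ext fun φ => Exp.ext (funext fun x =>
    (X.vMultFn_eq _ x).trans (X.str₀_y φ x))

theorem vMap_yV_vMult (X : 𝕋.RepCat) : vMap X.yV ≫ X.vMult = 𝟙 X.vietoris :=
  hom_ext fun φ => Exp.ext (funext fun x => by
    refine (X.vMultFn_eq _ x).trans ((vMapFn_eq X.yV φ (X.y x)).trans ?_)
    refine (iSup_congr fun z => congrArg (φ.fn z * ·) (X.str₀_y (X.y z) x)).trans ?_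
    apply le_antisymm
    · exact iSup_le fun z => VExp.mul_le 𝕋 φ z x
    · exact le_iSup_of_le x (mul_one_le (X.toTCat.refl₀ x) le_rfl le_rfl))

theorem vMult_assoc (X : 𝕋.RepCat) : vMap X.vMult ≫ X.vMult = X.vietoris.vMult ≫ X.vMult :=
  hom_ext fun Θ => Exp.ext (funext fun x => by
    refine (X.vMultFn_eq _ x).trans ((vMapFn_eq X.vMult Θ (X.y x)).trans (Eq.trans ?_
      (X.vMultFn_eq (X.vietoris.vMultObj Θ) x).symm))
    have h : ∀ Ψ, X.vietoris.toTCat.str₀ (X.vMultObj Ψ) (X.y x) = Ψ.fn (X.y x) := fun Ψ =>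
      (X.str₀_y _ x).trans (X.vMultFn_eq Ψ x)
    refine (iSup_congr fun Ψ => congrArg (Θ.fn Ψ * ·) (h Ψ)).trans ?_
    refine Eq.trans ?_ (X.vietoris.vMultFn_eq Θ (X.y x)).symm
    apply le_antisymm
    · exact iSup_le fun Ψ => X.vietoris.fn_mul_fn_le Θ Ψ (X.y x)
    · exact le_iSup_of_le (X.vietoris.y (X.y x))
        (mul_one_le (X.vietoris.toTCat.refl₀ _) le_rfl le_rfl))

end RepCat

end vietoris

/-! ### The monad `P` -/

section hat

variable {𝕋} {X Y Z : Type u}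

theorem hat_map_right (α : 𝕋.F X → Z → V) (g : Y → Z) (𝔵 : 𝕋.F X) (𝔶 : 𝕋.F Y) :
    𝕋.hat α 𝔵 (𝕋.map g 𝔶) = 𝕋.hat (fun 𝔵 y => α 𝔵 (g y)) 𝔵 𝔶 := by
  simp only [hat, ext_map_right]

theorem hat_map_left (α : 𝕋.F Z → Y → V) (f : X → Z) (𝔵 : 𝕋.F X) (𝔶 : 𝕋.F Y) :
    𝕋.hat α (𝕋.map f 𝔵) 𝔶 = 𝕋.hat (fun 𝔵 y => α (𝕋.map f 𝔵) y) 𝔵 𝔶 := by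
  apply le_antisymm
  · refine iSup₂_le fun ℨ h => ?_
    obtain ⟨𝔛, h₁, h₂⟩ := 𝕋.exists_of_m_eq f 𝔵 ℨ h.symm
    subst h₁ h₂
    rw [ext_map_left]
    exact 𝕋.le_hat _ _ _
  · refine iSup₂_le fun 𝔛 h => ?_
    subst h
    rw [← 𝕋.ext_map_left α, map_m]
    exact 𝕋.le_hat _ _ _

theorem hat_mono {α β : 𝕋.F X → Y → V} (h : ∀ 𝔵 y, α 𝔵 y ≤ β 𝔵 y) (𝔵 : 𝕋.F X) (𝔶 : 𝕋.F Y) :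
    𝕋.hat α 𝔵 𝔶 ≤ 𝕋.hat β 𝔵 𝔶 :=
  iSup₂_mono fun 𝔛 _ => 𝕋.ext_mono h 𝔛 𝔶

theorem hat_map_le {X Y : 𝕋.TCat} (f : 𝕋.TFunctor X Y) (𝔵 𝔵' : 𝕋.F X.carrier) :
    𝕋.hat X.str 𝔵 𝔵' ≤ 𝕋.hat Y.str (𝕋.map f.toFun 𝔵) (𝕋.map f.toFun 𝔵') := by
  rw [hat_map_left, hat_map_right]
  exact hat_mono f.isTFunctor 𝔵 𝔵'

end hat

section presheaf

variable {𝕋} [Subsingleton (𝕋.F PUnit.{u + 1})]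

namespace TCat

/-- The dual `(T X)^op` of the representable `T`-category `T X`. -/
noncomputable abbrev opFree (X : 𝕋.TCat) : 𝕋.RepCat :=
  RepCat.op ⟨X.free, (VAlg.free X).representable⟩

theorem opFree_induces (X : 𝕋.TCat) : VAlg.Induces (X := X.opFree.toTCat) (VAlg.free X).op :=
  VAlg.Induces.op (X := ⟨X.free, (VAlg.free X).representable⟩) (A := VAlg.free X) fun _ _ => rfl

/-- The `T`-category `P X = V ^ ((T X)^op)` of presheaves. -/
noncomputable abbrev presheaf (X : 𝕋.TCat) : 𝕋.TCat := X.opFree.exp.toTCat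

theorem presheaf_induces (X : 𝕋.TCat) : VAlg.Induces (X := X.presheaf) X.opFree.expVAlg :=
  X.opFree.exp_induces

theorem presheaf_str (X : 𝕋.TCat) (𝔭 : 𝕋.F X.presheaf.carrier) (ψ : X.presheaf.carrier) :
    X.presheaf.str 𝔭 ψ = ⨅ 𝔵, 𝕋.mu X.opFree.toTCat.str 𝔭 𝔵 ⇨ₗ ψ.fn 𝔵 :=
  X.presheaf_induces 𝔭 ψ

theorem presheaf_str₀ (X : 𝕋.TCat) (φ ψ : X.presheaf.carrier) :
    X.presheaf.str₀ φ ψ = ⨅ 𝔵, φ.fn 𝔵 ⇨ₗ ψ.fn 𝔵 :=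
  X.presheaf_induces.str₀_eq φ ψ

theorem presheaf_separated (X : 𝕋.TCat) : Separated X.presheaf :=
  separated_of_antisymm fun φ ψ h₁ h₂ => by
    rw [presheaf_str₀] at h₁ h₂
    exact Exp.ext (eq_of_one_le_iInf_hom h₁ h₂)

theorem hat_mul_fn_le (X : 𝕋.TCat) (ψ : X.presheaf.carrier) (𝔵 𝔶 : 𝕋.F X.carrier) :
    𝕋.hat X.str 𝔵 𝔶 * ψ.fn 𝔶 ≤ ψ.fn 𝔵 := by
  rw [mul_comm]
  exact VExp.mul_c_le X.opFree_induces ψ 𝔶 𝔵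

theorem xi_fn_le (X : 𝕋.TCat) (ψ : X.presheaf.carrier) (𝔛 : 𝕋.F (𝕋.F X.carrier)) :
    𝕋.xi ψ.fn 𝔛 ≤ ψ.fn (𝕋.m 𝔛) :=
  VExp.xi_le X.opFree_induces ψ 𝔛

theorem mu_opFree (X : 𝕋.TCat) (𝔭 : 𝕋.F X.presheaf.carrier) (𝔵 : 𝕋.F X.carrier) :
    𝕋.mu X.opFree.toTCat.str 𝔭 𝔵 =
      ⨆ 𝔛, 𝕋.ext (fun (φ : X.presheaf.carrier) 𝔵 => φ.fn 𝔵) 𝔭 𝔛 * 𝕋.hat X.str 𝔵 (𝕋.m 𝔛) :=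
  iSup_congr fun 𝔛 => congrArg (_ * ·) (X.opFree_induces 𝔛 𝔵)

theorem str_isPresheaf (X : 𝕋.TCat) (x : X.carrier) :
    𝕋.IsTFunctor (𝕋.tensorStr 𝕋.gStr X.opFree.toTCat.str) 𝕋.homStr
      (fun p : PUnit.{u + 1} × 𝕋.F X.carrier => X.str p.2 x) :=
  isPresheaf_of_vAlg (φ := fun 𝔵 => X.str 𝔵 x) X.opFree_induces
    (fun 𝔵 𝔶 => by rw [mul_comm]; exact X.hat_mul_le 𝔶 𝔵 x)
    (fun 𝔛 => by
      change _ ≤ X.str (𝕋.m 𝔛) x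
      rw [← 𝕋.ext_e_left (fun x 𝔵 => X.str 𝔵 x) x 𝔛, ext_swap, ← X.hat_e]
      exact 𝕋.le_hat _ _ _)

/-- The underlying map of the Yoneda functor `y : X → P X`, `y x = a(-, x)`. -/
noncomputable abbrev y (X : 𝕋.TCat) (x : X.carrier) : X.presheaf.carrier :=
  ⟨fun 𝔵 => X.str 𝔵 x, X.str_isPresheaf x⟩

theorem mu_y (X : 𝕋.TCat) (𝔵 𝔶 : 𝕋.F X.carrier) :
    𝕋.mu X.opFree.toTCat.str (𝕋.map X.y 𝔵) 𝔶 = 𝕋.hat X.str 𝔶 𝔵 := by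
  rw [mu_opFree]
  have h : ∀ 𝔛, 𝕋.ext (fun (φ : X.presheaf.carrier) 𝔵 => φ.fn 𝔵) (𝕋.map X.y 𝔵) 𝔛 =
      𝕋.ext X.str 𝔛 𝔵 := fun 𝔛 => by
    rw [ext_map_left]
    exact 𝕋.ext_swap X.str 𝔛 𝔵
  apply le_antisymm
  · refine iSup_le fun 𝔛 => ?_
    rw [h, mul_comm]
    exact (mul_le_mul_right (𝕋.le_hat _ _ _) _).trans (X.hat_trans _ _ _)
  · refine iSup₂_le fun 𝔛 h' => le_iSup_of_le 𝔛 ?_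
    subst h'
    rw [h]
    exact mul_one_le (X.one_le_hat _) le_rfl le_rfl

/-- The Yoneda functor `y : X → P X`. -/
noncomputable abbrev yP (X : 𝕋.TCat) : X ⟶ X.presheaf where
  toFun := X.y
  isTFunctor 𝔵 x := by
    rw [presheaf_str]
    refine le_iInf fun 𝔶 => le_hom_iff.2 ?_
    rw [mu_y, mul_comm]
    exact X.hat_mul_le 𝔶 𝔵 x

theorem str_y (X : 𝕋.TCat) (𝔵 : 𝕋.F X.carrier) (ψ : X.presheaf.carrier) :
    X.presheaf.str (𝕋.map X.y 𝔵) ψ = ψ.fn 𝔵 := by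
  rw [presheaf_str]
  apply le_antisymm
  · refine (iInf_le _ 𝔵).trans ?_
    rw [mu_y]
    exact mul_one_le (X.one_le_hat 𝔵) (hom_mul_le _ _) le_rfl
  · refine le_iInf fun 𝔶 => le_hom_iff.2 ?_
    rw [mu_y, mul_comm]
    exact X.hat_mul_fn_le ψ 𝔶 𝔵

theorem hat_y (X : 𝕋.TCat) (𝔵 : 𝕋.F X.carrier) (𝔭 : 𝕋.F X.presheaf.carrier) :
    𝕋.hat X.presheaf.str (𝕋.map X.y 𝔵) 𝔭 =
      𝕋.hat (fun 𝔵 (φ : X.presheaf.carrier) => φ.fn 𝔵) 𝔵 𝔭 := by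
  rw [hat_map_left]
  exact congrArg (fun r => 𝕋.hat r 𝔵 𝔭) (funext fun 𝔵 => funext fun φ => X.str_y 𝔵 φ)

/-- The map `ψ ↦ ψ ∘ f^⊛`, where `f^⊛` is the `T`-relation `(𝔶, x) ↦ b(𝔶, f x)`; here `ψ` is
considered as a `T`-relation from `X` to the one-point set. -/
noncomputable def pMapFn {X Y : 𝕋.TCat} (f : X ⟶ Y) (ψ : X.presheaf.carrier)
    (𝔶 : 𝕋.F Y.carrier) : V :=
  𝕋.kleisli (fun 𝔵 (_ : PUnit.{u + 1}) => ψ.fn 𝔵) (fun 𝔶 x => Y.str 𝔶 (f.toFun x)) 𝔶 PUnit.unit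

theorem pMapFn_eq {X Y : 𝕋.TCat} (f : X ⟶ Y) (ψ : X.presheaf.carrier) (𝔶 : 𝕋.F Y.carrier) :
    pMapFn f ψ 𝔶 = ⨆ 𝔵, ψ.fn 𝔵 * 𝕋.hat Y.str 𝔶 (𝕋.map f.toFun 𝔵) :=
  iSup_congr fun 𝔵 => by rw [hat_map_right, mul_comm]

theorem ext_hat_map_le {X Y : 𝕋.TCat} (f : X ⟶ Y) (𝔛 : 𝕋.F (𝕋.F X.carrier))
    (𝔜 : 𝕋.F (𝕋.F Y.carrier)) :
    𝕋.ext (fun 𝔵 𝔶 => 𝕋.hat Y.str 𝔶 (𝕋.map f.toFun 𝔵)) 𝔛 𝔜 ≤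
      𝕋.hat Y.str (𝕋.m 𝔜) (𝕋.map f.toFun (𝕋.m 𝔛)) := by
  rw [𝕋.ext_swap (fun 𝔶 𝔵 => 𝕋.hat Y.str 𝔶 (𝕋.map f.toFun 𝔵)), ← 𝕋.ext_map_right, map_m]
  exact Y.ext_hat_le _ _

theorem pMapFn_isPresheaf {X Y : 𝕋.TCat} (f : X ⟶ Y) (ψ : X.presheaf.carrier) :
    𝕋.IsTFunctor (𝕋.tensorStr 𝕋.gStr Y.opFree.toTCat.str) 𝕋.homStr
      (fun p : PUnit.{u + 1} × 𝕋.F Y.carrier => pMapFn f ψ p.2) := by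
  have h : pMapFn f ψ = fun 𝔶 => ⨆ 𝔵, ψ.fn 𝔵 * 𝕋.hat Y.str 𝔶 (𝕋.map f.toFun 𝔵) :=
    funext (pMapFn_eq f ψ)
  rw [h]
  refine isPresheaf_of_vAlg (φ := fun 𝔶 => ⨆ 𝔵, ψ.fn 𝔵 * 𝕋.hat Y.str 𝔶 (𝕋.map f.toFun 𝔵))
    Y.opFree_induces (fun 𝔶 𝔶' => ?_) (fun 𝔜 => ?_)
  · refine iSup_mul_le fun 𝔵 => le_iSup_of_le 𝔵 ?_
    rw [mul_assoc, mul_comm (𝕋.hat Y.str _ _)]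
    exact mul_le_mul_right (Y.hat_trans _ _ _) _
  · rw [xi_iSup]
    exact iSup_le fun 𝔛 => le_iSup_of_le (𝕋.m 𝔛)
      (mul_le_mul' (X.xi_fn_le ψ 𝔛) (ext_hat_map_le f 𝔛 𝔜))

/-- The underlying map of `P f`. -/
noncomputable abbrev pMapObj {X Y : 𝕋.TCat} (f : X ⟶ Y) (ψ : X.presheaf.carrier) :
    Y.presheaf.carrier :=
  ⟨pMapFn f ψ, pMapFn_isPresheaf f ψ⟩

theorem mu_pMapObj {X Y : 𝕋.TCat} (f : X ⟶ Y) (𝔭 : 𝕋.F X.presheaf.carrier)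
    (𝔶 : 𝕋.F Y.carrier) :
    𝕋.mu Y.opFree.toTCat.str (𝕋.map (pMapObj f) 𝔭) 𝔶 ≤ pMapFn f (X.opFree.expVAlg.α 𝔭) 𝔶 := by
  rw [mu_opFree, pMapFn_eq]
  refine iSup_le fun 𝔜 => ?_
  rw [ext_map_left]
  have h : 𝕋.ext (fun (ψ : X.presheaf.carrier) 𝔶 => pMapFn f ψ 𝔶) 𝔭 𝔜 =
      ⨆ 𝔛, 𝕋.ext (fun (φ : X.presheaf.carrier) 𝔵 => φ.fn 𝔵) 𝔭 𝔛 *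
        𝕋.ext (fun 𝔵 𝔶 => 𝕋.hat Y.str 𝔶 (𝕋.map f.toFun 𝔵)) 𝔛 𝔜 := by
    rw [← ext_comp]
    exact congrArg (fun r => 𝕋.ext r 𝔭 𝔜) (funext fun ψ => funext fun 𝔶 => pMapFn_eq f ψ 𝔶)
  refine (mul_le_mul_left h.le _).trans (iSup_mul_le fun 𝔛 => ?_)
  refine le_iSup_of_le (𝕋.m 𝔛) ?_
  rw [mul_assoc]
  refine mul_le_mul' ?_ ?_
  · refine le_trans ?_ (X.mu_opFree 𝔭 (𝕋.m 𝔛)).ge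
    exact le_iSup_of_le 𝔛 (mul_one_le (X.one_le_hat _) le_rfl le_rfl)
  · rw [mul_comm]
    exact (mul_le_mul_right (ext_hat_map_le f 𝔛 𝔜) _).trans (Y.hat_trans _ _ _)

/-- The `T`-functor `P f`. -/
noncomputable abbrev pMap {X Y : 𝕋.TCat} (f : X ⟶ Y) : X.presheaf ⟶ Y.presheaf where
  toFun := pMapObj f
  isTFunctor := isTFunctor_of_vAlg X.presheaf_induces Y.presheaf_induces
    (fun φ ψ => le_iInf fun 𝔶 => le_hom_iff.2 (by
      change (⨅ 𝔵, φ.fn 𝔵 ⇨ₗ ψ.fn 𝔵) * pMapFn f φ 𝔶 ≤ pMapFn f ψ 𝔶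
      rw [pMapFn_eq, pMapFn_eq]
      refine mul_iSup_le fun 𝔵 => le_iSup_of_le 𝔵 ?_
      rw [← mul_assoc]
      have h : (⨅ 𝔵, φ.fn 𝔵 ⇨ₗ ψ.fn 𝔵) * φ.fn 𝔵 ≤ ψ.fn 𝔵 := le_hom_iff.1 (iInf_le _ 𝔵)
      exact mul_le_mul_left h _))
    (fun 𝔭 => one_le_iInf_hom fun 𝔶 => mu_pMapObj f 𝔭 𝔶)

/-- The map `Ψ ↦ Ψ ∘ y_⊛`, where `y_⊛` is the `T`-relation `(𝔵, φ) ↦ (P X)(T y 𝔵, φ)`. -/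
noncomputable def pMultFn (X : 𝕋.TCat) (Ψ : X.presheaf.presheaf.carrier) (𝔵 : 𝕋.F X.carrier) : V :=
  𝕋.kleisli (fun 𝔭 (_ : PUnit.{u + 1}) => Ψ.fn 𝔭) (fun 𝔵 φ => X.presheaf.str (𝕋.map X.y 𝔵) φ) 𝔵
    PUnit.unit

theorem pMultFn_eq (X : 𝕋.TCat) (Ψ : X.presheaf.presheaf.carrier) (𝔵 : 𝕋.F X.carrier) :
    X.pMultFn Ψ 𝔵 = Ψ.fn (𝕋.map X.y 𝔵) := by
  apply le_antisymm
  · refine iSup_le fun 𝔭 => ?_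
    rw [← hat_map_left]
    exact X.presheaf.hat_mul_fn_le Ψ _ _
  · refine le_iSup_of_le (𝕋.map X.y 𝔵) ?_
    rw [← hat_map_left]
    exact one_mul_le (X.presheaf.one_le_hat _) le_rfl le_rfl

theorem pMultFn_isPresheaf (X : 𝕋.TCat) (Ψ : X.presheaf.presheaf.carrier) :
    𝕋.IsTFunctor (𝕋.tensorStr 𝕋.gStr X.opFree.toTCat.str) 𝕋.homStr
      (fun p : PUnit.{u + 1} × 𝕋.F X.carrier => X.pMultFn Ψ p.2) := by
  have h : X.pMultFn Ψ = fun 𝔵 => Ψ.fn (𝕋.map X.y 𝔵) := funext (X.pMultFn_eq Ψ)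
  rw [h]
  refine isPresheaf_of_vAlg (φ := fun 𝔵 => Ψ.fn (𝕋.map X.y 𝔵)) X.opFree_induces
    (fun 𝔵 𝔶 => ?_) (fun 𝔛 => ?_)
  · rw [mul_comm]
    exact (mul_le_mul_left (hat_map_le X.yP 𝔶 𝔵) _).trans (X.presheaf.hat_mul_fn_le Ψ _ _)
  · rw [← 𝕋.xi_map (𝕋.map X.y) Ψ.fn]
    refine (X.presheaf.xi_fn_le Ψ _).trans_eq ?_
    rw [← map_m]

/-- The underlying map of the multiplication of `P`. -/
noncomputable abbrev pMultObj (X : 𝕋.TCat) (Ψ : X.presheaf.presheaf.carrier) :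
    X.presheaf.carrier :=
  ⟨X.pMultFn Ψ, X.pMultFn_isPresheaf Ψ⟩

theorem mu_pMultObj (X : 𝕋.TCat) (𝔓 : 𝕋.F X.presheaf.presheaf.carrier) (𝔵 : 𝕋.F X.carrier) :
    𝕋.mu X.opFree.toTCat.str (𝕋.map X.pMultObj 𝔓) 𝔵 ≤
      𝕋.mu X.presheaf.opFree.toTCat.str 𝔓 (𝕋.map X.y 𝔵) := by
  rw [mu_opFree, mu_opFree]
  refine iSup_le fun 𝔛 => le_iSup_of_le (𝕋.map (𝕋.map X.y) 𝔛) ?_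
  rw [ext_map_left, ext_map_right, ← map_m]
  refine mul_le_mul' (𝕋.ext_mono (fun Ψ 𝔵 => (X.pMultFn_eq Ψ 𝔵).le) _ _) ?_
  exact hat_map_le X.yP _ _

/-- The multiplication of the monad `P`. -/
noncomputable abbrev pMult (X : 𝕋.TCat) : X.presheaf.presheaf ⟶ X.presheaf where
  toFun := X.pMultObj
  isTFunctor := isTFunctor_of_vAlg X.presheaf.presheaf_induces X.presheaf_induces
    (fun Φ Ψ => le_iInf fun 𝔵 => by
      change _ ≤ X.pMultFn Φ 𝔵 ⇨ₗ X.pMultFn Ψ 𝔵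
      rw [pMultFn_eq, pMultFn_eq]
      exact iInf_le _ _)
    (fun 𝔓 => one_le_iInf_hom fun 𝔵 =>
      (X.mu_pMultObj 𝔓 𝔵).trans (X.pMultFn_eq (X.presheaf.opFree.expVAlg.α 𝔓) 𝔵).ge)

theorem hom_ext {X Y : 𝕋.TCat} {f g : X ⟶ Y} (h : ∀ x, f.toFun x = g.toFun x) : f = g :=
  TFunctor.ext (funext h)

theorem pMap_id (X : 𝕋.TCat) : pMap (𝟙 X) = 𝟙 X.presheaf :=
  hom_ext fun ψ => Exp.ext (funext fun 𝔶 => by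
    refine (pMapFn_eq (𝟙 X) ψ 𝔶).trans ?_
    have h : ∀ 𝔵, 𝕋.map (TFunctor.toFun (𝟙 X)) 𝔵 = 𝔵 := 𝕋.map_id'
    simp only [h]
    apply le_antisymm
    · refine iSup_le fun 𝔵 => ?_
      rw [mul_comm]
      exact X.hat_mul_fn_le ψ 𝔶 𝔵
    · exact le_iSup_of_le 𝔶 (mul_one_le (X.one_le_hat 𝔶) le_rfl le_rfl))

theorem pMap_comp {X Y Z : 𝕋.TCat} (f : X ⟶ Y) (g : Y ⟶ Z) :
    pMap (f ≫ g) = pMap f ≫ pMap g :=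
  hom_ext fun ψ => Exp.ext (funext fun 𝔷 => by
    refine (pMapFn_eq (f ≫ g) ψ 𝔷).trans (Eq.trans ?_ (pMapFn_eq g (pMapObj f ψ) 𝔷).symm)
    have h : ∀ 𝔵, 𝕋.map (TFunctor.toFun (f ≫ g)) 𝔵 = 𝕋.map g.toFun (𝕋.map f.toFun 𝔵) :=
      fun 𝔵 => (𝕋.map_map f.toFun g.toFun 𝔵).symm
    simp only [h, pMapFn_eq]
    apply le_antisymm
    · refine iSup_le fun 𝔵 => le_iSup_of_le (𝕋.map f.toFun 𝔵) (mul_le_mul_left ?_ _)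
      exact le_iSup_of_le 𝔵 (mul_one_le (Y.one_le_hat _) le_rfl le_rfl)
    · refine iSup_le fun 𝔶 => iSup_mul_le fun 𝔵 => le_iSup_of_le 𝔵 ?_
      rw [mul_assoc, mul_comm (𝕋.hat Y.str _ _)]
      exact mul_le_mul_right ((mul_le_mul_right (hat_map_le g _ _) _).trans (Z.hat_trans _ _ _)) _)

theorem y_toFun_eq {X Y : 𝕋.TCat} (f : X ⟶ Y) (x : X.carrier) :
    Y.y (f.toFun x) = pMapObj f (X.y x) :=
  Exp.ext (funext fun 𝔶 => by
    refine Eq.trans ?_ (pMapFn_eq f (X.y x) 𝔶).symm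
    apply le_antisymm
    · refine le_iSup_of_le (𝕋.e x) ?_
      rw [map_e, hat_e]
      exact one_mul_le (X.refl x) le_rfl le_rfl
    · refine iSup_le fun 𝔵 => ?_
      rw [mul_comm]
      exact (mul_le_mul_right (f.isTFunctor 𝔵 x) _).trans (Y.hat_mul_le _ _ _))

theorem yP_naturality {X Y : 𝕋.TCat} (f : X ⟶ Y) : f ≫ Y.yP = X.yP ≫ pMap f :=
  hom_ext (y_toFun_eq f)

theorem hat_y_pMapObj {X Y : 𝕋.TCat} (f : X ⟶ Y) (𝔶 : 𝕋.F Y.carrier)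
    (𝔭 : 𝕋.F X.presheaf.carrier) (Ψ : X.presheaf.presheaf.carrier) :
    Ψ.fn 𝔭 * 𝕋.hat Y.presheaf.str (𝕋.map Y.y 𝔶) (𝕋.map (pMapObj f) 𝔭) ≤
      ⨆ 𝔵, Ψ.fn (𝕋.map X.y 𝔵) * 𝕋.hat Y.str 𝔶 (𝕋.map f.toFun 𝔵) := by
  rw [hat_y, hat_map_right]
  refine mul_iSup_le fun 𝔜 => mul_iSup_le fun h𝔜 => ?_
  subst h𝔜
  have h : 𝕋.ext (fun 𝔶 (φ : X.presheaf.carrier) => pMapFn f φ 𝔶) 𝔜 𝔭 =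
      ⨆ 𝔛, 𝕋.ext (fun 𝔶 𝔵 => 𝕋.hat Y.str 𝔶 (𝕋.map f.toFun 𝔵)) 𝔜 𝔛 *
        𝕋.ext (fun 𝔵 (φ : X.presheaf.carrier) => φ.fn 𝔵) 𝔛 𝔭 := by
    rw [← ext_comp]
    refine congrArg (fun r => 𝕋.ext r 𝔜 𝔭) (funext fun 𝔶 => funext fun φ => ?_)
    rw [pMapFn_eq]
    exact iSup_congr fun 𝔵 => mul_comm _ _
  refine (mul_le_mul_right h.le _).trans (mul_iSup_le fun 𝔛 => le_iSup_of_le (𝕋.m 𝔛) ?_)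
  rw [mul_comm (𝕋.ext _ 𝔜 𝔛), ← mul_assoc]
  refine mul_le_mul' ?_ ?_
  · rw [mul_comm]
    refine (mul_le_mul_left (𝕋.le_hat _ 𝔛 𝔭) _).trans ?_
    rw [← hat_y]
    exact X.presheaf.hat_mul_fn_le Ψ _ _
  · rw [ext_swap (r := fun 𝔵 𝔶 => 𝕋.hat Y.str 𝔶 (𝕋.map f.toFun 𝔵))]
    exact ext_hat_map_le f 𝔛 𝔜

theorem pMult_naturality {X Y : 𝕋.TCat} (f : X ⟶ Y) :
    pMap (pMap f) ≫ Y.pMult = X.pMult ≫ pMap f :=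
  hom_ext fun Ψ => Exp.ext (funext fun 𝔶 => by
    refine (Y.pMultFn_eq _ 𝔶).trans ((pMapFn_eq (pMap f) Ψ (𝕋.map Y.y 𝔶)).trans (Eq.trans ?_
      (pMapFn_eq f (X.pMultObj Ψ) 𝔶).symm))
    simp only [pMultFn_eq]
    apply le_antisymm
    · exact iSup_le fun 𝔭 => hat_y_pMapObj f 𝔶 𝔭 Ψ
    · refine iSup_le fun 𝔵 => le_iSup_of_le (𝕋.map X.y 𝔵) (mul_le_mul_right ?_ _)
      refine (hat_map_le Y.yP _ _).trans_eq ?_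
      rw [map_map, map_map]
      exact congrArg (fun g => 𝕋.hat Y.presheaf.str _ (𝕋.map g 𝔵)) (funext (y_toFun_eq f)))

theorem yP_pMult (X : 𝕋.TCat) : X.presheaf.yP ≫ X.pMult = 𝟙 X.presheaf :=
  hom_ext fun φ => Exp.ext (funext fun 𝔵 =>
    (X.pMultFn_eq _ 𝔵).trans (X.str_y 𝔵 φ))

theorem pMap_yP_pMult (X : 𝕋.TCat) : pMap X.yP ≫ X.pMult = 𝟙 X.presheaf :=
  hom_ext fun φ => Exp.ext (funext fun 𝔶 => by
    refine (X.pMultFn_eq _ 𝔶).trans ((pMapFn_eq X.yP φ (𝕋.map X.y 𝔶)).trans ?_)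
    have h : ∀ 𝔵, 𝕋.hat X.presheaf.str (𝕋.map X.y 𝔶) (𝕋.map X.y 𝔵) = 𝕋.hat X.str 𝔶 𝔵 :=
      fun 𝔵 => by rw [hat_y, hat_map_right]
    refine (iSup_congr fun 𝔵 => congrArg (φ.fn 𝔵 * ·) (h 𝔵)).trans ?_
    apply le_antisymm
    · refine iSup_le fun 𝔵 => ?_
      rw [mul_comm]
      exact X.hat_mul_fn_le φ 𝔶 𝔵
    · exact le_iSup_of_le 𝔶 (mul_one_le (X.one_le_hat 𝔶) le_rfl le_rfl))

theorem pMult_assoc (X : 𝕋.TCat) : pMap X.pMult ≫ X.pMult = X.presheaf.pMult ≫ X.pMult :=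
  hom_ext fun Θ => Exp.ext (funext fun 𝔵 => by
    refine (X.pMultFn_eq _ 𝔵).trans ((pMapFn_eq X.pMult Θ (𝕋.map X.y 𝔵)).trans (Eq.trans ?_
      (X.pMultFn_eq (X.presheaf.pMultObj Θ) 𝔵).symm))
    refine Eq.trans ?_ (X.presheaf.pMultFn_eq Θ (𝕋.map X.y 𝔵)).symm
    have h : ∀ 𝔮, 𝕋.hat X.presheaf.str (𝕋.map X.y 𝔵) (𝕋.map X.pMultObj 𝔮) =
        𝕋.hat X.presheaf.presheaf.str (𝕋.map X.presheaf.y (𝕋.map X.y 𝔵)) 𝔮 := fun 𝔮 => by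
      rw [hat_y, hat_y, hat_map_right, hat_map_left]
      exact congrArg (fun r => 𝕋.hat r 𝔵 𝔮) (funext fun 𝔵 => funext fun Ψ => X.pMultFn_eq Ψ 𝔵)
    refine (iSup_congr fun 𝔮 => congrArg (Θ.fn 𝔮 * ·) (h 𝔮)).trans ?_
    apply le_antisymm
    · refine iSup_le fun 𝔮 => ?_
      rw [mul_comm]
      exact X.presheaf.presheaf.hat_mul_fn_le Θ _ 𝔮
    · exact le_iSup_of_le _ (mul_one_le (X.presheaf.presheaf.one_le_hat _) le_rfl le_rfl))

end TCat

end presheaf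

/-! ### The monads `P` and `V` on separated objects -/

section monads

variable [Subsingleton (𝕋.F PUnit.{u + 1})]

/-- The category of separated `T`-categories and `T`-functors. -/
abbrev SepTCat : Type (u + 1) := (Separated (𝕋 := 𝕋)).FullSubcategory

/-- Separatedness of representable `T`-categories. -/
abbrev SeparatedRep : ObjectProperty 𝕋.RepCat := fun X => Separated X.toTCat

/-- The category of separated representable `T`-categories and pseudo-homomorphisms. -/
abbrev SepRepCat : Type (u + 1) := 𝕋.SeparatedRep.FullSubcategory

/-- The presheaf monad on separated `T`-categories. -/
noncomputable def presheafMonad : Monad 𝕋.SepTCat where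
  obj X := ⟨X.obj.presheaf, X.obj.presheaf_separated⟩
  map f := ObjectProperty.homMk (TCat.pMap f.hom)
  map_id X := ObjectProperty.hom_ext _ (TCat.pMap_id X.obj)
  map_comp f g := ObjectProperty.hom_ext _ (TCat.pMap_comp f.hom g.hom)
  η :=
    { app := fun X => ObjectProperty.homMk X.obj.yP
      naturality := fun _ _ f => ObjectProperty.hom_ext _ (TCat.yP_naturality f.hom) }
  μ :=
    { app := fun X => ObjectProperty.homMk X.obj.pMult
      naturality := fun _ _ f => ObjectProperty.hom_ext _ (TCat.pMult_naturality f.hom) }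
  assoc X := ObjectProperty.hom_ext _ X.obj.pMult_assoc
  left_unit X := ObjectProperty.hom_ext _ X.obj.yP_pMult
  right_unit X := ObjectProperty.hom_ext _ X.obj.pMap_yP_pMult

/-- The enriched Vietoris monad on separated representable `T`-categories. -/
noncomputable def vietorisMonad : Monad 𝕋.SepRepCat where
  obj X := ⟨X.obj.vietoris, X.obj.vietoris_separated⟩
  map f := ObjectProperty.homMk (RepCat.vMap f.hom)
  map_id X := ObjectProperty.hom_ext _ (RepCat.vMap_id X.obj)
  map_comp f g := ObjectProperty.hom_ext _ (RepCat.vMap_comp f.hom g.hom)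
  η :=
    { app := fun X => ObjectProperty.homMk X.obj.yV
      naturality := fun _ _ f => ObjectProperty.hom_ext _ (RepCat.yV_naturality f.hom) }
  μ :=
    { app := fun X => ObjectProperty.homMk X.obj.vMult
      naturality := fun _ _ f => ObjectProperty.hom_ext _ (RepCat.vMult_naturality f.hom) }
  assoc X := ObjectProperty.hom_ext _ X.obj.vMult_assoc
  left_unit X := ObjectProperty.hom_ext _ X.obj.yV_vMult
  right_unit X := ObjectProperty.hom_ext _ X.obj.vMap_yV_vMult

/-- The forgetful functor from the Eilenberg-Moore category of `P` to sets. -/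
noncomputable def presheafMonadForget : 𝕋.presheafMonad.Algebra ⥤ Type u :=
  𝕋.presheafMonad.forget ⋙ (Separated (𝕋 := 𝕋)).ι ⋙ TCat.forget

/-- The forgetful functor from the Eilenberg-Moore category of `V` to sets. -/
noncomputable def vietorisMonadForget : 𝕋.vietorisMonad.Algebra ⥤ Type u :=
  𝕋.vietorisMonad.forget ⋙ 𝕋.SeparatedRep.ι ⋙ RepCat.forget ⋙ TCat.forget

end monads

/-! ### Weighted colimits and limits -/

section limits

variable {𝕋}

/-- A `T`-relation `φ` between `T`-categories is a `T`-distributor if `φ ∘ a ≤ φ` and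
`b ∘ φ ≤ φ`. -/
def IsDistributor (X Y : 𝕋.TCat) (φ : 𝕋.F X.carrier → Y.carrier → V) : Prop :=
  (∀ 𝔵 y, 𝕋.kleisli φ X.str 𝔵 y ≤ φ 𝔵 y) ∧ ∀ 𝔵 y, 𝕋.kleisli Y.str φ 𝔵 y ≤ φ 𝔵 y

/-- `g` is a colimit of the diagram `d : D → X` with weight `φ` from `D` to `A`: the `T`-relation
`g_⊛` is the extension of `d_⊛` along `φ`. -/
def IsColimit {D A X : 𝕋.TCat} (d : 𝕋.TFunctor D X) (φ : 𝕋.F D.carrier → A.carrier → V)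
    (g : 𝕋.TFunctor A X) : Prop :=
  ∀ 𝔞 x, X.str (𝕋.map g.toFun 𝔞) x =
    𝕋.extension (fun 𝔡 x => X.str (𝕋.map d.toFun 𝔡) x) φ 𝔞 x

/-- A `T`-functor preserves weighted colimits (the weights being arbitrary `T`-distributors). -/
def IsCocontinuous {X Y : 𝕋.TCat} (f : 𝕋.TFunctor X Y) : Prop :=
  ∀ (D A : 𝕋.TCat) (d : 𝕋.TFunctor D X) (φ : 𝕋.F D.carrier → A.carrier → V)
    (g : 𝕋.TFunctor A X), IsDistributor D A φ → IsColimit d φ g →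
      IsColimit (d.comp f) φ (g.comp f)

theorem isCocontinuous_id (X : 𝕋.TCat) : IsCocontinuous (TFunctor.id X) :=
  fun _ _ _ _ _ _ h => h

theorem IsCocontinuous.comp {X Y Z : 𝕋.TCat} {f : 𝕋.TFunctor X Y} {g : 𝕋.TFunctor Y Z}
    (hf : IsCocontinuous f) (hg : IsCocontinuous g) : IsCocontinuous (f.comp g) :=
  fun D A d φ k hφ hk => hg D A (d.comp f) φ (k.comp f) hφ (hf D A d φ k hφ hk)

/-- `x₀` is a limit of the diagram `h : A → X` with weight `φ` from `G` to `A`: the `T`-relation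
`x₀^⊛` is the lifting of `h^⊛` along `φ`. -/
def IsLimit {A X : 𝕋.TCat} (h : 𝕋.TFunctor A X) (φ : 𝕋.F PUnit.{u + 1} → A.carrier → V)
    (x₀ : X.carrier) : Prop :=
  ∀ 𝔵, X.str 𝔵 x₀ = 𝕋.lifting φ (fun 𝔵 z => X.str 𝔵 (h.toFun z)) 𝔵

variable [Subsingleton (𝕋.F PUnit.{u + 1})]

variable (𝕋) in
/-- The `T`-category `G = (1, e°)`. -/
def G : 𝕋.TCat where
  carrier := PUnit.{u + 1}
  str := 𝕋.gStr
  refl x := le_iSup_of_le rfl le_rfl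
  trans 𝔛 𝔵 x := by
    have h₁ : ∀ t p, 𝕋.gStr t p ≤ 1 := fun t p => iSup_le fun _ => le_rfl
    have h₂ : 1 ≤ 𝕋.gStr (𝕋.m 𝔛) x := le_iSup_of_le (Subsingleton.elim _ _) le_rfl
    refine le_trans ?_ h₂
    have h₃ : 𝕋.ext 𝕋.gStr 𝔛 𝔵 ≤ 1 :=
      𝕋.ext_le fun w _ _ => (𝕋.xi_mono (fun p => h₁ p.1 p.2) w).trans (𝕋.xi_one w).le
    exact (mul_le_mul' h₃ (h₁ 𝔵 x)).trans (one_mul 1).le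

/-- A `T`-functor preserves weighted limits. -/
def IsContinuous {X Y : 𝕋.TCat} (f : 𝕋.TFunctor X Y) : Prop :=
  ∀ (A : 𝕋.TCat) (h : 𝕋.TFunctor A X) (φ : 𝕋.F PUnit.{u + 1} → A.carrier → V)
    (x₀ : X.carrier), IsDistributor 𝕋.G A φ → IsLimit h φ x₀ → IsLimit (h.comp f) φ (f.toFun x₀)

theorem isContinuous_id (X : 𝕋.TCat) : IsContinuous (TFunctor.id X) :=
  fun _ _ _ _ _ h => h

theorem IsContinuous.comp {X Y Z : 𝕋.TCat} {f : 𝕋.TFunctor X Y} {g : 𝕋.TFunctor Y Z}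
    (hf : IsContinuous f) (hg : IsContinuous g) : IsContinuous (f.comp g) :=
  fun A h φ x₀ hφ hx => hg A (h.comp f) φ (f.toFun x₀) hφ (hf A h φ x₀ hφ hx)

/-! ### Total cocompleteness and total completeness -/

/-- A `T`-category `X` is totally cocomplete if the Yoneda functor `X → P X` has a left adjoint
(in `T`-categories). -/
def TotallyCocomplete (X : 𝕋.TCat) : Prop :=
  ∃ S : X.presheaf ⟶ X, 𝕋.IsAdjoint S X.yP

/-- A representable `T`-category `X` is totally complete if the Yoneda functor `X → V X` has a
right adjoint in representable `T`-categories and pseudo-homomorphisms. -/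
def TotallyComplete (X : 𝕋.RepCat) : Prop :=
  ∃ I : X.vietoris ⟶ X, 𝕋.IsAdjoint X.yV.toTFunctor I.toTFunctor

variable (𝕋) in
/-- A totally cocomplete `T`-category. -/
structure Cocts where
  /-- the underlying `T`-category -/
  toTCat : 𝕋.TCat
  totallyCocomplete : TotallyCocomplete toTCat

variable (𝕋) in
/-- A totally complete representable `T`-category. -/
structure Cts where
  /-- the underlying representable `T`-category -/
  toRepCat : 𝕋.RepCat
  totallyComplete : TotallyComplete toRepCat

/-- A weighted colimit preserving `T`-functor. -/
@[ext]
structure CoctsHom (X Y : 𝕋.Cocts) extends 𝕋.TFunctor X.toTCat Y.toTCat where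
  isCocontinuous : IsCocontinuous toTFunctor

/-- A weighted limit preserving pseudo-homomorphism. -/
@[ext]
structure CtsHom (X Y : 𝕋.Cts) extends PseudoHom X.toRepCat Y.toRepCat where
  isContinuous : IsContinuous toTFunctor

instance : Category 𝕋.Cocts where
  Hom X Y := CoctsHom X Y
  id X := ⟨TFunctor.id X.toTCat, isCocontinuous_id _⟩
  comp f g := ⟨f.toTFunctor.comp g.toTFunctor, f.isCocontinuous.comp g.isCocontinuous⟩

instance : Category 𝕋.Cts where
  Hom X Y := CtsHom X Y
  id X := ⟨⟨TFunctor.id X.toRepCat.toTCat, isPseudoHom_id _⟩, isContinuous_id _⟩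
  comp f g := ⟨⟨f.toTFunctor.comp g.toTFunctor, isPseudoHom_comp _ _ f.isPseudoHom g.isPseudoHom⟩,
    f.isContinuous.comp g.isContinuous⟩

variable (𝕋) in
/-- The forgetful functor from totally cocomplete `T`-categories to sets. -/
def Cocts.forget : 𝕋.Cocts ⥤ Type u where
  obj X := X.toTCat.carrier
  map f := ↾(f : CoctsHom _ _).toFun

variable (𝕋) in
/-- The forgetful functor from totally complete representable `T`-categories to sets. -/
def Cts.forget : 𝕋.Cts ⥤ Type u where
  obj X := X.toRepCat.toTCat.carrier
  map f := ↾(f : CtsHom _ _).toFun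

variable (𝕋) in
/-- The separated totally cocomplete `T`-categories. -/
def Cocts.Sep : ObjectProperty 𝕋.Cocts := fun X => Separated X.toTCat

variable (𝕋) in
/-- The separated totally complete representable `T`-categories. -/
def Cts.Sep : ObjectProperty 𝕋.Cts := fun X => Separated X.toRepCat.toTCat

end limits

end TopologicalTheory

namespace TopologicalTheory

variable {V : Type u} [CommMonoid V] [CompleteLattice V] [IsQuantale V]

section quantale

variable {ι κ : Type u}

theorem iInf_hom_le_iInf_hom {φ h : ι → V} {ψ g : κ → V}
    (H : ∀ v k, (∀ i, v * φ i ≤ h i) → v * ψ k ≤ g k) :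
    (⨅ i, φ i ⇨ₗ h i) ≤ ⨅ k, ψ k ⇨ₗ g k :=
  le_iInf fun k => le_hom_iff.2 (H _ k fun i => le_hom_iff.1 (iInf_le _ i))

/-- Residuation out of a weight which is an image of another weight. -/
theorem iInf_iSup_mul_hom {φ h : ι → V} {r : κ → ι → V} {g : κ → V}
    (h₁ : ∀ k i, r k i * h i ≤ g k) (h₂ : ∀ i, ∃ k, 1 ≤ r k i ∧ g k ≤ h i) :
    (⨅ k, (⨆ i, φ i * r k i) ⇨ₗ g k) = ⨅ i, φ i ⇨ₗ h i := by
  apply le_antisymm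
  · refine iInf_hom_le_iInf_hom fun v i H => ?_
    obtain ⟨k, hk, hk'⟩ := h₂ i
    refine (le_trans ?_ (H k)).trans hk'
    exact mul_le_mul_right (le_iSup_of_le i (mul_one_le hk le_rfl le_rfl)) v
  · refine iInf_hom_le_iInf_hom fun v k H => mul_iSup_le fun i => ?_
    rw [← mul_assoc]
    refine (mul_le_mul_left (H i) _).trans ?_
    rw [mul_comm]
    exact h₁ k i

end quantale

variable {𝕋 : TopologicalTheory V}

theorem TCat.str_le_of_le (X : 𝕋.TCat) {x y : X.carrier} (h : 1 ≤ X.str₀ x y)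
    (𝔵 : 𝕋.F X.carrier) : X.str 𝔵 x ≤ X.str 𝔵 y :=
  mul_one_le h (X.mul_le 𝔵 x y) le_rfl

/-- The `T`-functor from `G` given by a point. -/
abbrev constFunctor [Subsingleton (𝕋.F PUnit.{u + 1})] (X : 𝕋.TCat) (x : X.carrier) :
    𝕋.TFunctor 𝕋.G X where
  toFun _ := x
  isTFunctor t p := iSup_le fun h => by
    subst h
    exact (X.refl x).trans_eq
      (congrArg (fun t => X.str t x) (𝕋.map_e (fun _ : PUnit.{u + 1} => x) p)).symm

theorem Separated.eq [Subsingleton (𝕋.F PUnit.{u + 1})] {X : 𝕋.TCat} (hX : Separated X)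
    {x y : X.carrier} (h₁ : 1 ≤ X.str₀ x y) (h₂ : 1 ≤ X.str₀ y x) : x = y := by
  have h := hX 𝕋.G (constFunctor X x) (constFunctor X y) ⟨fun _ => h₁, fun _ => h₂⟩
  exact congrFun (congrArg TFunctor.toFun h) PUnit.unit

theorem IsAdjoint.str_eq {X Y : 𝕋.TCat} {f : 𝕋.TFunctor X Y} {g : 𝕋.TFunctor Y X}
    (h : 𝕋.IsAdjoint f g) (𝔵 : 𝕋.F X.carrier) (y : Y.carrier) :
    Y.str (𝕋.map f.toFun 𝔵) y = X.str 𝔵 (g.toFun y) := by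
  apply le_antisymm
  · refine (g.isTFunctor _ y).trans ?_
    refine one_mul_le ?_ (X.hat_mul_le 𝔵 _ _) le_rfl
    refine le_trans ?_ (𝕋.ext_e_le_hat X.str _ _)
    rw [map_map, ext_map_right]
    exact 𝕋.one_le_ext (r := fun x x' => X.str (𝕋.e x) (g.toFun (f.toFun x'))) h.1 𝔵
  · exact (f.isTFunctor 𝔵 _).trans (Y.str_le_of_le (h.2 y) _)

theorem IsAdjoint.str₀_eq {X Y : 𝕋.TCat} {f : 𝕋.TFunctor X Y} {g : 𝕋.TFunctor Y X}
    (h : 𝕋.IsAdjoint f g) (x : X.carrier) (y : Y.carrier) :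
    Y.str₀ (f.toFun x) y = X.str₀ x (g.toFun y) := by
  rw [TCat.str₀, ← map_e]
  exact h.str_eq (𝕋.e x) y

/-- A left adjoint between representable `T`-categories is a pseudo-homomorphism. -/
theorem IsAdjoint.isPseudoHom {X Y : 𝕋.TCat} (hY : 𝕋.Representable Y) {A : 𝕋.VAlg X.carrier}
    (hA : A.Induces) {f : 𝕋.TFunctor X Y} {g : 𝕋.TFunctor Y X} (h : 𝕋.IsAdjoint f g) :
    𝕋.IsPseudoHom f := by
  refine (isPseudoHom_iff hY hA f).2 fun 𝔵 y => ?_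
  rw [h.str_eq, h.str₀_eq, hA, hA.str₀_eq]

/-- A map between pseudo-algebras which is a `V`-functor and a homomorphism up to
equivalence. -/
structure VAlg.IsHom {X Y : Type u} (A : 𝕋.VAlg X) (B : 𝕋.VAlg Y) (f : X → Y) : Prop where
  c_le : ∀ x y, A.c x y ≤ B.c (f x) (f y)
  le_map : ∀ 𝔵, 1 ≤ B.c (f (A.α 𝔵)) (B.α (𝕋.map f 𝔵))
  map_le : ∀ 𝔵, 1 ≤ B.c (B.α (𝕋.map f 𝔵)) (f (A.α 𝔵))

theorem VAlg.IsHom.op {X Y : Type u} {A : 𝕋.VAlg X} {B : 𝕋.VAlg Y} {f : X → Y}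
    (h : A.IsHom B f) : A.op.IsHom B.op f :=
  ⟨fun x y => h.c_le y x, h.map_le, h.le_map⟩

theorem VAlg.IsHom.isTFunctor {X Y : 𝕋.TCat} {A : 𝕋.VAlg X.carrier} {B : 𝕋.VAlg Y.carrier}
    (hA : A.Induces) (hB : B.Induces) {f : X.carrier → Y.carrier} (h : A.IsHom B f) :
    𝕋.IsTFunctor X.str Y.str f :=
  isTFunctor_of_vAlg hA hB h.c_le h.map_le

theorem VAlg.IsHom.isPseudoHom {X Y : 𝕋.TCat} {A : 𝕋.VAlg X.carrier} {B : 𝕋.VAlg Y.carrier}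
    (hA : A.Induces) (hB : B.Induces) {f : 𝕋.TFunctor X Y} (h : A.IsHom B f.toFun) :
    𝕋.IsPseudoHom f :=
  isPseudoHom_of_vAlg hA hB f h.le_map

theorem IsPseudoHom.isHom {X Y : 𝕋.TCat} {A : 𝕋.VAlg X.carrier} {B : 𝕋.VAlg Y.carrier}
    (hA : A.Induces) (hB : B.Induces) {f : 𝕋.TFunctor X Y} (h : 𝕋.IsPseudoHom f) :
    A.IsHom B f.toFun := by
  obtain ⟨β, hβ, -⟩ := hB.exists_isAlg
  refine ⟨fun x y => ?_, fun 𝔵 => ?_, fun 𝔵 => ?_⟩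
  · rw [← hA.str₀_eq, ← hB.str₀_eq]
    exact f.str₀_le x y
  · rw [← hB.str₀_eq]
    refine le_trans ?_ ((isPseudoHom_iff ⟨β, hβ⟩ hA f).1 h 𝔵 _)
    rw [hB]
    exact B.refl _
  · rw [← hB]
    refine le_trans ?_ (f.isTFunctor _ _)
    rw [hA]
    exact A.refl _

namespace RepCat

theorem eq_of_str_eq {X : Type u} {a b : 𝕋.F X → X → V} {hr ht h hr' ht' h'} (hab : a = b) :
    RepCat.mk ⟨X, a, hr, ht⟩ h = RepCat.mk (𝕋 := 𝕋) ⟨X, b, hr', ht'⟩ h' := by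
  subst hab
  rfl

theorem op_op (X : 𝕋.RepCat) : X.op.op = X := by
  have h : X.op.op.toTCat.str = X.toTCat.str := funext fun 𝔵 => funext fun x => by
    rw [VAlg.Induces.op_str (X := X.op) X.induces.op,
      VAlg.Induces.str₀_eq (X := X.op.toTCat) X.induces.op, X.induces]
  exact eq_of_str_eq h

theorem op_str₀ (X : 𝕋.RepCat) (x y : X.toTCat.carrier) :
    X.op.toTCat.str₀ x y = X.toTCat.str₀ y x :=
  VAlg.Induces.str₀_eq (X := X.op.toTCat) X.induces.op x y

variable [Subsingleton (𝕋.F PUnit.{u + 1})]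

theorem separated_op {X : 𝕋.RepCat} (h : Separated X.toTCat) : Separated X.op.toTCat :=
  separated_of_antisymm fun x y h₁ h₂ => by
    rw [op_str₀] at h₁ h₂
    exact h.eq h₂ h₁

end RepCat

theorem TCat.le_mu_opFree [Subsingleton (𝕋.F PUnit.{u + 1})] (X : 𝕋.TCat)
    (𝔭 : 𝕋.F X.presheaf.carrier) (𝔛 : 𝕋.F (𝕋.F X.carrier)) :
    𝕋.ext (fun (φ : X.presheaf.carrier) 𝔵 => φ.fn 𝔵) 𝔭 𝔛 ≤
      𝕋.mu X.opFree.toTCat.str 𝔭 (𝕋.m 𝔛) := by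
  rw [X.mu_opFree]
  exact le_iSup_of_le 𝔛 (mul_one_le (X.one_le_hat _) le_rfl le_rfl)

namespace RepCat

theorem hat_le_c (X : 𝕋.RepCat) (𝔵 𝔶 : 𝕋.F X.toTCat.carrier) :
    𝕋.hat X.toTCat.str 𝔵 𝔶 ≤ X.toTCat.str₀ (X.vAlg.α 𝔵) (X.vAlg.α 𝔶) :=
  IsAlg.hat_le X.representable.choose 𝔵 𝔶

variable [Subsingleton (𝕋.F PUnit.{u + 1})]

/-- The Yoneda functor `X → V ^ (X^op)`, `x ↦ a₀(-, x)`. -/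
noncomputable abbrev yExp (X : 𝕋.RepCat) : 𝕋.TFunctor X.toTCat X.op.exp.toTCat where
  toFun := X.op.y
  isTFunctor := (IsPseudoHom.isHom X.induces.op X.op.vietoris_induces
    X.op.yV.isPseudoHom).op.isTFunctor X.induces X.op.exp_induces

theorem op_fn_mul_le (X : 𝕋.RepCat) (ψ : 𝕋.VExp X.op.toTCat.str) (x y : X.toTCat.carrier) :
    X.toTCat.str₀ y x * ψ.fn x ≤ ψ.fn y := by
  rw [mul_comm]
  exact VExp.mul_c_le X.induces.op ψ x y

theorem op_xi_le (X : 𝕋.RepCat) (ψ : 𝕋.VExp X.op.toTCat.str) (𝔵 : 𝕋.F X.toTCat.carrier) :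
    𝕋.xi ψ.fn 𝔵 ≤ ψ.fn (X.vAlg.α 𝔵) :=
  VExp.xi_le X.induces.op ψ 𝔵

/-- Restriction along `α : T X → X`, as a map `V ^ (X^op) → P X`. -/
noncomputable abbrev restrictObj (X : 𝕋.RepCat) (ψ : 𝕋.VExp X.op.toTCat.str) :
    X.toTCat.presheaf.carrier :=
  ⟨fun 𝔵 => ψ.fn (X.vAlg.α 𝔵), isPresheaf_of_vAlg (φ := fun 𝔵 => ψ.fn (X.vAlg.α 𝔵))
    X.toTCat.opFree_induces
    (fun 𝔵 𝔶 => by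
      rw [mul_comm]
      exact (mul_le_mul_left (X.hat_le_c 𝔶 𝔵) _).trans (X.op_fn_mul_le ψ _ _))
    (fun 𝔛 => by
      rw [← 𝕋.xi_map X.vAlg.α ψ.fn]
      exact one_mul_le (X.vAlg.le_assoc 𝔛) (X.op_fn_mul_le ψ _ _) (X.op_xi_le ψ _))⟩

/-- Restriction along `α : T X → X`, as a `T`-functor `V ^ (X^op) → P X`. -/
noncomputable abbrev restrict (X : 𝕋.RepCat) : 𝕋.TFunctor X.op.exp.toTCat X.toTCat.presheaf where
  toFun := X.restrictObj
  isTFunctor := isTFunctor_of_vAlg X.op.exp_induces X.toTCat.presheaf_induces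
    (fun ψ ψ' => le_iInf fun 𝔵 => iInf_le _ (X.vAlg.α 𝔵))
    (fun 𝔭 => one_le_iInf_hom fun 𝔵 => by
      refine (X.toTCat.mu_opFree _ _).trans_le
        (iSup_le fun 𝔛 => le_iSup_of_le (𝕋.map X.vAlg.α 𝔛) ?_)
      rw [ext_map_left, ext_map_right]
      refine mul_le_mul_right ((X.hat_le_c _ _).trans ?_) _
      exact mul_one_le (X.vAlg.le_assoc 𝔛) (X.toTCat.trans₀ _ _ _) le_rfl)

/-- The left Kan extension of a presheaf along `α : T X → X`. -/
noncomputable def extendFn (X : 𝕋.RepCat) (φ : X.toTCat.presheaf.carrier) (x : X.toTCat.carrier) :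
    V :=
  ⨆ 𝔵, φ.fn 𝔵 * X.toTCat.str₀ x (X.vAlg.α 𝔵)

theorem ext_str₀_map_α_le (X : 𝕋.RepCat) (𝔵 : 𝕋.F X.toTCat.carrier)
    (𝔛 : 𝕋.F (𝕋.F X.toTCat.carrier)) :
    𝕋.ext (fun 𝔵 x => X.toTCat.str₀ x (X.vAlg.α 𝔵)) 𝔛 𝔵 ≤
      X.toTCat.str₀ (X.vAlg.α 𝔵) (X.vAlg.α (𝕋.m 𝔛)) := by
  rw [𝕋.ext_swap (fun x 𝔵 => X.toTCat.str₀ x (X.vAlg.α 𝔵)), ← 𝕋.ext_map_right X.toTCat.str₀]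
  exact mul_one_le (X.vAlg.assoc_le 𝔛) (X.toTCat.trans₀ _ _ _) (X.vAlg.ext_le _ _)

/-- The left Kan extension along `α : T X → X`, as a map `P X → V ^ (X^op)`. -/
noncomputable abbrev extendObj (X : 𝕋.RepCat) (φ : X.toTCat.presheaf.carrier) :
    𝕋.VExp X.op.toTCat.str :=
  ⟨X.extendFn φ, isPresheaf_of_vAlg X.induces.op
    (fun x y => iSup_mul_le fun 𝔵 => le_iSup_of_le 𝔵 (by
      rw [mul_assoc, mul_comm (X.toTCat.str₀ x _)]
      exact mul_le_mul_right (X.toTCat.trans₀ y x _) _))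
    (fun 𝔵 => (xi_iSup _ _ 𝔵).trans_le (iSup_le fun 𝔛 => le_iSup_of_le (𝕋.m 𝔛)
      (mul_le_mul' (X.toTCat.xi_fn_le φ 𝔛) (X.ext_str₀_map_α_le 𝔵 𝔛))))⟩

/-- The left Kan extension along `α : T X → X`, as a `T`-functor `P X → V ^ (X^op)`. -/
noncomputable abbrev extend (X : 𝕋.RepCat) : 𝕋.TFunctor X.toTCat.presheaf X.op.exp.toTCat where
  toFun := X.extendObj
  isTFunctor := isTFunctor_of_vAlg X.toTCat.presheaf_induces X.op.exp_induces
    (fun φ φ' => iInf_hom_le_iInf_hom fun v x H => mul_iSup_le fun 𝔵 => le_iSup_of_le 𝔵 (by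
      rw [← mul_assoc]
      exact mul_le_mul_left (H 𝔵) _))
    (fun 𝔭 => one_le_iInf_hom fun x => iSup_le fun 𝔶 => by
      rw [ext_map_left]
      refine (mul_le_mul_left (𝕋.ext_comp (fun (φ : X.toTCat.presheaf.carrier) 𝔵 => φ.fn 𝔵)
        (fun 𝔵 x => X.toTCat.str₀ x (X.vAlg.α 𝔵)) 𝔭 𝔶).le _).trans (iSup_mul_le fun 𝔛 => ?_)
      refine le_iSup_of_le (𝕋.m 𝔛) ?_
      rw [mul_assoc]
      refine mul_le_mul' (X.toTCat.le_mu_opFree 𝔭 𝔛) ?_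
      rw [mul_comm]
      exact (mul_le_mul_right (X.ext_str₀_map_α_le 𝔶 𝔛) _).trans (X.toTCat.trans₀ _ _ _))

theorem extend_restrict_le (X : 𝕋.RepCat) (ψ : 𝕋.VExp X.op.toTCat.str) (x : X.toTCat.carrier) :
    (X.extendObj (X.restrictObj ψ)).fn x ≤ ψ.fn x :=
  iSup_le fun 𝔵 => by
    rw [mul_comm]
    exact X.op_fn_mul_le ψ _ _

theorem le_restrict_extend (X : 𝕋.RepCat) (φ : X.toTCat.presheaf.carrier)
    (𝔵 : 𝕋.F X.toTCat.carrier) : φ.fn 𝔵 ≤ (X.restrictObj (X.extendObj φ)).fn 𝔵 :=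
  le_iSup_of_le (f := fun 𝔶 => φ.fn 𝔶 * X.toTCat.str₀ (X.vAlg.α 𝔵) (X.vAlg.α 𝔶)) 𝔵
    (mul_one_le (X.toTCat.refl₀ _) le_rfl le_rfl)

theorem restrict_yExp (X : 𝕋.RepCat) (x : X.toTCat.carrier) :
    X.restrictObj (X.op.y x) = X.toTCat.y x :=
  Exp.ext (funext fun 𝔵 => (X.op_str₀ _ _).trans (X.induces 𝔵 x).symm)

theorem op_fn_α_e (X : 𝕋.RepCat) (ψ : 𝕋.VExp X.op.toTCat.str) (x : X.toTCat.carrier) :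
    ψ.fn (X.vAlg.α (𝕋.e x)) = ψ.fn x :=
  le_antisymm (one_mul_le (X.vAlg.le_unit x) (X.op_fn_mul_le ψ _ _) le_rfl)
    (one_mul_le (X.vAlg.unit_le x) (X.op_fn_mul_le ψ _ _) le_rfl)

theorem op_exp_str₀ (X : 𝕋.RepCat) (ψ ψ' : 𝕋.VExp X.op.toTCat.str) :
    X.op.exp.toTCat.str₀ ψ ψ' = ⨅ x, ψ.fn x ⇨ₗ ψ'.fn x :=
  X.op.exp_induces.str₀_eq ψ ψ'

theorem totallyCocomplete_iff_exists_adjoint_yExp (X : 𝕋.RepCat) :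
    TotallyCocomplete X.toTCat ↔
      ∃ I : 𝕋.TFunctor X.op.exp.toTCat X.toTCat, 𝕋.IsAdjoint I X.yExp := by
  constructor
  · rintro ⟨S, hS⟩
    refine ⟨X.restrict.comp S, fun ψ => ?_, fun x => ?_⟩
    · have h := hS.1 (X.restrictObj ψ)
      rw [TCat.presheaf_str₀] at h
      rw [op_exp_str₀]
      refine one_le_iInf_hom fun x => ?_
      have h' := le_hom_iff.1 (h.trans (iInf_le _ (𝕋.e x)))
      rw [one_mul] at h'
      refine (X.op_fn_α_e ψ x).ge.trans (h'.trans (le_of_eq ?_))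
      exact (X.op_str₀ _ _).symm
    · exact (hS.2 x).trans_eq
        (congrArg (fun φ => X.toTCat.str₀ (S.toFun φ) x) (X.restrict_yExp x)).symm
  · rintro ⟨I, hI⟩
    refine ⟨X.extend.comp I, fun φ => ?_, fun x => ?_⟩
    · have h := hI.1 (X.extendObj φ)
      rw [op_exp_str₀] at h
      rw [TCat.presheaf_str₀]
      refine one_le_iInf_hom fun 𝔵 => ?_
      have h' := le_hom_iff.1 (h.trans (iInf_le _ (X.vAlg.α 𝔵)))
      rw [one_mul] at h'
      refine (X.le_restrict_extend φ 𝔵).trans (h'.trans (le_of_eq ?_))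
      exact (X.op_str₀ _ _).trans (X.induces _ _).symm
    · refine one_mul_le (a := X.toTCat.str₀ (I.toFun (X.extendObj (X.toTCat.y x)))
        (I.toFun (X.op.y x))) ?_ (X.toTCat.trans₀ _ _ _) (hI.2 x)
      refine le_trans ?_ (I.str₀_le _ _)
      rw [op_exp_str₀, ← restrict_yExp]
      exact one_le_iInf_hom (X.extend_restrict_le _)

theorem totallyComplete_op_iff_exists_adjoint_yExp (X : 𝕋.RepCat) :
    TotallyComplete X.op ↔
      ∃ I : 𝕋.TFunctor X.op.exp.toTCat X.toTCat, 𝕋.IsAdjoint I X.yExp := by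
  constructor
  · rintro ⟨I, hI⟩
    have h := (IsPseudoHom.isHom X.op.vietoris_induces X.induces.op I.isPseudoHom).op
    refine ⟨⟨I.toFun, h.isTFunctor X.op.exp_induces X.induces⟩, fun ψ => ?_, fun x => ?_⟩
    · have := hI.2 ψ
      rw [op_str₀] at this
      exact this
    · have := hI.1 x
      rw [op_str₀] at this
      exact this
  · rintro ⟨I, hI⟩
    have h := (IsPseudoHom.isHom X.op.exp_induces X.induces
      (hI.isPseudoHom X.representable X.op.exp_induces)).op
    refine ⟨⟨⟨I.toFun, h.isTFunctor X.op.vietoris_induces X.induces.op⟩,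
      h.isPseudoHom X.op.vietoris_induces X.induces.op⟩, fun x => ?_, fun ψ => ?_⟩
    · rw [op_str₀]
      exact hI.2 x
    · rw [op_str₀]
      exact hI.1 ψ

theorem totallyCocomplete_iff_totallyComplete_op (X : 𝕋.RepCat) :
    TotallyCocomplete X.toTCat ↔ TotallyComplete X.op :=
  X.totallyCocomplete_iff_exists_adjoint_yExp.trans
    X.totallyComplete_op_iff_exists_adjoint_yExp.symm

end RepCat

namespace TCat

variable [Subsingleton (𝕋.F PUnit.{u + 1})]

/-- The presheaf `ã(-, 𝔵)` on `X`. -/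
noncomputable abbrev hatY (X : 𝕋.TCat) (𝔵 : 𝕋.F X.carrier) : X.presheaf.carrier :=
  ⟨fun 𝔶 => 𝕋.hat X.str 𝔶 𝔵, isPresheaf_of_vAlg (φ := fun 𝔶 => 𝕋.hat X.str 𝔶 𝔵) X.opFree_induces
    (fun 𝔶 𝔷 => by rw [mul_comm]; exact X.hat_trans 𝔷 𝔶 𝔵)
    (fun 𝔛 => by
      rw [← 𝕋.ext_e_left (fun 𝔵 𝔶 => 𝕋.hat X.str 𝔶 𝔵), 𝕋.ext_swap (𝕋.hat X.str)]
      refine (X.ext_hat_le _ _).trans_eq ?_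
      rw [m_e])⟩

/-- The `T`-functor `T X → P X`, `𝔵 ↦ ã(-, 𝔵)`. -/
noncomputable abbrev hatYFunctor (X : 𝕋.TCat) : 𝕋.TFunctor X.free X.presheaf where
  toFun := X.hatY
  isTFunctor 𝔛 𝔵 := by
    rw [presheaf_str]
    refine le_iInf fun 𝔶 => le_hom_iff.2 ?_
    rw [mu_opFree]
    refine mul_iSup_le fun 𝔜 => ?_
    rw [ext_map_left, 𝕋.ext_swap (𝕋.hat X.str), mul_comm]
    refine (mul_le_mul_left ((mul_le_mul_left (X.ext_hat_le 𝔜 𝔛) _).trans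
      ((mul_comm _ _).trans_le (X.hat_trans _ _ _))) _).trans (X.hat_trans _ _ _)

/-- A left adjoint of the Yoneda functor represents colimits of presheaves. -/
theorem adj_str₀ {X : 𝕋.TCat} {S : X.presheaf ⟶ X} (hS : 𝕋.IsAdjoint S X.yP)
    (φ : X.presheaf.carrier) (x : X.carrier) :
    X.str₀ (S.toFun φ) x = ⨅ 𝔵, φ.fn 𝔵 ⇨ₗ X.str 𝔵 x :=
  (hS.str₀_eq φ x).trans (X.presheaf_str₀ φ (X.y x))

theorem iInf_hat_hom (X : 𝕋.TCat) (𝔵 : 𝕋.F X.carrier) (x : X.carrier) :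
    (⨅ 𝔶, 𝕋.hat X.str 𝔶 𝔵 ⇨ₗ X.str 𝔶 x) = X.str 𝔵 x :=
  le_antisymm ((iInf_le _ 𝔵).trans (mul_one_le (X.one_le_hat 𝔵) (hom_mul_le _ _) le_rfl))
    (le_iInf fun 𝔶 => le_hom_iff.2 (by rw [mul_comm]; exact X.hat_mul_le _ _ _))

end TCat

theorem TotallyCocomplete.representable [Subsingleton (𝕋.F PUnit.{u + 1})]
    {X : 𝕋.TCat} (h : TotallyCocomplete X) : 𝕋.Representable X := by
  obtain ⟨S, hS⟩ := h
  have hα : ∀ 𝔵 x, X.str₀ (S.toFun (X.hatY 𝔵)) x = X.str 𝔵 x := fun 𝔵 x =>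
    (TCat.adj_str₀ hS _ x).trans (X.iInf_hat_hom 𝔵 x)
  refine ⟨X.hatYFunctor.comp S, fun 𝔵 => ?_, fun x => ?_⟩
  · change 1 ≤ 𝕋.hat X.str (𝕋.m (𝕋.e 𝔵)) (𝕋.e (S.toFun (X.hatY 𝔵)))
    rw [m_e, TCat.hat_e, ← hα]
    exact X.refl₀ _
  · change 1 ≤ X.str₀ (S.toFun (X.hatY (𝕋.e x))) x
    rw [hα]
    exact X.refl x

theorem ext_hat_le {X Y : Type u} (α : 𝕋.F X → Y → V) (𝔛 : 𝕋.F (𝕋.F X)) (𝔜 : 𝕋.F (𝕋.F Y)) :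
    𝕋.ext (𝕋.hat α) 𝔛 𝔜 ≤ 𝕋.hat α (𝕋.m 𝔛) (𝕋.m 𝔜) := by
  refine (𝕋.ext_image_le 𝕋.m (𝕋.ext α) 𝔛 𝔜).trans (iSup₂_le fun 𝔚 h => ?_)
  subst h
  refine (𝕋.ext_ext_le α 𝔚 𝔜).trans ?_
  rw [m_map_m]
  exact 𝕋.le_hat _ _ _

variable [Subsingleton (𝕋.F PUnit.{u + 1})]

theorem xi_const {X : Type u} (v : V) (𝔵 : 𝕋.F X) : 𝕋.xi (fun _ => v) 𝔵 = v := by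
  rw [← 𝕋.xi_map (fun _ => PUnit.unit) (fun _ : PUnit.{u + 1} => v) 𝔵,
    Subsingleton.elim (𝕋.map _ 𝔵) (𝕋.e PUnit.unit), xi_e]

theorem xi_hat_le {X Y : Type u} (α : 𝕋.F X → Y → V) (𝔛 : 𝕋.F (𝕋.F X)) (𝔶 : 𝕋.F Y) :
    𝕋.xi (fun 𝔵 => 𝕋.hat α 𝔵 𝔶) 𝔛 ≤ 𝕋.hat α (𝕋.m 𝔛) 𝔶 := by
  rw [← 𝕋.ext_e_left (fun 𝔶 𝔵 => 𝕋.hat α 𝔵 𝔶), 𝕋.ext_swap (𝕋.hat α)]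
  refine (ext_hat_le α _ _).trans_eq ?_
  rw [m_e]

/-- The image of a weight on `T D` along a map `d : D → X`. -/
noncomputable abbrev TCat.imagePresheaf (X : 𝕋.TCat) {D : Type u} (d : D → X.carrier)
    (θ : 𝕋.F D → V) (hθ : ∀ 𝔇, 𝕋.xi θ 𝔇 ≤ θ (𝕋.m 𝔇)) : X.presheaf.carrier :=
  ⟨fun 𝔵 => ⨆ 𝔡, θ 𝔡 * 𝕋.hat X.str 𝔵 (𝕋.map d 𝔡),
    isPresheaf_of_vAlg (φ := fun 𝔵 => ⨆ 𝔡, θ 𝔡 * 𝕋.hat X.str 𝔵 (𝕋.map d 𝔡)) X.opFree_induces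
      (fun 𝔵 𝔶 => iSup_mul_le fun 𝔡 => le_iSup_of_le 𝔡 (by
        rw [mul_assoc, mul_comm (𝕋.hat X.str _ _)]
        exact mul_le_mul_right (X.hat_trans _ _ _) _))
      (fun 𝔛 => (xi_iSup _ _ 𝔛).trans_le (iSup_le fun 𝔇 => le_iSup_of_le (𝕋.m 𝔇)
        (mul_le_mul' (hθ 𝔇) (by
          rw [𝕋.ext_swap (fun 𝔵 𝔡 => 𝕋.hat X.str 𝔵 (𝕋.map d 𝔡)), ← 𝕋.ext_map_right, map_m]
          exact X.ext_hat_le _ _))))⟩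

/-- The image of a weight on `A` along a map `h : A → X`. -/
noncomputable abbrev TCat.imageExp (X : 𝕋.TCat) {A : Type u} (h : A → X.carrier) (θ : A → V) :
    𝕋.VExp X.str :=
  ⟨fun x => ⨆ 𝔷, 𝕋.xi θ 𝔷 * X.str (𝕋.map h 𝔷) x,
    (𝕋.isPresheaf_iff X.str fun x => ⨆ 𝔷, 𝕋.xi θ 𝔷 * X.str (𝕋.map h 𝔷) x).2 fun 𝔵 x => by
    rw [xi_iSup]
    refine iSup_mul_le fun 𝔚 => le_iSup_of_le (𝕋.m 𝔚) ?_
    rw [mul_assoc, ← xi_m, ← 𝕋.ext_map_left X.str, map_m]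
    exact mul_le_mul_right (X.trans _ _ _) _⟩

/-- A map preserves the existing colimits of presheaves. -/
def PreservesColims (X Y : 𝕋.TCat) (f : X.carrier → Y.carrier) : Prop :=
  ∀ (χ : X.presheaf.carrier) (x₀ : X.carrier),
    (∀ x, X.str₀ x₀ x = ⨅ 𝔵, χ.fn 𝔵 ⇨ₗ X.str 𝔵 x) →
      ∀ y, Y.str₀ (f x₀) y = ⨅ 𝔵, χ.fn 𝔵 ⇨ₗ Y.str (𝕋.map f 𝔵) y

/-- A map preserves the existing limits weighted by elements of `V ^ X`. -/
def PreservesLims (X Y : 𝕋.TCat) (f : X.carrier → Y.carrier) : Prop :=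
  ∀ (ψ : 𝕋.VExp X.str) (x₀ : X.carrier),
    (∀ x, X.str₀ x x₀ = ⨅ z, ψ.fn z ⇨ₗ X.str₀ x z) →
      ∀ y, Y.str₀ y (f x₀) = ⨅ z, ψ.fn z ⇨ₗ Y.str₀ y (f z)

theorem PreservesColims.str_map_eq {X Y : 𝕋.TCat} {A : 𝕋.VAlg X.carrier} (hA : A.Induces)
    {f : 𝕋.TFunctor X Y} (h : PreservesColims X Y f.toFun) (𝔵 : 𝕋.F X.carrier) (y : Y.carrier) :
    Y.str (𝕋.map f.toFun 𝔵) y = Y.str₀ (f.toFun (A.α 𝔵)) y := by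
  rw [h (X.hatY 𝔵) (A.α 𝔵) fun x => by rw [X.iInf_hat_hom, hA, hA.str₀_eq]]
  refine le_antisymm (le_iInf fun 𝔶 => le_hom_iff.2 ?_)
    ((iInf_le _ 𝔵).trans (mul_one_le (X.one_le_hat 𝔵) (hom_mul_le _ _) le_rfl))
  rw [mul_comm]
  exact (mul_le_mul_left (hat_map_le f 𝔶 𝔵) _).trans (Y.hat_mul_le _ _ _)

theorem PreservesColims.isPseudoHom {X Y : 𝕋.RepCat} {f : 𝕋.TFunctor X.toTCat Y.toTCat}
    (h : PreservesColims X.toTCat Y.toTCat f.toFun) : 𝕋.IsPseudoHom f :=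
  (isPseudoHom_iff Y.representable X.induces f).2 fun 𝔵 y => (h.str_map_eq X.induces 𝔵 y).le

theorem IsCocontinuous.preservesColims {X Y : 𝕋.TCat} {f : 𝕋.TFunctor X Y}
    (h : IsCocontinuous f) : PreservesColims X Y f.toFun := by
  intro χ x₀ hx y
  have hχ : ∀ 𝔵 t, 𝕋.hat (fun 𝔵 (_ : PUnit.{u + 1}) => χ.fn 𝔵) 𝔵 t = χ.fn 𝔵 := fun 𝔵 t => by
    rw [Subsingleton.elim t (𝕋.e PUnit.unit)]
    refine le_antisymm (iSup₂_le fun 𝔛 h𝔛 => ?_)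
      (𝕋.le_hat_e (fun 𝔵 (_ : PUnit.{u + 1}) => χ.fn 𝔵) 𝔵 PUnit.unit)
    rw [← h𝔛, ← 𝕋.ext_swap, ext_e_left]
    exact X.xi_fn_le χ 𝔛
  have hc : ∀ x t, X.str (𝕋.map (fun _ : PUnit.{u + 1} => x) t) = X.str (𝕋.e x) := fun x t => by
    rw [Subsingleton.elim t (𝕋.e PUnit.unit), map_e]
  have key := h X 𝕋.G (TFunctor.id X) (fun 𝔵 _ => χ.fn 𝔵) (constFunctor X x₀) ⟨?_, ?_⟩ ?_
    (𝕋.e PUnit.unit) y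
  · change Y.str (𝕋.map (fun _ : PUnit.{u + 1} => f.toFun x₀) (𝕋.e PUnit.unit)) y = ⨅ 𝔵,
      𝕋.hat (fun 𝔵 (_ : PUnit.{u + 1}) => χ.fn 𝔵) 𝔵 (𝕋.e PUnit.unit) ⇨ₗ
        Y.str (𝕋.map (fun x => f.toFun x) 𝔵) y at key
    simp only [hχ, map_e] at key
    exact key
  · exact fun 𝔵 _ => iSup_le fun 𝔶 => X.hat_mul_fn_le χ 𝔵 𝔶
  · refine fun 𝔵 _ => iSup_le fun t => ?_
    refine (mul_le_mul_left (hχ 𝔵 t).le _).trans ?_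
    exact mul_iSup_le fun _ => (mul_one _).le
  · intro t x
    refine (congrFun (hc x₀ t) x).trans ((hx x).trans (iInf_congr fun 𝔵 => ?_))
    exact congrArg₂ (· ⇨ₗ ·) (hχ 𝔵 t).symm (congrArg (X.str · x) (𝕋.map_id' 𝔵).symm)

theorem PreservesColims.isCocontinuous {X : 𝕋.RepCat} {Y : 𝕋.TCat} {f : 𝕋.TFunctor X.toTCat Y}
    (h : PreservesColims X.toTCat Y f.toFun) : IsCocontinuous f := by
  intro D A d φ g _ hg 𝔞 y
  have key := h (X.toTCat.imagePresheaf d.toFun (fun 𝔡 => 𝕋.hat φ 𝔡 𝔞)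
    fun 𝔇 => xi_hat_le φ 𝔇 𝔞) (X.vAlg.α (𝕋.map g.toFun 𝔞)) (fun x => ?_) y
  · rw [← h.str_map_eq X.induces, map_map] at key
    refine key.trans (iInf_iSup_mul_hom (fun 𝔵 𝔡 => ?_) fun 𝔡 => ⟨𝕋.map d.toFun 𝔡, ?_, ?_⟩)
    · change _ * Y.str (𝕋.map (fun z => f.toFun (d.toFun z)) 𝔡) y ≤ _
      rw [← 𝕋.map_map d.toFun f.toFun]
      exact (mul_le_mul_left (hat_map_le f _ _) _).trans (Y.hat_mul_le _ _ _)
    · exact X.toTCat.one_le_hat _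
    · rw [map_map]
  · refine (X.induces _ x).symm.trans ((hg 𝔞 x).trans
      (iInf_iSup_mul_hom (h := fun 𝔡 => X.toTCat.str (𝕋.map d.toFun 𝔡) x)
        (g := fun 𝔵 => X.toTCat.str 𝔵 x) (fun 𝔵 𝔡 => ?_)
        fun 𝔡 => ⟨𝕋.map d.toFun 𝔡, ?_, le_rfl⟩).symm)
    · exact X.toTCat.hat_mul_le _ _ _
    · exact X.toTCat.one_le_hat _

theorem IsContinuous.preservesLims {X Y : 𝕋.RepCat} {f : 𝕋.TFunctor X.toTCat Y.toTCat}
    (h : IsContinuous f) : PreservesLims X.toTCat Y.toTCat f.toFun := by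
  intro ψ x₀ hx y
  refine h X.toTCat (TFunctor.id X.toTCat) (fun _ z => ψ.fn z) x₀ ⟨?_, ?_⟩ ?_ (𝕋.e y)
  · refine fun t z => iSup_le fun t' => ?_
    have h₁ : 𝕋.hat (𝕋.G).str t t' ≤ 1 := iSup₂_le fun 𝔛 _ => 𝕋.ext_le fun w _ _ =>
      (𝕋.xi_mono (fun p => iSup_le fun _ => le_rfl) w).trans (𝕋.xi_one w).le
    exact (mul_le_mul_left h₁ _).trans (one_mul _).le
  · refine fun t z => iSup_le fun 𝔷 => ?_
    exact (mul_le_mul_left (hat_const ψ.fn t 𝔷).le _).trans (VExp.le 𝕋 ψ 𝔷 z)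
  · refine fun 𝔵 => (X.induces 𝔵 x₀).trans ((hx _).trans (iInf_congr fun z => ?_))
    exact congrArg (_ ⇨ₗ ·) (X.induces 𝔵 z).symm

theorem iInf_xi_hom {Y : 𝕋.RepCat} {A : Type u} (h : A → Y.toTCat.carrier) (θ : A → V)
    (k : 𝕋.F A → Y.toTCat.carrier) (h₁ : ∀ z, 1 ≤ Y.toTCat.str₀ (k (𝕋.e z)) (h z))
    (h₂ : ∀ 𝔷, 1 ≤ Y.toTCat.str₀ (Y.vAlg.α (𝕋.map h 𝔷)) (k 𝔷)) (y : Y.toTCat.carrier) :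
    (⨅ 𝔷, 𝕋.xi θ 𝔷 ⇨ₗ Y.toTCat.str₀ y (k 𝔷)) = ⨅ z, θ z ⇨ₗ Y.toTCat.str₀ y (h z) := by
  apply le_antisymm
  · refine iInf_hom_le_iInf_hom fun v z H => ?_
    have := H (𝕋.e z)
    rw [xi_e] at this
    exact this.trans (mul_one_le (h₁ z) (Y.toTCat.trans₀ _ _ _) le_rfl)
  · refine iInf_hom_le_iInf_hom fun v 𝔷 H => ?_
    refine le_trans ?_ (mul_one_le (h₂ 𝔷) (Y.toTCat.trans₀ y _ _) le_rfl)
    have h₃ : v * 𝕋.xi θ 𝔷 = 𝕋.xi (fun z => v * θ z) 𝔷 := by rw [xi_mul, xi_const]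
    rw [h₃]
    refine (𝕋.xi_mono H 𝔷).trans ?_
    rw [← 𝕋.xi_map h (Y.toTCat.str₀ y), ← ext_e_left]
    exact (Y.vAlg.ext_le _ _).trans_eq (Y.vAlg.c_unit y _)

theorem PreservesLims.isContinuous {X Y : 𝕋.RepCat} {f : 𝕋.TFunctor X.toTCat Y.toTCat}
    (hf : 𝕋.IsPseudoHom f) (h : PreservesLims X.toTCat Y.toTCat f.toFun) : IsContinuous f := by
  intro A k φ x₀ _ hx 𝔶
  have hf' := IsPseudoHom.isHom X.induces Y.induces hf
  have hk : ∀ z, 1 ≤ X.toTCat.str₀ (X.vAlg.α (𝕋.map k.toFun (𝕋.e z))) (k.toFun z) := fun z => by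
    rw [map_e]
    exact X.vAlg.unit_le _
  have key := h (X.toTCat.imageExp k.toFun (φ (𝕋.e PUnit.unit))) x₀ (fun x => ?_)
    (Y.vAlg.α 𝔶)
  · refine (Y.induces 𝔶 _).trans (key.trans (Eq.trans ?_ (iInf_congr fun z =>
      congrArg (_ ⇨ₗ ·) (Y.induces 𝔶 (f.toFun (k.toFun z)))).symm))
    refine (iInf_iSup_mul_hom
      (h := fun 𝔷 => Y.toTCat.str₀ (Y.vAlg.α 𝔶) (f.toFun (X.vAlg.α (𝕋.map k.toFun 𝔷))))
      (g := fun z => Y.toTCat.str₀ (Y.vAlg.α 𝔶) (f.toFun z))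
      (fun z 𝔷 => ?_) fun 𝔷 => ⟨X.vAlg.α (𝕋.map k.toFun 𝔷), ?_, le_rfl⟩).trans
      (iInf_xi_hom (fun z => f.toFun (k.toFun z)) _ _ (fun z => (hk z).trans (f.str₀_le _ _))
        (fun 𝔷 => ?_) _)
    · rw [mul_comm, X.induces]
      exact (mul_le_mul_right (f.str₀_le _ _) _).trans (Y.toTCat.trans₀ _ _ _)
    · rw [X.induces]
      exact X.vAlg.refl _
    · rw [← 𝕋.map_map k.toFun f.toFun]
      exact hf'.map_le _
  · have hx' := hx (𝕋.e x)
    refine hx'.trans (Eq.symm ?_)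
    refine (iInf_iSup_mul_hom
      (h := fun 𝔷 => X.toTCat.str₀ x (X.vAlg.α (𝕋.map k.toFun 𝔷)))
      (g := fun z => X.toTCat.str₀ x z)
      (fun z 𝔷 => ?_) fun 𝔷 => ⟨X.vAlg.α (𝕋.map k.toFun 𝔷), ?_, le_rfl⟩).trans
      (iInf_xi_hom k.toFun _ _ hk (fun 𝔷 => X.vAlg.refl _) _)
    · rw [mul_comm, X.induces]
      exact X.toTCat.trans₀ _ _ _
    · rw [X.induces]
      exact X.vAlg.refl _

theorem preservesLims_op_iff {X Y : 𝕋.RepCat} {f : X.toTCat.carrier → Y.toTCat.carrier} :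
    PreservesLims X.op.toTCat Y.op.toTCat f ↔
      ∀ (ψ : 𝕋.VExp X.op.toTCat.str) (x₀ : X.toTCat.carrier),
        (∀ x, X.toTCat.str₀ x₀ x = ⨅ z, ψ.fn z ⇨ₗ X.toTCat.str₀ z x) →
          ∀ y, Y.toTCat.str₀ (f x₀) y = ⨅ z, ψ.fn z ⇨ₗ Y.toTCat.str₀ (f z) y := by
  have hX : ∀ (ψ : 𝕋.VExp X.op.toTCat.str) x, (⨅ z, ψ.fn z ⇨ₗ X.op.toTCat.str₀ x z) =
      ⨅ z, ψ.fn z ⇨ₗ X.toTCat.str₀ z x := fun ψ x =>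
    iInf_congr fun z => congrArg (_ ⇨ₗ ·) (X.op_str₀ x z)
  have hY : ∀ (ψ : 𝕋.VExp X.op.toTCat.str) y, (⨅ z, ψ.fn z ⇨ₗ Y.op.toTCat.str₀ y (f z)) =
      ⨅ z, ψ.fn z ⇨ₗ Y.toTCat.str₀ (f z) y := fun ψ y =>
    iInf_congr fun z => congrArg (_ ⇨ₗ ·) (Y.op_str₀ y (f z))
  refine forall₂_congr fun ψ x₀ => ⟨fun h hx y => ?_, fun h hx y => ?_⟩
  · exact (Y.op_str₀ _ _).symm.trans ((h (fun x => (X.op_str₀ _ _).trans ((hx x).trans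
      (hX ψ x).symm)) y).trans (hY ψ y))
  · exact (Y.op_str₀ _ _).trans ((h (fun x => (X.op_str₀ _ _).symm.trans ((hx x).trans
      (hX ψ x))) y).trans (hY ψ y).symm)

theorem PreservesColims.preservesLims_op {X Y : 𝕋.RepCat} {f : 𝕋.TFunctor X.toTCat Y.toTCat}
    (h : PreservesColims X.toTCat Y.toTCat f.toFun) :
    PreservesLims X.op.toTCat Y.op.toTCat f.toFun := by
  refine preservesLims_op_iff.2 fun ψ x₀ hx y => ?_
  have hα : ∀ (Z : 𝕋.RepCat) (g : 𝕋.TFunctor X.toTCat Z.toTCat) (z : Z.toTCat.carrier),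
      (⨅ 𝔵, ψ.fn (X.vAlg.α 𝔵) ⇨ₗ Z.toTCat.str₀ (g.toFun (X.vAlg.α 𝔵)) z) =
        ⨅ x, ψ.fn x ⇨ₗ Z.toTCat.str₀ (g.toFun x) z := fun Z g z =>
    le_antisymm
      (iInf_hom_le_iInf_hom fun v x H => by
        rw [← X.op_fn_α_e ψ x]
        exact (H (𝕋.e x)).trans (one_mul_le ((X.vAlg.le_unit x).trans (g.str₀_le _ _))
          (Z.toTCat.trans₀ _ _ _) le_rfl))
      (le_iInf fun 𝔵 => iInf_le _ (X.vAlg.α 𝔵))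
  refine (h (X.restrictObj ψ) x₀ (fun x => ?_) y).trans (Eq.trans ?_ (hα Y f y))
  · refine (hx x).trans ((hα X (TFunctor.id _) x).symm.trans (iInf_congr fun 𝔵 => ?_))
    exact congrArg (_ ⇨ₗ ·) (X.induces 𝔵 x).symm
  · exact iInf_congr fun 𝔵 => congrArg (_ ⇨ₗ ·) (h.str_map_eq X.induces 𝔵 y)

theorem PreservesLims.preservesColims {X Y : 𝕋.RepCat} {f : X.toTCat.carrier → Y.toTCat.carrier}
    (hf : X.vAlg.IsHom Y.vAlg f) (h : PreservesLims X.op.toTCat Y.op.toTCat f) :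
    PreservesColims X.toTCat Y.toTCat f := by
  intro χ x₀ hx y
  have hY : ∀ 𝔵, Y.toTCat.str (𝕋.map f 𝔵) y = Y.toTCat.str₀ (f (X.vAlg.α 𝔵)) y := fun 𝔵 => by
    rw [Y.induces]
    exact le_antisymm (one_mul_le (hf.le_map 𝔵) (Y.toTCat.trans₀ _ _ _) le_rfl)
      (one_mul_le (hf.map_le 𝔵) (Y.toTCat.trans₀ _ _ _) le_rfl)
  have key := preservesLims_op_iff.1 h (X.extendObj χ) x₀
  refine (key (fun x => ?_) y).trans (Eq.trans (iInf_iSup_mul_hom (fun x 𝔵 => ?_) fun 𝔵 =>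
    ⟨X.vAlg.α 𝔵, X.toTCat.refl₀ _, le_rfl⟩)
    (iInf_congr fun 𝔵 => congrArg (_ ⇨ₗ ·) (hY 𝔵).symm))
  · refine (hx x).trans (iInf_iSup_mul_hom (fun x' 𝔵 => ?_) fun 𝔵 =>
      ⟨X.vAlg.α 𝔵, X.toTCat.refl₀ _, (X.induces 𝔵 x).ge⟩).symm
    rw [X.induces]
    exact X.toTCat.trans₀ _ _ _
  · exact (mul_le_mul_left (hf.c_le _ _) _).trans (Y.toTCat.trans₀ _ _ _)

/-- The representable `T`-category underlying a totally cocomplete `T`-category. -/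
abbrev TotallyCocomplete.toRepCat {X : 𝕋.TCat} (h : TotallyCocomplete X) : 𝕋.RepCat :=
  ⟨X, h.representable⟩

/-- A colimit preserving `T`-functor between representable `T`-categories, as a
pseudo-homomorphism between the duals. -/
abbrev PreservesColims.opHom {X Y : 𝕋.RepCat} {f : 𝕋.TFunctor X.toTCat Y.toTCat}
    (h : PreservesColims X.toTCat Y.toTCat f.toFun) : PseudoHom X.op Y.op where
  toFun := f.toFun
  isTFunctor := (IsPseudoHom.isHom X.induces Y.induces h.isPseudoHom).op.isTFunctor
    X.induces.op Y.induces.op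
  isPseudoHom := (IsPseudoHom.isHom X.induces Y.induces h.isPseudoHom).op.isPseudoHom
    X.induces.op Y.induces.op

theorem PseudoHom.isHom_of_op {X Y : 𝕋.RepCat} (g : PseudoHom X.op Y.op) :
    X.vAlg.IsHom Y.vAlg g.toFun :=
  (IsPseudoHom.isHom X.induces.op Y.induces.op g.isPseudoHom).op

variable (𝕋) in
/-- Taking duals, from totally cocomplete to totally complete `T`-categories. -/
noncomputable def coctsOp : 𝕋.Cocts ⥤ 𝕋.Cts where
  obj X := ⟨X.totallyCocomplete.toRepCat.op,
    X.totallyCocomplete.toRepCat.totallyCocomplete_iff_totallyComplete_op.1 X.totallyCocomplete⟩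
  map {X Y} f :=
    { toPseudoHom := (IsCocontinuous.preservesColims
        (CoctsHom.isCocontinuous f)).opHom (X := X.totallyCocomplete.toRepCat)
          (Y := Y.totallyCocomplete.toRepCat)
      isContinuous := PreservesLims.isContinuous (X := X.totallyCocomplete.toRepCat.op)
        (Y := Y.totallyCocomplete.toRepCat.op) (PseudoHom.isPseudoHom _)
        (PreservesColims.preservesLims_op (X := X.totallyCocomplete.toRepCat)
          (Y := Y.totallyCocomplete.toRepCat)
          (IsCocontinuous.preservesColims (CoctsHom.isCocontinuous f))) }

instance : (𝕋.coctsOp).Faithful where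
  map_injective h := CoctsHom.ext
    (congrArg (fun k => (CtsHom.toPseudoHom k).toTFunctor.toFun) h)

instance : (𝕋.coctsOp).Full where
  map_surjective {X Y} g := by
    have hg := PseudoHom.isHom_of_op (X := X.totallyCocomplete.toRepCat)
      (Y := Y.totallyCocomplete.toRepCat) (CtsHom.toPseudoHom g)
    have hl : PreservesLims _ _ _ := IsContinuous.preservesLims
      (X := X.totallyCocomplete.toRepCat.op) (Y := Y.totallyCocomplete.toRepCat.op)
      (CtsHom.isContinuous g)
    exact ⟨⟨⟨_, hg.isTFunctor (RepCat.induces _) (RepCat.induces _)⟩,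
      PreservesColims.isCocontinuous (X := X.totallyCocomplete.toRepCat)
        (hl.preservesColims hg)⟩, rfl⟩

theorem TotallyComplete.op {X : 𝕋.RepCat} (h : TotallyComplete X) :
    TotallyCocomplete X.op.toTCat :=
  X.op.totallyCocomplete_iff_totallyComplete_op.2 (by rwa [RepCat.op_op])

/-- The totally cocomplete dual of a totally complete `T`-category. -/
noncomputable abbrev Cts.op (X : 𝕋.Cts) : 𝕋.Cocts := ⟨X.toRepCat.op.toTCat, X.totallyComplete.op⟩

theorem coctsOp_obj_op (X : 𝕋.Cts) : 𝕋.coctsOp.obj X.op = X := by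
  obtain ⟨X, hX⟩ := X
  have h : (𝕋.coctsOp.obj (Cts.op ⟨X, hX⟩)).toRepCat = X := X.op_op
  generalize 𝕋.coctsOp.obj (Cts.op ⟨X, hX⟩) = Y at h
  subst h
  rfl

instance : (𝕋.coctsOp).EssSurj where
  mem_essImage X := ⟨X.op, ⟨eqToIso (coctsOp_obj_op X)⟩⟩

instance : (𝕋.coctsOp).IsEquivalence where

variable (𝕋) in
/-- Taking duals, on separated objects. -/
noncomputable def sepCoctsOp : (Cocts.Sep 𝕋).FullSubcategory ⥤ (Cts.Sep 𝕋).FullSubcategory :=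
  (Cts.Sep 𝕋).lift ((Cocts.Sep 𝕋).ι ⋙ 𝕋.coctsOp)
    fun X => RepCat.separated_op (X := X.obj.totallyCocomplete.toRepCat) X.property

theorem sepCoctsOp_ι : 𝕋.sepCoctsOp ⋙ (Cts.Sep 𝕋).ι = (Cocts.Sep 𝕋).ι ⋙ 𝕋.coctsOp := rfl

instance : (𝕋.sepCoctsOp).Faithful :=
  haveI : ((Cocts.Sep 𝕋).ι ⋙ 𝕋.coctsOp).Faithful := Functor.Faithful.comp _ _
  Functor.Faithful.of_comp_iso (eqToIso sepCoctsOp_ι)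
instance : (𝕋.sepCoctsOp).Full :=
  haveI : ((Cocts.Sep 𝕋).ι ⋙ 𝕋.coctsOp).Full := Functor.Full.comp _ _
  Functor.Full.of_comp_faithful_iso (eqToIso sepCoctsOp_ι)
instance : (𝕋.sepCoctsOp).EssSurj where
  mem_essImage X := ⟨⟨X.obj.op, RepCat.separated_op X.property⟩,
    ⟨ObjectProperty.isoMk _ (eqToIso (coctsOp_obj_op X.obj))⟩⟩
instance : (𝕋.sepCoctsOp).IsEquivalence where

theorem Separated.eq_of_str₀_left {X : 𝕋.TCat} (hX : Separated X) {x y : X.carrier}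
    (h : ∀ z, X.str₀ x z = X.str₀ y z) : x = y :=
  hX.eq ((h y).symm ▸ X.refl₀ y) (h x ▸ X.refl₀ x)

theorem Separated.eq_of_str₀_right {X : 𝕋.TCat} (hX : Separated X) {x y : X.carrier}
    (h : ∀ z, X.str₀ z x = X.str₀ z y) : x = y :=
  hX.eq (h x ▸ X.refl₀ x) ((h y).symm ▸ X.refl₀ y)

namespace TCat

theorem isAdjoint_yP_of_section {X : 𝕋.TCat} {S : X.presheaf ⟶ X}
    (h : ∀ x, S.toFun (X.y x) = x) : 𝕋.IsAdjoint S X.yP := by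
  refine ⟨fun φ => ?_, fun x => ?_⟩
  · rw [presheaf_str₀]
    refine one_le_iInf_hom fun 𝔵 => ?_
    have h' := S.isTFunctor (𝕋.map X.y 𝔵) φ
    rw [str_y, map_map] at h'
    simp only [h, map_id'] at h'
    exact h'
  · exact (X.refl₀ x).trans_eq (congrArg (X.str₀ · x) (h x)).symm

theorem section_of_isAdjoint {X : 𝕋.TCat} (hX : Separated X) {S : X.presheaf ⟶ X}
    (hS : 𝕋.IsAdjoint S X.yP) (x : X.carrier) : S.toFun (X.y x) = x :=
  hX.eq_of_str₀_left fun z => by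
    rw [hS.str₀_eq]
    exact (congrArg (X.presheaf.str · (X.y z)) (𝕋.map_e X.y x)).symm.trans (X.str_y (𝕋.e x) (X.y z))

theorem mu_opFree_le (X : 𝕋.TCat) (𝔭 : 𝕋.F X.presheaf.carrier) (𝔵 : 𝕋.F X.carrier) :
    𝕋.mu X.opFree.toTCat.str 𝔭 𝔵 ≤ 𝕋.hat X.presheaf.str (𝕋.map X.y 𝔵) 𝔭 := by
  rw [mu_opFree]
  refine iSup_le fun 𝔛 => ?_
  rw [mul_comm]
  refine (mul_le_mul' (hat_map_le X.yP _ _) ?_).trans (X.presheaf.hat_trans _ _ _)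
  rw [hat_y, ← 𝕋.ext_swap]
  exact 𝕋.le_hat _ _ _

theorem iInf_pMapFn_hom {X Y : 𝕋.TCat} (f : X ⟶ Y) (φ : X.presheaf.carrier) (y : Y.carrier) :
    (⨅ 𝔶, pMapFn f φ 𝔶 ⇨ₗ Y.str 𝔶 y) = ⨅ 𝔵, φ.fn 𝔵 ⇨ₗ Y.str (𝕋.map f.toFun 𝔵) y := by
  simp only [pMapFn_eq]
  exact iInf_iSup_mul_hom (fun 𝔶 𝔵 => Y.hat_mul_le _ _ _)
    fun 𝔵 => ⟨𝕋.map f.toFun 𝔵, Y.one_le_hat _, le_rfl⟩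

theorem pMult_of_isAdjoint {X : 𝕋.TCat} (hX : Separated X) {S : X.presheaf ⟶ X}
    (hS : 𝕋.IsAdjoint S X.yP) (Ψ : X.presheaf.presheaf.carrier) :
    S.toFun (X.pMultObj Ψ) = S.toFun (pMapObj S Ψ) := by
  refine hX.eq_of_str₀_left fun x => ?_
  rw [adj_str₀ hS, adj_str₀ hS]
  refine Eq.trans ?_ (iInf_pMapFn_hom S Ψ x).symm
  refine (iInf_congr fun 𝔵 => congrArg (· ⇨ₗ _) (X.pMultFn_eq Ψ 𝔵)).trans ?_
  apply le_antisymm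
  · refine iInf_hom_le_iInf_hom fun v 𝔭 H => ?_
    rw [hS.str_eq, presheaf_str]
    refine le_iInf fun 𝔵 => le_hom_iff.2 ((le_of_eq (mul_assoc _ _ _)).trans (le_trans ?_ (H 𝔵)))
    refine mul_le_mul_right ?_ _
    rw [mul_comm]
    exact (mul_le_mul_left (X.mu_opFree_le 𝔭 𝔵) _).trans (X.presheaf.hat_mul_fn_le Ψ _ _)
  · refine iInf_hom_le_iInf_hom fun v 𝔵 H => (H (𝕋.map X.y 𝔵)).trans_eq ?_
    rw [map_map]
    simp only [section_of_isAdjoint hX hS, map_id']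

theorem preservesColims_iff {X Y : 𝕋.TCat} (hX : Separated X) (hY : Separated Y)
    {S : X.presheaf ⟶ X} (hS : 𝕋.IsAdjoint S X.yP) {S' : Y.presheaf ⟶ Y}
    (hS' : 𝕋.IsAdjoint S' Y.yP) (f : X ⟶ Y) :
    PreservesColims X Y f.toFun ↔ ∀ φ, S'.toFun (pMapObj f φ) = f.toFun (S.toFun φ) := by
  have key : ∀ φ y, Y.str₀ (S'.toFun (pMapObj f φ)) y =
      ⨅ 𝔵, φ.fn 𝔵 ⇨ₗ Y.str (𝕋.map f.toFun 𝔵) y := fun φ y =>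
    (adj_str₀ hS' _ y).trans (iInf_pMapFn_hom f φ y)
  constructor
  · intro h φ
    refine hY.eq_of_str₀_left fun y => ?_
    rw [key, h φ _ (adj_str₀ hS φ)]
  · intro h φ x₀ hx y
    have : x₀ = S.toFun φ := hX.eq_of_str₀_left fun x => (hx x).trans (adj_str₀ hS φ x).symm
    rw [this, ← h, key]

end TCat

namespace RepCat

theorem isAdjoint_yV_of_section {X : 𝕋.RepCat} {I : X.vietoris ⟶ X}
    (h : ∀ x, I.toFun (X.y x) = x) : 𝕋.IsAdjoint X.yV.toTFunctor I.toTFunctor := by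
  refine ⟨fun x => ?_, fun φ => ?_⟩
  · exact (X.toTCat.refl₀ x).trans_eq (congrArg (X.toTCat.str₀ x) (h x)).symm
  · refine le_trans ?_ (X.vietoris_str₀ _ _).ge
    refine one_le_iInf_hom fun z => ?_
    have h' := I.str₀_le φ (X.y z)
    rw [str₀_y, h] at h'
    exact h'

theorem adj_str₀ {X : 𝕋.RepCat} {I : X.vietoris ⟶ X}
    (hI : 𝕋.IsAdjoint X.yV.toTFunctor I.toTFunctor) (φ : X.vietoris.toTCat.carrier)
    (x : X.toTCat.carrier) :
    X.toTCat.str₀ x (I.toFun φ) = ⨅ z, φ.fn z ⇨ₗ X.toTCat.str₀ x z :=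
  (hI.str₀_eq x φ).symm.trans (X.vietoris_str₀ (X.y x) φ)

theorem section_of_isAdjoint {X : 𝕋.RepCat} (hX : Separated X.toTCat) {I : X.vietoris ⟶ X}
    (hI : 𝕋.IsAdjoint X.yV.toTFunctor I.toTFunctor) (x : X.toTCat.carrier) :
    I.toFun (X.y x) = x :=
  hX.eq_of_str₀_right fun z => (hI.str₀_eq z (X.y x)).symm.trans (X.str₀_y (X.y z) x)

theorem iInf_vMapFn_hom {X Y : 𝕋.RepCat} (f : X ⟶ Y) (φ : X.vietoris.toTCat.carrier)
    (y : Y.toTCat.carrier) :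
    (⨅ y', vMapFn f φ y' ⇨ₗ Y.toTCat.str₀ y y') =
      ⨅ x, φ.fn x ⇨ₗ Y.toTCat.str₀ y (f.toFun x) := by
  simp only [vMapFn_eq]
  exact iInf_iSup_mul_hom
    (fun y' x => (mul_comm _ _).trans_le (Y.toTCat.trans₀ y (f.toFun x) y'))
    fun x => ⟨f.toFun x, Y.toTCat.refl₀ _, le_rfl⟩

theorem vMult_of_isAdjoint {X : 𝕋.RepCat} (hX : Separated X.toTCat) {I : X.vietoris ⟶ X}
    (hI : 𝕋.IsAdjoint X.yV.toTFunctor I.toTFunctor) (Θ : X.vietoris.vietoris.toTCat.carrier) :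
    I.toFun (X.vMultObj Θ) = I.toFun (vMapObj I Θ) := by
  refine hX.eq_of_str₀_right fun x => ?_
  rw [adj_str₀ hI, adj_str₀ hI]
  refine Eq.trans ?_ (iInf_vMapFn_hom I Θ x).symm
  refine (iInf_congr fun z => congrArg (· ⇨ₗ _) (X.vMultFn_eq Θ z)).trans ?_
  apply le_antisymm
  · refine iInf_hom_le_iInf_hom fun v φ H => ?_
    rw [adj_str₀ hI]
    refine le_iInf fun z => le_hom_iff.2 ((le_of_eq (mul_assoc _ _ _)).trans (le_trans ?_ (H z)))
    exact mul_le_mul_right (X.fn_mul_fn_le Θ φ z) _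
  · refine iInf_hom_le_iInf_hom fun v z H => (H (X.y z)).trans_eq ?_
    rw [section_of_isAdjoint hX hI]

theorem preservesLims_iff {X Y : 𝕋.RepCat} (hX : Separated X.toTCat) (hY : Separated Y.toTCat)
    {I : X.vietoris ⟶ X} (hI : 𝕋.IsAdjoint X.yV.toTFunctor I.toTFunctor) {I' : Y.vietoris ⟶ Y}
    (hI' : 𝕋.IsAdjoint Y.yV.toTFunctor I'.toTFunctor) (f : X ⟶ Y) :
    PreservesLims X.toTCat Y.toTCat f.toFun ↔
      ∀ φ, I'.toFun (vMapObj f φ) = f.toFun (I.toFun φ) := by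
  have key : ∀ φ y, Y.toTCat.str₀ y (I'.toFun (vMapObj f φ)) =
      ⨅ x, φ.fn x ⇨ₗ Y.toTCat.str₀ y (f.toFun x) := fun φ y =>
    (adj_str₀ hI' _ y).trans (iInf_vMapFn_hom f φ y)
  constructor
  · intro h φ
    refine hY.eq_of_str₀_right fun y => ?_
    rw [key, h φ _ (adj_str₀ hI φ)]
  · intro h φ x₀ hx y
    have : x₀ = I.toFun φ := hX.eq_of_str₀_right fun x => (hx x).trans (adj_str₀ hI φ x).symm
    rw [this, ← h, key]

end RepCat

/-! ### Eilenberg-Moore algebras -/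

/-- The algebra for `P` given by a left adjoint of the Yoneda functor. -/
noncomputable def presheafAlgebra (X : 𝕋.SepTCat) (S : X.obj.presheaf ⟶ X.obj)
    (hS : 𝕋.IsAdjoint S X.obj.yP) : 𝕋.presheafMonad.Algebra where
  A := X
  a := ObjectProperty.homMk S
  unit := ObjectProperty.hom_ext _ (TCat.hom_ext (TCat.section_of_isAdjoint X.property hS))
  assoc := ObjectProperty.hom_ext _ (TCat.hom_ext (TCat.pMult_of_isAdjoint X.property hS))

/-- The algebra for `V` given by a right adjoint of the Yoneda functor. -/
noncomputable def vietorisAlgebra (X : 𝕋.SepRepCat) (I : X.obj.vietoris ⟶ X.obj)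
    (hI : 𝕋.IsAdjoint X.obj.yV.toTFunctor I.toTFunctor) : 𝕋.vietorisMonad.Algebra where
  A := X
  a := ObjectProperty.homMk I
  unit := ObjectProperty.hom_ext _ (RepCat.hom_ext (RepCat.section_of_isAdjoint X.property hI))
  assoc := ObjectProperty.hom_ext _ (RepCat.hom_ext (RepCat.vMult_of_isAdjoint X.property hI))

/-- The structure map of an algebra for `P`. -/
def presheafAction (A : 𝕋.presheafMonad.Algebra) : A.A.obj.presheaf ⟶ A.A.obj := A.a.hom

/-- The structure map of an algebra for `V`. -/
def vietorisAction (A : 𝕋.vietorisMonad.Algebra) : A.A.obj.vietoris ⟶ A.A.obj := A.a.hom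

theorem isAdjoint_presheafAction (A : 𝕋.presheafMonad.Algebra) :
    𝕋.IsAdjoint (presheafAction A) A.A.obj.yP :=
  TCat.isAdjoint_yP_of_section fun x =>
    congrArg (fun k : A.A ⟶ A.A => TFunctor.toFun k.hom x) A.unit

theorem isAdjoint_vietorisAction (A : 𝕋.vietorisMonad.Algebra) :
    𝕋.IsAdjoint A.A.obj.yV.toTFunctor (vietorisAction A).toTFunctor :=
  RepCat.isAdjoint_yV_of_section fun x =>
    congrArg (fun k : A.A ⟶ A.A => (PseudoHom.toTFunctor k.hom).toFun x) A.unit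

theorem totallyCocomplete_of_algebra (A : 𝕋.presheafMonad.Algebra) :
    TotallyCocomplete A.A.obj :=
  ⟨_, isAdjoint_presheafAction A⟩

theorem totallyComplete_of_algebra (A : 𝕋.vietorisMonad.Algebra) : TotallyComplete A.A.obj :=
  ⟨_, isAdjoint_vietorisAction A⟩

theorem preservesColims_of_algebra_hom {A B : 𝕋.presheafMonad.Algebra} (f : A ⟶ B) :
    PreservesColims A.A.obj B.A.obj (TFunctor.toFun f.f.hom) :=
  (TCat.preservesColims_iff A.A.property B.A.property (isAdjoint_presheafAction A)
    (isAdjoint_presheafAction B) f.f.hom).2 fun φ =>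
      congrArg (fun k : 𝕋.presheafMonad.obj A.A ⟶ B.A => TFunctor.toFun k.hom φ) f.h

theorem preservesLims_of_algebra_hom {A B : 𝕋.vietorisMonad.Algebra} (f : A ⟶ B) :
    PreservesLims A.A.obj.toTCat B.A.obj.toTCat (PseudoHom.toTFunctor f.f.hom).toFun :=
  (RepCat.preservesLims_iff A.A.property B.A.property (isAdjoint_vietorisAction A)
    (isAdjoint_vietorisAction B) f.f.hom).2 fun φ =>
      congrArg (fun k : 𝕋.vietorisMonad.obj A.A ⟶ B.A =>
        (PseudoHom.toTFunctor k.hom).toFun φ) f.h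

/-- A colimit preserving `T`-functor, as a homomorphism of algebras for `P`. -/
def presheafAlgebraHom {A B : 𝕋.presheafMonad.Algebra} (f : A.A.obj ⟶ B.A.obj)
    (hf : PreservesColims A.A.obj B.A.obj f.toFun) : A ⟶ B where
  f := ObjectProperty.homMk f
  h := ObjectProperty.hom_ext _ (TCat.hom_ext
    ((TCat.preservesColims_iff A.A.property B.A.property (isAdjoint_presheafAction A)
      (isAdjoint_presheafAction B) f).1 hf))

/-- A limit preserving pseudo-homomorphism, as a homomorphism of algebras for `V`. -/
def vietorisAlgebraHom {A B : 𝕋.vietorisMonad.Algebra} (f : A.A.obj ⟶ B.A.obj)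
    (hf : PreservesLims A.A.obj.toTCat B.A.obj.toTCat f.toFun) : A ⟶ B where
  f := ObjectProperty.homMk f
  h := ObjectProperty.hom_ext _ (RepCat.hom_ext
    ((RepCat.preservesLims_iff A.A.property B.A.property (isAdjoint_vietorisAction A)
      (isAdjoint_vietorisAction B) f).1 hf))

theorem vietorisAlgebra_ext {A B : 𝕋.vietorisMonad.Algebra} (h : A.A.obj = B.A.obj) : A = B := by
  have hA := isAdjoint_vietorisAction A
  have hB := isAdjoint_vietorisAction B
  obtain ⟨⟨X, hX⟩, a, _, _⟩ := A
  obtain ⟨⟨Y, hY⟩, b, _, _⟩ := B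
  obtain rfl : X = Y := h
  have hab : a = b := ObjectProperty.hom_ext _ (RepCat.hom_ext fun φ =>
    hX.eq_of_str₀_right fun x => (RepCat.adj_str₀ hA φ x).trans (RepCat.adj_str₀ hB φ x).symm)
  subst hab
  rfl

/-- The representable `T`-category underlying an algebra for `P`. -/
abbrev algebraRepCat (A : 𝕋.presheafMonad.Algebra) : 𝕋.RepCat :=
  (totallyCocomplete_of_algebra A).toRepCat

theorem algebraRepCat_op_totallyComplete (A : 𝕋.presheafMonad.Algebra) :
    TotallyComplete (algebraRepCat A).op :=
  (algebraRepCat A).totallyCocomplete_iff_totallyComplete_op.1 (totallyCocomplete_of_algebra A)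

variable (𝕋) in
/-- Taking duals, from algebras for `P` to algebras for `V`. -/
noncomputable def algebraOp : 𝕋.presheafMonad.Algebra ⥤ 𝕋.vietorisMonad.Algebra where
  obj A := vietorisAlgebra ⟨(algebraRepCat A).op, RepCat.separated_op A.A.property⟩ _
    (algebraRepCat_op_totallyComplete A).choose_spec
  map {A B} f := vietorisAlgebraHom
    (PreservesColims.opHom (X := algebraRepCat A) (Y := algebraRepCat B)
      (preservesColims_of_algebra_hom f))
    (PreservesColims.preservesLims_op (X := algebraRepCat A) (Y := algebraRepCat B)
      (preservesColims_of_algebra_hom f))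

instance : (𝕋.algebraOp).Faithful where
  map_injective {A B} _ _ h := Monad.Algebra.Hom.ext (ObjectProperty.hom_ext _ (TFunctor.ext
    (congrArg (fun k : 𝕋.algebraOp.obj A ⟶ 𝕋.algebraOp.obj B =>
      (PseudoHom.toTFunctor k.f.hom).toFun) h)))

instance : (𝕋.algebraOp).Full where
  map_surjective {A B} g := by
    have hg := PseudoHom.isHom_of_op (X := algebraRepCat A) (Y := algebraRepCat B) g.f.hom
    exact ⟨presheafAlgebraHom ⟨_, hg.isTFunctor (algebraRepCat A).induces
      (algebraRepCat B).induces⟩ (PreservesLims.preservesColims hg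
        (preservesLims_of_algebra_hom g)), rfl⟩

instance : (𝕋.algebraOp).EssSurj where
  mem_essImage B := by
    obtain ⟨S, hS⟩ := (totallyComplete_of_algebra B).op
    exact ⟨presheafAlgebra ⟨B.A.obj.op.toTCat, RepCat.separated_op B.A.property⟩ S hS,
      ⟨eqToIso (vietorisAlgebra_ext B.A.obj.op_op)⟩⟩

instance : (𝕋.algebraOp).IsEquivalence where

end TopologicalTheory

theorem mainTheorem2 {V : Type u} [CommMonoid V] [CompleteLattice V] [IsQuantale V]
    (𝕋 : TopologicalTheory V) [Subsingleton (𝕋.F PUnit.{u + 1})] :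
    (∀ X : 𝕋.RepCat,
      TopologicalTheory.TotallyCocomplete X.toTCat ↔ TopologicalTheory.TotallyComplete X.op) ∧
    (∃ F : 𝕋.Cocts ⥤ 𝕋.Cts,
      F.IsEquivalence ∧
      F ⋙ TopologicalTheory.Cts.forget 𝕋 = TopologicalTheory.Cocts.forget 𝕋 ∧
      (∀ X : 𝕋.Cocts, ∃ h : 𝕋.Representable X.toTCat,
        (F.obj X).toRepCat = TopologicalTheory.RepCat.op ⟨X.toTCat, h⟩) ∧
      ∃ G : (TopologicalTheory.Cocts.Sep 𝕋).FullSubcategory ⥤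
          (TopologicalTheory.Cts.Sep 𝕋).FullSubcategory,
        G.IsEquivalence ∧
        G ⋙ (TopologicalTheory.Cts.Sep 𝕋).ι = (TopologicalTheory.Cocts.Sep 𝕋).ι ⋙ F) ∧
    ∃ E : 𝕋.presheafMonad.Algebra ≌ 𝕋.vietorisMonad.Algebra,
      E.functor ⋙ 𝕋.vietorisMonadForget = 𝕋.presheafMonadForget ∧
      ∀ A : 𝕋.presheafMonad.Algebra, ∃ h : 𝕋.Representable A.A.obj,
        (E.functor.obj A).A.obj = TopologicalTheory.RepCat.op ⟨A.A.obj, h⟩ :=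
  ⟨fun X => X.totallyCocomplete_iff_totallyComplete_op,
    ⟨𝕋.coctsOp, inferInstance, rfl, fun X => ⟨X.totallyCocomplete.representable, rfl⟩,
      𝕋.sepCoctsOp, inferInstance, TopologicalTheory.sepCoctsOp_ι⟩,
    𝕋.algebraOp.asEquivalence, rfl,
    fun A => ⟨(TopologicalTheory.totallyCocomplete_of_algebra A).representable, rfl⟩⟩
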